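/- **Conventions.** A signed graph $\Sigma=(V,E,\sigma)$ is a finite graph, loops and multiple edges allowed, with signs $\sigma:E\to\{1,-1\}$. Every edge has two half-edges, attached to its end-vertices (to the same vertex if it is a loop). An orientation $\varepsilon$ puts an arrow $\varepsilon(u,e)\in\{1,-1\}$ on each half-edge $(u,e)$ (with $1$ meaning "away from $u$") so that $\varepsilon(u,e)\varepsilon(v,e)=-\sigma(e)$ for $e=uv$. For two orientations, $[\varepsilon,\varepsilon'](e)$ is $1$ if they agree on the half-edges of $e$ and $-1$ otherwise. A function $f:E\to\mathbb Z$ is an integral flow of $(\Sigma,\varepsilon)$ if for each vertex $v$ the sum of $\varepsilon(u,e)f(e)$ over all half-edges $(u,e)$ with $u=v$ is $0$. A nontrivial (that is, nonzero) integral flow is indecomposable if it is not a sum $f_1+f_2$ of nontrivial integral flows with $f_1(e)f_2(e)\ge 0$ for all $e\in E$. The orientation $\varepsilon_f$ is obtained from $\varepsilon$ by reversing both arrows on every edge $e$ with $f(e)<0$. A cycle is a simple closed path (a loop is a cycle of length 1, two parallel edges form a cycle of length 2); it is balanced if the product of the signs of its edges is $1$, and unbalanced otherwise. A *cycle-tree*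 is a connected subgraph $T$ with at least one edge that is the union of edge-disjoint cycles (*block cycles*) and vertex-disjoint simple paths of positive length (*block paths*) such that: (1) the block cycles are all the cycles in $T$; (2) two block cycles have at most one common vertex, and no vertex lies on three block cycles; (3) each block path meets exactly two block cycles, one exactly in its initial vertex and the other exactly in its terminal vertex; (4) the *intersection vertices*, namely the common vertices of two block cycles and the end-vertices of block paths, are cut-points of $T$ (points whose removal increases the number of components of $T$ as a one-dimensional complex). It is *Eulerian* if each balanced block cycle has an even number and each unbalanced block cycle an odd number of intersection vertices. An *end-block cycle* is a block cycle with exactly one intersection vertex. The indicator $I_T:E\to\mathbb Z$ is $1$ on the block cycles, $2$ on the block paths and $0$ elsewhere. A *direction* of $T$ is an orientation $\varepsilon_T$ of $T$ such that $T$ has no sink and no source, while each block cycle has a sink or a source at each cut-point of $T$ on it. A *circuit* is an Eulerian cycle-tree that does not properly contain an Eulerian cycle-tree; it is of *Type III*, written $CPC'$, if it consists of two vertex-disjoint unbalanced cycles $C,C'$ and a simple path $P$ of positive length that meets $C$ exactly in its initial vertex and $C'$ exactly in its terminal vertex. **Theorem (Classification of Indecomposable Integral Flows).** Let $(\Sigma,\varepsilon)$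 be an oriented signed graph. (a) An integral flow $f$ of $(\Sigma,\varepsilon)$ is indecomposable if and only if $f=[\varepsilon,\varepsilon_f]\cdot I_T$ for some Eulerian cycle-tree $T$ of $\Sigma$. (b) Let $T$ be an Eulerian cycle-tree of $\Sigma$ that is not a circuit, and let $W$ be a closed walk on $T$ that uses all edges of $T$ and has minimum length among such walks. Then, up to the choice of its starting point, $$W=C_0P_1C_1P_2\cdots P_kC_kP_{k+1},\qquad k\ge 1,$$ where, with $C_{k+1}=C_0$ and for $0\le i\le k$: (i) $C_0,\dots,C_k$ are all the end-block cycles of $T$, each occurring exactly once and traversed exactly once around, and each $P_{i+1}$ is a simple open path of positive length; (ii) each edge of a block cycle that is not an end-block cycle lies in exactly one of the paths $P_1,\dots,P_{k+1}$, and each edge of a block path of $T$ lies in exactly two of them; (iii) each $C_iP_{i+1}C_{i+1}$ is a circuit of Type III, and every direction of $T$ restricts to a direction of it; (iv) $I_T=\frac12\sum_{i=0}^{k} I_{C_iP_{i+1}C_{i+1}}$. -/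

import Mathlib

/-- A signed graph with vertex set `V` and edge set `E`; loops and multiple edges are allowed.
Every edge `e` has two half-edges `(e, false)` and `(e, true)`, attached to the (possibly equal)
end-vertices `G.inc e false` and `G.inc e true`, and a sign `G.sign e = ±1`. -/
structure SignedGraph (V E : Type*) where
  inc : E → Bool → V
  sign : E → ℤˣ

namespace SignedGraph

variable {V E : Type*} (G : SignedGraph V E)

/-! ### Walks, paths and cycles

A walk is recorded as the list of its steps. The step `(e, b)` traverses the edge `e` from
`G.inc e b` to `G.inc e (!b)`. -/

/-- The vertex at which the step `d` starts. -/
def src (d : E × Bool) : V := G.inc d.1 d.2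

/-- The vertex at which the step `d` arrives. -/
def tgt (d : E × Bool) : V := G.inc d.1 (!d.2)

/-- `G.IsWalk u l v`: the steps `l` form a walk with initial vertex `u` and terminal vertex `v`. -/
def IsWalk (u : V) (l : List (E × Bool)) (v : V) : Prop :=
  match l with
  | [] => u = v
  | d :: l => G.src d = u ∧ IsWalk (G.tgt d) l v

/-- The support of a walk: the set of the edges that it uses. -/
def supp (l : List (E × Bool)) : Set E := {e | ∃ b, (e, b) ∈ l}

/-- The end-vertices of the edges in `S`. -/
def verts (S : Set E) : Set V := {v | ∃ e ∈ S, ∃ b, G.inc e b = v}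

/-- `l` goes once around a cycle, starting and ending at `u`: a closed walk of positive length
that repeats neither vertices (except for `u` at the end) nor edges. -/
def IsCycleWalk (u : V) (l : List (E × Bool)) : Prop :=
  l ≠ [] ∧ G.IsWalk u l u ∧ (l.map G.tgt).Nodup ∧ (l.map Prod.fst).Nodup

/-- `C` is the edge set of a cycle. -/
def IsCycle (C : Set E) : Prop := ∃ u l, G.IsCycleWalk u l ∧ supp l = C

/-- The (edge sets of the) cycles contained in `S`. -/
def cyclesIn (S : Set E) : Set (Set E) := {C | G.IsCycle C ∧ C ⊆ S}

/-- The sign of a cycle: the product of the signs of its edges. -/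
noncomputable def cycleSign (C : Set E) : ℤˣ := ∏ᶠ e ∈ C, G.sign e

/-- A simple path of positive length. -/
structure SimplePath where
  init : V
  term : V
  steps : List (E × Bool)
  isWalk : G.IsWalk init steps term
  nodup : (init :: steps.map G.tgt).Nodup
  pos : steps ≠ []

variable {G} in
/-- The edges of a simple path. -/
def SimplePath.edges (P : G.SimplePath) : Set E := supp P.steps

variable {G} in
/-- The vertices of a simple path. -/
def SimplePath.verts (P : G.SimplePath) : Set V := G.verts P.edges

/-- `W` is a closed walk that uses only edges of `S` and uses every edge of `S`. -/
def IsCoveringClosedWalk (S : Set E) (W : List (E × Bool)) : Prop :=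
  (∃ u, G.IsWalk u W u) ∧ supp W = S

/-- `W` is a closed walk in `S` of minimum length using all edges of `S`. -/
def IsMinCoveringClosedWalk (S : Set E) (W : List (E × Bool)) : Prop :=
  G.IsCoveringClosedWalk S W ∧ ∀ W', G.IsCoveringClosedWalk S W' → W.length ≤ W'.length

/-! ### Connectedness and cut-points -/

/-- The edges `e` and `e'` of `S` lie in the same component of the topological space that is
left when the points of `X` are removed from the one-dimensional complex formed by `S`. -/
def SameComponent (S : Set E) (X : Set V) (e e' : E) : Prop :=
  Relation.ReflTransGen
    (fun a b => a ∈ S ∧ b ∈ S ∧ ∃ w, w ∉ X ∧ (∃ i, G.inc a i = w) ∧ ∃ j, G.inc b j = w) e e'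

/-- `S` has an edge, and the subgraph that it forms is connected. -/
def IsConnected (S : Set E) : Prop :=
  S.Nonempty ∧ ∀ e ∈ S, ∀ e' ∈ S, G.SameComponent S ∅ e e'

/-- The removal of the point `v` splits a component of the complex formed by `S`. In particular,
the vertex of a loop is a cut-point as soon as another edge of `S` is attached to it. -/
def IsCutPoint (S : Set E) (v : V) : Prop :=
  ∃ e ∈ S, ∃ e' ∈ S, G.SameComponent S ∅ e e' ∧ ¬ G.SameComponent S {v} e e'

/-! ### Cycle-trees -/

/-- A cycle-tree. Its block cycles are all the cycles contained in it; the block paths are part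
of the data. (Block paths and block cycles are automatically edge-disjoint, since a block path is
a simple path that meets each block cycle in at most one vertex.) -/
structure CycleTree where
  edges : Set E
  paths : Set G.SimplePath
  connected : G.IsConnected edges
  /-- the block cycles and the block paths make up the whole subgraph -/
  cover : edges = (⋃ C ∈ G.cyclesIn edges, C) ∪ ⋃ P ∈ paths, P.edges
  /-- two block cycles have no common edge and at most one common vertex -/
  cycles_inter : ∀ C ∈ G.cyclesIn edges, ∀ C' ∈ G.cyclesIn edges, C ≠ C' →
    Disjoint C C' ∧ (G.verts C ∩ G.verts C').Subsingleton
  /-- no vertex lies on three block cycles -/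
  cycles_le_two : ∀ v, {C ∈ G.cyclesIn edges | v ∈ G.verts C}.encard ≤ 2
  /-- the block paths are vertex-disjoint -/
  paths_disjoint : ∀ P ∈ paths, ∀ Q ∈ paths, P ≠ Q → Disjoint P.verts Q.verts
  /-- a block path meets exactly two block cycles, one exactly in its initial vertex and the other
  exactly in its terminal vertex -/
  paths_inter : ∀ P ∈ paths, ∃ C ∈ G.cyclesIn edges, ∃ C' ∈ G.cyclesIn edges, C ≠ C' ∧
    P.verts ∩ G.verts C = {P.init} ∧ P.verts ∩ G.verts C' = {P.term} ∧
    ∀ D ∈ G.cyclesIn edges, D ≠ C → D ≠ C' → Disjoint P.verts (G.verts D)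
  /-- common vertices of two block cycles are cut-points -/
  cut_cycles : ∀ C ∈ G.cyclesIn edges, ∀ C' ∈ G.cyclesIn edges, C ≠ C' →
    ∀ v ∈ G.verts C ∩ G.verts C', G.IsCutPoint edges v
  /-- end-vertices of block paths are cut-points -/
  cut_paths : ∀ P ∈ paths, G.IsCutPoint edges P.init ∧ G.IsCutPoint edges P.term

namespace CycleTree

variable {G} (T : G.CycleTree)

/-- The block cycles: all cycles of the cycle-tree. -/
def cycles : Set (Set E) := G.cyclesIn T.edges

/-- The intersection vertices: the common vertices of two block cycles and the end-vertices of
the block paths. -/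
def interVerts : Set V :=
  {v | (∃ C ∈ T.cycles, ∃ C' ∈ T.cycles, C ≠ C' ∧ v ∈ G.verts C ∧ v ∈ G.verts C') ∨
    ∃ P ∈ T.paths, v = P.init ∨ v = P.term}

/-- The Parity Condition: balanced block cycles have an even number of intersection vertices, and
unbalanced block cycles have an odd number of them. -/
def IsEulerian : Prop :=
  ∀ C ∈ T.cycles,
    (G.cycleSign C = 1 → Even (G.verts C ∩ T.interVerts).ncard) ∧
    (G.cycleSign C = -1 → Odd (G.verts C ∩ T.interVerts).ncard)

/-- An end-block cycle: a block cycle with exactly one intersection vertex. -/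
def IsEndBlock (C : Set E) : Prop :=
  C ∈ T.cycles ∧ (G.verts C ∩ T.interVerts).ncard = 1

open Classical in
/-- The indicator `I_T`. -/
noncomputable def indicator (e : E) : ℤ :=
  if ∃ C ∈ T.cycles, e ∈ C then 1 else if ∃ P ∈ T.paths, e ∈ P.edges then 2 else 0

/-- A (signed graph) circuit: an Eulerian cycle-tree that does not properly contain any Eulerian
cycle-tree. -/
def IsCircuit : Prop :=
  T.IsEulerian ∧ ∀ T' : G.CycleTree, T'.IsEulerian → ¬ T'.edges ⊂ T.edges

/-- `T = C₁ P C₂` is a circuit of Type III: it consists of two vertex-disjoint unbalanced cycles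
`C₁`, `C₂` and of a simple path `P` of positive length that meets `C₁` exactly in its initial
vertex and `C₂` exactly in its terminal vertex. -/
def IsTypeIII (C₁ : Set E) (P : G.SimplePath) (C₂ : Set E) : Prop :=
  T.IsCircuit ∧ T.edges = C₁ ∪ P.edges ∪ C₂ ∧
  G.IsCycle C₁ ∧ G.IsCycle C₂ ∧ G.cycleSign C₁ = -1 ∧ G.cycleSign C₂ = -1 ∧
  Disjoint (G.verts C₁) (G.verts C₂) ∧
  P.verts ∩ G.verts C₁ = {P.init} ∧ P.verts ∩ G.verts C₂ = {P.term}

end CycleTree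

/-! ### Orientations and flows -/

/-- An orientation: every half-edge carries an arrow, `1` if it points away from its end-vertex
and `-1` if it points toward it, so that `ε(u,e) ε(v,e) = -σ(e)` for an edge `e = uv`. -/
structure Orientation where
  arrow : E → Bool → ℤˣ
  arrow_mul : ∀ e, arrow e false * arrow e true = -G.sign e

namespace Orientation

variable {G} (ε : G.Orientation)

/-- The restriction of `ε` to the cycle-tree `T` is a direction of `T`: there is neither a sink
nor a source in `T`, while every block cycle has a sink or a source at each cut-point of `T`
on it. -/
def IsDirection (T : G.CycleTree) : Prop :=
  (∀ v ∈ G.verts T.edges, ∀ s : ℤˣ,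
    ¬ ∀ e ∈ T.edges, ∀ b, G.inc e b = v → ε.arrow e b = s) ∧
  ∀ C ∈ T.cycles, ∀ v ∈ G.verts C, G.IsCutPoint T.edges v →
    ∃ s : ℤˣ, ∀ e ∈ C, ∀ b, G.inc e b = v → ε.arrow e b = s

/-- The coupling `[ε, ε']` of two orientations of the whole graph. -/
def coupling (ε' : G.Orientation) (e : E) : ℤ :=
  if ∀ b, ε.arrow e b = ε'.arrow e b then 1 else -1

/-- The orientation `ε_f`: the arrows of `ε` are reversed on the edges with `f < 0`. -/
def ofFun (f : E → ℤ) : G.Orientation where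
  arrow e b := if f e < 0 then -ε.arrow e b else ε.arrow e b
  arrow_mul e := by
    by_cases h : f e < 0 <;> simp [h, ε.arrow_mul e]

variable [Fintype E]

open Classical in
/-- The boundary `(∂f)(v)`: the sum of `ε(u,e) f(e)` over all half-edges `(u,e)` with `u = v`. -/
noncomputable def boundary (f : E → ℤ) (v : V) : ℤ :=
  ∑ e : E, ∑ b : Bool, if G.inc e b = v then (ε.arrow e b : ℤ) * f e else 0

/-- An integral flow. -/
def IsFlow (f : E → ℤ) : Prop := ∀ v, ε.boundary f v = 0

/-- An indecomposable flow: a nontrivial integral flow that is not the sum of two nontrivial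
integral flows having the same sign at every edge. -/
def IsIndecomposable (f : E → ℤ) : Prop :=
  ε.IsFlow f ∧ f ≠ 0 ∧
  ¬ ∃ f₁ f₂ : E → ℤ, ε.IsFlow f₁ ∧ ε.IsFlow f₂ ∧ f₁ ≠ 0 ∧ f₂ ≠ 0 ∧
    (∀ e, 0 ≤ f₁ e * f₂ e) ∧ f = f₁ + f₂

end Orientation

end SignedGraph

/-! Part (a). Reversing arrows turns an integral flow `f` of `ε` into the nonnegative flow `|f|` of
`ε.ofFun f`, and decompositions of `f` without cancellation into decompositions of `|f|` into
nonnegative flows. A directed walk is described by its states, a state being a vertex together with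
the arrow by which it is to be left. A longest directed walk below `|f|` must close (`exists_tour`)
and is then itself a flow. So if `f` is indecomposable, `|f|` counts the uses of the edges by one
closed directed walk that contains no smaller one. Such a walk repeats no state, so it visits each
vertex at most twice. If it visits `v` twice, its two parts meet only in `v`, since otherwise
rerouting would shorten it (`IsTour.verts_inter`). Hence each vertex has two half-edges of weight
one with opposite arrows, or it separates the support into two sides, each with equal arrows and
total weight two (`IsCactus`). From this local picture the edges of weight one form the block
cycles, the maximal paths of weight two are the block paths, and the intersection vertices on a
cycle are its sinks and sources. Their number determines the sign of the cycle (`IsCycle.sign_eq`),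
which is the Parity Condition.

Conversely, let the indicator of an Eulerian `T` be a flow. Every intersection vertex is a sink or a
source of each block cycle on it: by parity a violation on a cycle comes with a second one,
conservation passes it on to a further cycle beyond, and this descent cannot go on forever
(`isConst_of_inter`). If now the indicator is a sum of two nonnegative flows, the handshake lemma on
each side of a cut-point and conservation show that a summand vanishing on one edge vanishes on all
edges meeting it (`flow_eq_zero_of_star`). On a cycle edge one of the summands vanishes, so it
vanishes everywhere.

Part (b). A closed walk covering `T` uses each path edge an even number of times, so it uses every
edge at least as often as the indicator says. An Eulerian tour attains this bound, and therefore so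
does every minimum walk (`isEulerTour_of_min`). At an intersection vertex both sides have weighted
degree two, so the tour has to change sides there (`IsEulerTour.crossing`). A shortest closed piece
of the tour thus goes round a block cycle with no intersection vertex besides its base, which is an
end-block cycle when `T` is not a circuit (`IsEulerTour.exists_endBlock`). Cut the tour into maximal
segments on and off the end-block cycles. The segments on them go once round one cycle, those off
them are simple paths. End-block cycles are unbalanced and pairwise vertex-disjoint, so consecutive
ones and the path between them form a circuit of Type III (`exists_typeIII`). The remaining claims
count edge uses. -/

namespace SignedGraph

/-! ### Walks in a digraph and their closed pieces -/

section Wk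

variable {D X : Type*} {s t : D → X}

/-- `Wk s t u l v`: the arcs `l` form a walk from `u` to `v` in the digraph in which the arc `d`
goes from `s d` to `t d`. -/
def Wk (s t : D → X) : X → List D → X → Prop
  | u, [], v => u = v
  | u, d :: l, v => s d = u ∧ Wk s t (t d) l v

@[simp] theorem wk_nil {u v : X} : Wk s t u [] v ↔ u = v := Iff.rfl

@[simp] theorem wk_cons {u v : X} {d : D} {l : List D} :
    Wk s t u (d :: l) v ↔ s d = u ∧ Wk s t (t d) l v := Iff.rfl

theorem wk_append {u v : X} {l l' : List D} :
    Wk s t u (l ++ l') v ↔ ∃ w, Wk s t u l w ∧ Wk s t w l' v := by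
  induction l generalizing u with
  | nil => simp
  | cons d l ih => simp [ih, and_assoc]

theorem Wk.append {u v w : X} {l l' : List D} (h : Wk s t u l w) (h' : Wk s t w l' v) :
    Wk s t u (l ++ l') v := wk_append.2 ⟨w, h, h'⟩

theorem Wk.last {u v : X} {l : List D} {d : D} (h : Wk s t u (l ++ [d]) v) : t d = v := by
  obtain ⟨w, -, h⟩ := wk_append.1 h
  simpa using h.2

theorem Wk.map {Y : Type*} (φ : X → Y) {u v : X} {l : List D} (h : Wk s t u l v) :
    Wk (φ ∘ s) (φ ∘ t) (φ u) l (φ v) := by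
  induction l generalizing u with
  | nil => exact congrArg φ h
  | cons d l ih => exact ⟨congrArg φ h.1, ih h.2⟩

theorem Wk.eq_end {u v v' : X} {l : List D} (h : Wk s t u l v) (h' : Wk s t u l v') : v = v' := by
  induction l generalizing u with
  | nil => exact h.symm.trans h'
  | cons d l ih => exact ih h.2 h'.2

/-- The initial vertices followed by the end of a walk are its start followed by the terminal
vertices. -/
theorem Wk.map_append {u v : X} {l : List D} (h : Wk s t u l v) :
    l.map s ++ [v] = u :: l.map t := by
  induction l generalizing u with
  | nil => simpa using h.symm
  | cons d l ih => simp [ih h.2, h.1]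

theorem Wk.map_perm {u : X} {l : List D} (h : Wk s t u l u) : (l.map s).Perm (l.map t) := by
  have h1 : (u :: l.map s).Perm (u :: l.map t) := by
    rw [← h.map_append]
    exact (List.perm_append_singleton u (l.map s)).symm
  exact h1.cons_inv

/-- The twist `τ` is there for directed walks, whose reversal changes the sign of every state. -/
theorem Wk.reverse {s' t' : D → X} {τ : X → X} {f : D → D} (hs : ∀ d, s' (f d) = τ (t d))
    (ht : ∀ d, t' (f d) = τ (s d)) {u v : X} {l : List D} (h : Wk s t u l v) :
    Wk s' t' (τ v) (l.map f).reverse (τ u) := by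
  induction l generalizing u with
  | nil => simpa using (congrArg τ h).symm
  | cons d l ih =>
    rw [List.map_cons, List.reverse_cons]
    exact (ih h.2).append ⟨hs d, by simp [ht, h.1]⟩

theorem Wk.rotate {u : X} {l : List D} (h : Wk s t u l u) {x : X} (hx : x ∈ l.map s) :
    ∃ l', l.IsRotated l' ∧ Wk s t x l' x := by
  obtain ⟨d, hd, rfl⟩ := List.mem_map.1 hx
  obtain ⟨l1, l2, rfl⟩ := List.append_of_mem hd
  obtain ⟨w, h1, h2⟩ := wk_append.1 h
  obtain rfl : s d = w := h2.1
  exact ⟨d :: l2 ++ l1, List.isRotated_append, h2.append h1⟩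

theorem Wk.of_isRotated {u : X} {l l' : List D} (h : Wk s t u l u) (hr : l.IsRotated l') :
    ∃ x, Wk s t x l' x := by
  obtain ⟨n, rfl⟩ := hr
  rw [List.rotate_eq_drop_append_take_mod]
  rw [← List.take_append_drop (n % l.length) l] at h
  obtain ⟨w, h1, h2⟩ := wk_append.1 h
  exact ⟨w, h2.append h1⟩

/-- A vertex that occurs twice cuts out a nonempty closed piece. This is the source of all
shortcuts, for walks on vertices as well as on states. -/
theorem Wk.exists_closed_infix {u v : X} {l : List D} (h : Wk s t u l v)
    (hn : ¬ (u :: l.map t).Nodup) :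
    ∃ l1 l2 l3 w, l = l1 ++ l2 ++ l3 ∧ l2 ≠ [] ∧ Wk s t u l1 w ∧ Wk s t w l2 w ∧
      Wk s t w l3 v := by
  induction l generalizing u with
  | nil => simp at hn
  | cons d l ih =>
    by_cases hd : (t d :: l.map t).Nodup
    · have hu : u ∈ (d :: l).map t := by
        by_contra hu
        exact hn (List.nodup_cons.2 ⟨hu, hd⟩)
      obtain ⟨x, hx, rfl⟩ := List.mem_map.1 hu
      obtain ⟨a, b, hab⟩ := List.append_of_mem hx
      refine ⟨[], a ++ [x], b, t x, by simp [hab], by simp, rfl, ?_⟩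
      rw [hab, ← List.singleton_append, ← List.append_assoc] at h
      obtain ⟨w, h1, h2⟩ := wk_append.1 h
      obtain rfl : t x = w := h1.last
      exact ⟨h1, h2⟩
    · obtain ⟨l1, l2, l3, w, rfl, h0, h1, h2, h3⟩ := ih h.2 hd
      exact ⟨d :: l1, l2, l3, w, by simp, h0, ⟨h.1, h1⟩, h2, h3⟩

theorem Wk.exists_simple {u v : X} {l : List D} (h : Wk s t u l v) :
    ∃ l', Wk s t u l' v ∧ (u :: l'.map t).Nodup ∧ l' ⊆ l := by
  induction hn : l.length using Nat.strong_induction_on generalizing l with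
  | _ n ih =>
    by_cases hd : (u :: l.map t).Nodup
    · exact ⟨l, h, hd, List.Subset.refl _⟩
    · obtain ⟨l1, l2, l3, w, rfl, h0, h1, h2, h3⟩ := h.exists_closed_infix hd
      have := List.length_pos_iff.2 h0
      obtain ⟨l', h4, h5, h6⟩ := ih (l1 ++ l3).length (by simp at hn ⊢; omega)
        (h1.append h3) rfl
      exact ⟨l', h4, h5, fun x hx => by have := h6 hx; simp at this ⊢; tauto⟩

/-- Only terminal vertices are compared, because the start of a closed walk recurs as its end. -/
theorem Wk.exists_min_closed {u : X} {l : List D} (h : Wk s t u l u) (hl : l ≠ []) :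
    ∃ l1 l2 l3 w, l = l1 ++ l2 ++ l3 ∧ l2 ≠ [] ∧ Wk s t w l2 w ∧ (l2.map t).Nodup := by
  induction hn : l.length using Nat.strong_induction_on generalizing l u with
  | _ n ih =>
    by_cases hd : (l.map t).Nodup
    · exact ⟨[], l, [], u, by simp, hl, h, hd⟩
    · obtain ⟨d, l, rfl⟩ := List.exists_cons_of_ne_nil hl
      -- The repetition `hd` concerns the vertices of the walk without its first step, so the closed
      -- piece found in it is strictly shorter.
      obtain ⟨l1, l2, l3, w, rfl, h0, h1, h2, h3⟩ := h.2.exists_closed_infix hd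
      obtain ⟨m1, m2, m3, x, rfl, h4⟩ := ih l2.length (by simp at hn; omega) h2 h0 rfl
      exact ⟨d :: l1 ++ m1, m2, m3 ++ l3, x, by simp, h4⟩

end Wk

variable {V E : Type*} {G : SignedGraph V E}

theorem isWalk_iff {u v : V} {l : List (E × Bool)} :
    G.IsWalk u l v ↔ Wk G.src G.tgt u l v := by
  induction l generalizing u with
  | nil => rfl
  | cons d l ih => exact and_congr Iff.rfl ih

/-! ### Half-edges

The step `d` is identified with the half-edge at which it starts. -/

/-- The reverse of a step; the other half-edge of an edge. -/
def flip (d : E × Bool) : E × Bool := (d.1, !d.2)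

@[simp] theorem flip_fst (d : E × Bool) : (flip d).1 = d.1 := rfl

@[simp] theorem flip_flip (d : E × Bool) : flip (flip d) = d := by simp [flip]

theorem flip_ne (d : E × Bool) : flip d ≠ d := fun h => by
  have := congrArg Prod.snd h
  simp [flip] at this

@[simp] theorem src_flip (d : E × Bool) : G.src (flip d) = G.tgt d := rfl

@[simp] theorem tgt_flip (d : E × Bool) : G.tgt (flip d) = G.src d := by simp [flip, src, tgt]

theorem eq_or_eq_flip {d d' : E × Bool} (h : d.1 = d'.1) : d = d' ∨ d = flip d' := by
  obtain ⟨e, b⟩ := d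
  obtain ⟨e', b'⟩ := d'
  obtain rfl : e = e' := h
  cases b <;> cases b' <;> simp [flip]

theorem flip_eq_iff {d d' : E × Bool} : flip d = d' ↔ d = flip d' :=
  ⟨fun h => by rw [← h, flip_flip], fun h => by rw [h, flip_flip]⟩

variable (G) in
/-- The half-edges of the edges in `S` that are attached to `v`. -/
def star (S : Set E) (v : V) : Set (E × Bool) := {h | h.1 ∈ S ∧ G.src h = v}

theorem mem_star {S : Set E} {v : V} {h : E × Bool} : h ∈ G.star S v ↔ h.1 ∈ S ∧ G.src h = v :=
  Iff.rfl

theorem star_mono {S S' : Set E} (h : S ⊆ S') (v : V) : G.star S v ⊆ G.star S' v :=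
  fun _ hh => ⟨h hh.1, hh.2⟩

theorem mem_verts {S : Set E} {v : V} : v ∈ G.verts S ↔ ∃ h, h ∈ G.star S v := by
  constructor
  · rintro ⟨e, he, b, h⟩
    exact ⟨(e, b), he, h⟩
  · rintro ⟨h, he, hv⟩
    exact ⟨h.1, he, h.2, hv⟩

theorem verts_mono {S S' : Set E} (h : S ⊆ S') : G.verts S ⊆ G.verts S' :=
  fun _ ⟨e, he, hv⟩ => ⟨e, h he, hv⟩

theorem verts_union (S S' : Set E) : G.verts (S ∪ S') = G.verts S ∪ G.verts S' := by
  ext v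
  simp only [verts, Set.mem_union, Set.mem_ofPred_eq]
  constructor
  · rintro ⟨e, he | he, h⟩
    exacts [Or.inl ⟨e, he, h⟩, Or.inr ⟨e, he, h⟩]
  · rintro (⟨e, he, h⟩ | ⟨e, he, h⟩)
    exacts [⟨e, Or.inl he, h⟩, ⟨e, Or.inr he, h⟩]

theorem src_mem_verts {S : Set E} {h : E × Bool} (hh : h.1 ∈ S) : G.src h ∈ G.verts S :=
  ⟨h.1, hh, h.2, rfl⟩

theorem tgt_mem_verts {S : Set E} {h : E × Bool} (hh : h.1 ∈ S) : G.tgt h ∈ G.verts S :=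
  ⟨h.1, hh, !h.2, rfl⟩

theorem mem_supp {l : List (E × Bool)} {e : E} : e ∈ supp l ↔ e ∈ l.map Prod.fst := by
  simp [supp]

theorem mem_supp' {l : List (E × Bool)} {h : E × Bool} : h.1 ∈ supp l ↔ h ∈ l ∨ flip h ∈ l := by
  obtain ⟨e, b⟩ := h
  cases b <;> simp [supp, flip, or_comm]

theorem fst_mem_supp {l : List (E × Bool)} {d : E × Bool} (h : d ∈ l) : d.1 ∈ supp l := ⟨d.2, h⟩

@[simp] theorem supp_nil : supp ([] : List (E × Bool)) = ∅ := by simp [supp]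

theorem supp_append (l l' : List (E × Bool)) : supp (l ++ l') = supp l ∪ supp l' := by
  ext e
  simp [mem_supp]

theorem supp_cons (d : E × Bool) (l : List (E × Bool)) : supp (d :: l) = {d.1} ∪ supp l := by
  ext e
  simp [mem_supp]

theorem supp_mono {l l' : List (E × Bool)} (h : l ⊆ l') : supp l ⊆ supp l' :=
  fun _ ⟨b, hb⟩ => ⟨b, h hb⟩

theorem supp_perm {l l' : List (E × Bool)} (h : l.Perm l') : supp l = supp l' := by
  ext e
  simp only [mem_supp]
  exact (h.map _).mem_iff

theorem supp_nonempty {l : List (E × Bool)} (h : l ≠ []) : (supp l).Nonempty := by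
  obtain ⟨d, l, rfl⟩ := List.exists_cons_of_ne_nil h
  exact ⟨d.1, fst_mem_supp (by simp)⟩

/-! ### Components -/

theorem SameComponent.symm {S : Set E} {X : Set V} {e e' : E} (h : G.SameComponent S X e e') :
    G.SameComponent S X e' e := by
  induction h with
  | refl => exact .refl
  | tail _ hab ih =>
    obtain ⟨ha, hb, w, hw, hi, hj⟩ := hab
    exact .head ⟨hb, ha, w, hw, hj, hi⟩ ih

theorem SameComponent.trans {S : Set E} {X : Set V} {a b c : E} (h : G.SameComponent S X a b)
    (h' : G.SameComponent S X b c) : G.SameComponent S X a c := Relation.ReflTransGen.trans h h'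

theorem SameComponent.refl {S : Set E} {X : Set V} (e : E) : G.SameComponent S X e e :=
  Relation.ReflTransGen.refl

theorem SameComponent.mono {S S' : Set E} {X X' : Set V} (hS : S ⊆ S') (hX : X' ⊆ X) {e e' : E}
    (h : G.SameComponent S X e e') : G.SameComponent S' X' e e' := by
  induction h with
  | refl => exact Relation.ReflTransGen.refl
  | tail _ hab ih =>
    obtain ⟨ha, hb, w, hw, hi, hj⟩ := hab
    exact .tail ih ⟨hS ha, hS hb, w, fun h => hw (hX h), hi, hj⟩

theorem SameComponent.of_star {S : Set E} {X : Set V} {v : V} {h k : E × Bool}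
    (hh : h ∈ G.star S v) (hk : k ∈ G.star S v) (hv : v ∉ X) : G.SameComponent S X h.1 k.1 :=
  Relation.ReflTransGen.single ⟨hh.1, hk.1, v, hv, ⟨h.2, hh.2⟩, ⟨k.2, hk.2⟩⟩

/-- Induction along the chain of adjacent edges. It reduces connectivity to a local check at each
vertex, and most separation and propagation arguments are instances of it. -/
theorem SameComponent.mem_of_closed {S A : Set E} {X : Set V} {e e' : E}
    (h : G.SameComponent S X e e') (he : e ∈ A)
    (hA : ∀ v ∉ X, ∀ h ∈ G.star S v, ∀ k ∈ G.star S v, h.1 ∈ A → k.1 ∈ A) : e' ∈ A := by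
  induction h with
  | refl => exact he
  | tail _ hab ih =>
    obtain ⟨ha, hb, w, hw, ⟨i, hi⟩, ⟨j, hj⟩⟩ := hab
    exact hA w hw (_, i) ⟨ha, hi⟩ (_, j) ⟨hb, hj⟩ ih

/-- Consecutive steps share the vertex between them. The last step is set apart because its end may
lie in `X`, which allows a cycle to be cut open at one of its vertices. -/
theorem Wk.sameComponent {S : Set E} {X : Set V} {u v : V} {l : List (E × Bool)} {d : E × Bool}
    (h : Wk G.src G.tgt u (l ++ [d]) v) (hS : supp (l ++ [d]) ⊆ S) (hX : ∀ x ∈ l, G.tgt x ∉ X) :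
    ∀ x ∈ l, G.SameComponent S X x.1 d.1 := by
  induction l generalizing u with
  | nil => simp
  | cons x l ih =>
    have h1 := ih h.2 (fun _ he => hS (supp_mono (by intro; simp; tauto) he))
      (fun y hy => hX y (by simp [hy]))
    intro y hy
    rcases List.mem_cons.1 hy with rfl | hy
    · have hx := hX y (by simp)
      have h2 := h.2
      cases l with
      | nil =>
        exact SameComponent.of_star (h := flip y) (k := d) ⟨hS (fst_mem_supp (d := y) (by simp)), rfl⟩
          ⟨hS (fst_mem_supp (by simp)), h2.1⟩ hx
      | cons z l =>
        exact (SameComponent.of_star (h := flip y) (k := z)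
          ⟨hS (fst_mem_supp (d := y) (by simp)), rfl⟩
          ⟨hS (fst_mem_supp (by simp)), h2.1⟩ hx).trans (h1 z (by simp))
    · exact h1 y hy

theorem Wk.sameComponent_of_mem {S : Set E} {u v : V} {l : List (E × Bool)}
    (h : Wk G.src G.tgt u l v) (hS : supp l ⊆ S) {e e' : E} (he : e ∈ supp l) (he' : e' ∈ supp l) :
    G.SameComponent S ∅ e e' := by
  rcases List.eq_nil_or_concat' l with rfl | ⟨l, d, rfl⟩
  · simp at he
  · have key : ∀ e ∈ supp (l ++ [d]), G.SameComponent S ∅ e d.1 := by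
      rintro e ⟨b, hb⟩
      rcases List.mem_append.1 hb with hb | hb
      · exact h.sameComponent hS (by simp) _ hb
      · obtain rfl : (e, b) = d := by simpa using hb
        exact .refl _
    exact (key e he).trans (key e' he').symm

end SignedGraph

/-! ### Edge counts, cycles, separating vertices and simple paths -/

namespace SignedGraph

/-- Kept for abstract digraphs, since it serves cycles, which repeat no vertex, and minimal closed
directed walks, which repeat no state. -/
theorem Wk.ends {D X : Type*} {s t : D → X} {v : X} {l : List D} (h : Wk s t v l v) (hl : l ≠ [])
    (hn : (l.map t).Nodup) : ∃ d l' l'' d', l = d :: l' ∧ l = l'' ++ [d'] ∧ s d = v ∧ t d' = v ∧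
      (∀ x ∈ l', s x ≠ v) ∧ ∀ x ∈ l'', t x ≠ v := by
  obtain ⟨d, l', rfl⟩ := List.exists_cons_of_ne_nil hl
  obtain h0 | ⟨l'', d', h0⟩ := List.eq_nil_or_concat' (d :: l')
  · simp at h0
  have hs : ((d :: l').map s).Nodup := h.map_perm.nodup_iff.2 hn
  rw [h0] at hn
  have hd' : t d' = v := by
    rw [h0] at h
    exact h.last
  refine ⟨d, l', l'', d', rfl, h0, h.1, hd', fun x hx hxv => ?_, fun x hx hxv => ?_⟩
  · rw [List.map_cons, List.nodup_cons] at hs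
    exact hs.1 (List.mem_map.2 ⟨x, hx, hxv.trans h.1.symm⟩)
  · rw [List.map_append, List.nodup_append] at hn
    exact hn.2.2 _ (List.mem_map.2 ⟨x, hx, rfl⟩) (t d') (by simp) (hxv.trans hd'.symm)

variable {V E : Type*} {G : SignedGraph V E}

open Classical in
/-- The number of times that the steps `l` use the edge `e`. -/
noncomputable def cnt (l : List (E × Bool)) (e : E) : ℕ := (l.map Prod.fst).count e

open Classical in
theorem cnt_append (l l' : List (E × Bool)) (e : E) : cnt (l ++ l') e = cnt l e + cnt l' e := by
  simp [cnt]

open Classical in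
@[simp] theorem cnt_nil (e : E) : cnt [] e = 0 := by simp [cnt]

open Classical in
theorem cnt_cons (d : E × Bool) (l : List (E × Bool)) (e : E) :
    cnt (d :: l) e = cnt l e + if d.1 = e then 1 else 0 := by
  rw [cnt, cnt, List.map_cons, List.count_cons]
  simp

open Classical in
theorem cnt_pos {l : List (E × Bool)} {e : E} : 0 < cnt l e ↔ e ∈ supp l := by
  rw [cnt, List.count_pos_iff, mem_supp]

open Classical in
theorem cnt_perm {l l' : List (E × Bool)} (h : l.Perm l') : cnt l = cnt l' := by
  ext e
  exact (h.map _).count_eq e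

open Classical in
theorem cnt_le_one {l : List (E × Bool)} (h : (l.map Prod.fst).Nodup) (e : E) : cnt l e ≤ 1 :=
  List.nodup_iff_count_le_one.1 h e

theorem sum_cnt [Fintype E] (l : List (E × Bool)) : ∑ e, cnt l e = l.length := by
  classical
  induction l with
  | nil => simp
  | cons d l ih => simp [cnt_cons, Finset.sum_add_distrib, ih]

open Classical in
theorem cnt_eq_count (l : List (E × Bool)) (h : E × Bool) :
    cnt l h.1 = l.count h + l.count (flip h) := by
  induction l with
  | nil => simp
  | cons d l ih =>
    rw [cnt_cons, ih, List.count_cons, List.count_cons]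
    simp only [beq_iff_eq]
    by_cases hd : d.1 = h.1
    · rcases eq_or_eq_flip hd with rfl | rfl
      · simp [(flip_ne d).symm]; omega
      · simp [flip_ne h]; omega
    · have h1 : d ≠ h := fun h' => hd (by rw [h'])
      have h2 : d ≠ flip h := fun h' => hd (by rw [h']; rfl)
      simp [hd, h1, h2]

open Classical in
/-- The half-edges that are used at `v` by a walk that leaves `v` through `d`, returns to it
through `d'` and does not visit `v` in between. -/
theorem cnt_of_ends {l l' l'' : List (E × Bool)} {d d' : E × Bool} {v : V} (h1 : l = d :: l')
    (h2 : l = l'' ++ [d']) (hs : ∀ x ∈ l', G.src x ≠ v) (ht : ∀ x ∈ l'', G.tgt x ≠ v)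
    {h : E × Bool} (hv : G.src h = v) :
    cnt l h.1 = (if h = d then 1 else 0) + if h = flip d' then 1 else 0 := by
  rw [cnt_eq_count]
  congr 1
  · have : l'.count h = 0 := List.count_eq_zero.2 fun hm => hs _ hm hv
    rw [h1, List.count_cons, this]
    simp only [beq_iff_eq, zero_add]
    exact if_congr eq_comm rfl rfl
  · have : l''.count (flip h) = 0 := List.count_eq_zero.2 fun hm => ht _ hm (by simpa using hv)
    rw [h2, List.count_append, this, List.count_cons]
    simp only [beq_iff_eq, zero_add, List.count_nil]
    exact if_congr (eq_comm.trans flip_eq_iff) rfl rfl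

theorem star_of_ends {l l' l'' : List (E × Bool)} {d d' : E × Bool} {v : V} (h1 : l = d :: l')
    (h2 : l = l'' ++ [d']) (hd : G.src d = v) (hd' : G.tgt d' = v)
    (hs : ∀ x ∈ l', G.src x ≠ v) (ht : ∀ x ∈ l'', G.tgt x ≠ v) :
    G.star (supp l) v = {d, flip d'} := by
  classical
  ext h
  constructor
  · rintro ⟨h3, h4⟩
    have := cnt_pos.2 h3
    rw [cnt_of_ends h1 h2 hs ht h4] at this
    by_contra hc
    simp only [Set.mem_insert_iff, Set.mem_singleton_iff, not_or] at hc
    simp [hc] at this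
  · rintro (rfl | rfl)
    · exact ⟨fst_mem_supp (by simp [h1]), hd⟩
    · exact ⟨fst_mem_supp (d := d') (by simp [h2]), hd'⟩

theorem exists_mem_map_src {u v : V} {l : List (E × Bool)} (h : Wk G.src G.tgt u l u)
    (hv : v ∈ G.verts (supp l)) : v ∈ l.map G.src := by
  obtain ⟨k, hk, rfl⟩ := mem_verts.1 hv
  rcases mem_supp'.1 hk with hk | hk
  · exact List.mem_map.2 ⟨_, hk, rfl⟩
  · exact h.map_perm.mem_iff.2 (List.mem_map.2 ⟨_, hk, by simp⟩)

theorem Wk.isRotated_at {u v : V} {l : List (E × Bool)} (h : Wk G.src G.tgt u l u)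
    (hv : v ∈ G.verts (supp l)) : ∃ l', l.IsRotated l' ∧ Wk G.src G.tgt v l' v :=
  h.rotate (exists_mem_map_src h hv)

theorem isCycleWalk_iff {u : V} {l : List (E × Bool)} : G.IsCycleWalk u l ↔
    l ≠ [] ∧ Wk G.src G.tgt u l u ∧ (l.map G.tgt).Nodup ∧ (l.map Prod.fst).Nodup := by
  rw [IsCycleWalk, isWalk_iff]

theorem IsCycle.walk_at {C : Set E} (hC : G.IsCycle C) {v : V} (hv : v ∈ G.verts C) :
    ∃ l, G.IsCycleWalk v l ∧ supp l = C := by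
  obtain ⟨u, l, h, rfl⟩ := hC
  rw [isCycleWalk_iff] at h
  obtain ⟨l', h1, h2⟩ := h.2.1.isRotated_at hv
  refine ⟨l', isCycleWalk_iff.2 ⟨?_, h2, ?_, ?_⟩, (supp_perm h1.perm).symm⟩
  · rintro rfl
    exact h.1 (List.perm_nil.1 h1.perm)
  · exact (h1.perm.map _).nodup_iff.1 h.2.2.1
  · exact (h1.perm.map _).nodup_iff.1 h.2.2.2

theorem IsCycle.nonempty {C : Set E} (hC : G.IsCycle C) : C.Nonempty := by
  obtain ⟨u, l, h, rfl⟩ := hC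
  exact supp_nonempty h.1

/-- After a rotation `v` is the base, which only the first and the last step touch. Counting
half-edges instead of edges covers loops. -/
theorem IsCycle.star {C : Set E} (hC : G.IsCycle C) {v : V} (hv : v ∈ G.verts C) :
    ∃ h k, h ≠ k ∧ G.star C v = {h, k} := by
  obtain ⟨l, h, rfl⟩ := hC.walk_at hv
  obtain ⟨h0, h1, h2, h3⟩ := isCycleWalk_iff.1 h
  obtain ⟨d, l', l'', d', e1, e2, hd, hd', hs, ht⟩ := h1.ends h0 h2
  refine ⟨d, flip d', ?_, star_of_ends e1 e2 hd hd' hs ht⟩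
  rintro rfl
  rcases List.mem_cons.1 (show d' ∈ flip d' :: l' by rw [← e1, e2]; simp) with h4 | h4
  · exact flip_ne d' h4.symm
  · rw [e1, List.map_cons, List.nodup_cons] at h3
    exact h3.1 (List.mem_map.2 ⟨d', h4, rfl⟩)

/-- Cut open at `v`, or anywhere if `v` is not on it, a cycle is still a connected walk. -/
theorem IsCycle.sameComponent {C S : Set E} (hC : G.IsCycle C) (hS : C ⊆ S) (v : V) {e e' : E}
    (he : e ∈ C) (he' : e' ∈ C) : G.SameComponent S {v} e e' := by
  refine SameComponent.mono hS subset_rfl ?_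
  obtain ⟨u, l, h, rfl, hx⟩ : ∃ u l, G.IsCycleWalk u l ∧ supp l = C ∧
      (v ∈ G.verts C → u = v) := by
    by_cases hv : v ∈ G.verts C
    · obtain ⟨l, h, hl⟩ := hC.walk_at hv
      exact ⟨v, l, h, hl, fun _ => rfl⟩
    · obtain ⟨u, l, h, hl⟩ := hC
      exact ⟨u, l, h, hl, fun h => absurd h hv⟩
  obtain ⟨h0, h1, h2, h3⟩ := isCycleWalk_iff.1 h
  obtain ⟨d, l', l'', d', e1, e2, hd, hd', hs, ht⟩ := h1.ends h0 h2
  have key : ∀ e ∈ supp l, G.SameComponent (supp l) {v} e d'.1 := by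
    rintro e ⟨b, hb⟩
    by_cases heq : (e, b) = d'
    · rw [← heq]; exact .refl _
    · have hb' : (e, b) ∈ l'' := by
        rw [e2] at hb
        simpa [heq] using hb
      rw [e2] at h1
      refine h1.sameComponent (by rw [e2]) ?_ _ hb'
      rintro x hx' (hxv : _ = _)
      have hxl : x ∈ l := by simp [e2, hx']
      rw [← hx (hxv ▸ tgt_mem_verts (fst_mem_supp hxl))] at hxv
      exact ht x hx' hxv
  exact (key e he).trans (key e' he').symm

theorem pair_eq_of_subset {α : Type*} {a b c d : α} (hab : a ≠ b)
    (h : ({a, b} : Set α) ⊆ {c, d}) : ({a, b} : Set α) = {c, d} := by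
  have h1 : a = c ∨ a = d := by simpa using h (show a ∈ ({a, b} : Set α) by simp)
  have h2 : b = c ∨ b = d := by simpa using h (show b ∈ ({a, b} : Set α) by simp)
  rcases h1 with rfl | rfl <;> rcases h2 with rfl | rfl
  · exact absurd rfl hab
  · rfl
  · exact Set.pair_comm _ _
  · exact absurd rfl hab

theorem IsCycle.star_eq_of_subset {C C' : Set E} (hC : G.IsCycle C) (hC' : G.IsCycle C') {v : V}
    (hv : v ∈ G.verts C) (h : G.star C v ⊆ G.star C' v) : G.star C v = G.star C' v := by
  obtain ⟨a, b, hab, h1⟩ := hC.star hv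
  obtain ⟨k, hk⟩ := mem_verts.1 hv
  obtain ⟨c, d, -, h2⟩ := hC'.star (mem_verts.2 ⟨k, h hk⟩)
  rw [h1, h2] at h ⊢
  exact pair_eq_of_subset hab h

/-- Two cycles with a common edge are equal if they agree at each vertex at which they have a
common half-edge. -/
theorem IsCycle.subset_of_star {C C' : Set E} (hC : G.IsCycle C) {e : E} (he : e ∈ C)
    (he' : e ∈ C') (h : ∀ v, (G.star C v ∩ G.star C' v).Nonempty → G.star C v ⊆ G.star C' v) :
    C ⊆ C' := by
  obtain ⟨e₀, h₀⟩ := hC.nonempty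
  obtain ⟨u, l, hw, rfl⟩ := id hC
  rw [isCycleWalk_iff] at hw
  intro e' h'
  refine SameComponent.mem_of_closed (hw.2.1.sameComponent_of_mem subset_rfl he h') he' ?_
  intro v _ x hx y hy hx'
  exact (h v ⟨x, hx, hx', hx.2⟩ hy).1

/-- At each vertex of the smaller cycle both have exactly two half-edges, so their stars agree there
and the larger cycle cannot leave the smaller one. -/
theorem IsCycle.eq_of_subset {C C' : Set E} (hC : G.IsCycle C) (hC' : G.IsCycle C') (h : C ⊆ C') :
    C = C' := by
  obtain ⟨e, he⟩ := hC.nonempty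
  refine h.antisymm (hC'.subset_of_star (h he) he ?_)
  rintro v ⟨k, hk, hk'⟩
  exact (hC.star_eq_of_subset hC' (mem_verts.2 ⟨k, hk'⟩) (star_mono h v)).symm.subset

/-- `S` is the union of `A` and `B`, which have no edge and at most the vertex `v` in common. -/
structure Sep (G : SignedGraph V E) (S A B : Set E) (v : V) : Prop where
  union : S = A ∪ B
  disjoint : Disjoint A B
  verts_inter : ∀ w, w ∈ G.verts A → w ∈ G.verts B → w = v

theorem Sep.symm {S A B : Set E} {v : V} (h : Sep G S A B v) : Sep G S B A v :=
  ⟨by rw [h.union, Set.union_comm], h.disjoint.symm, fun w h1 h2 => h.verts_inter w h2 h1⟩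

theorem Sep.left {S A B : Set E} {v : V} (h : Sep G S A B v) : A ⊆ S := by
  rw [h.union]; exact Set.subset_union_left

theorem Sep.mem_left_of_star {S A B : Set E} {v w : V} (h : Sep G S A B v) (hw : w ≠ v)
    (hA : w ∈ G.verts A) {k : E × Bool} (hk : k ∈ G.star S w) : k.1 ∈ A := by
  have := hk.1
  rw [h.union] at this
  refine this.resolve_right fun hB => hw ?_
  exact h.verts_inter w hA (mem_verts.2 ⟨k, hB, hk.2⟩)

theorem Sep.mem_of_sameComponent {S A B : Set E} {v : V} (h : Sep G S A B v) {e e' : E}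
    (hs : G.SameComponent S {v} e e') (he : e ∈ A) : e' ∈ A :=
  hs.mem_of_closed he fun _ hw x hx _ hy hxA =>
    h.mem_left_of_star hw (mem_verts.2 ⟨x, hxA, hx.2⟩) hy

/-- A cycle stays connected when the point `v` is removed, so it cannot run on both sides. -/
theorem Sep.cycle {S A B C : Set E} {v : V} (h : Sep G S A B v) (hC : G.IsCycle C) (hS : C ⊆ S) :
    C ⊆ A ∨ C ⊆ B := by
  obtain ⟨e, he⟩ := hC.nonempty
  have := hS he
  rw [h.union] at this
  rcases this with h1 | h1
  · exact Or.inl fun e' he' => h.mem_of_sameComponent (hC.sameComponent hS v he he') h1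
  · exact Or.inr fun e' he' => h.symm.mem_of_sameComponent (hC.sameComponent hS v he he') h1

theorem Sep.isCutPoint {S A B : Set E} {v : V} (h : Sep G S A B v) (hS : G.IsConnected S)
    (hA : A.Nonempty) (hB : B.Nonempty) : G.IsCutPoint S v := by
  obtain ⟨a, ha⟩ := hA
  obtain ⟨b, hb⟩ := hB
  have hb' : b ∈ S := h.symm.left hb
  refine ⟨a, h.left ha, b, hb', hS.2 a (h.left ha) b hb', fun hs => ?_⟩
  exact Set.disjoint_left.1 h.disjoint (h.mem_of_sameComponent hs ha) hb

/-- The steps of a simple path do not repeat edges. -/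
theorem Wk.nodup_fst {u v : V} {l : List (E × Bool)} (h : Wk G.src G.tgt u l v)
    (hn : (u :: l.map G.tgt).Nodup) : (l.map Prod.fst).Nodup := by
  induction l generalizing u with
  | nil => simp
  | cons d l ih =>
    have hn' := (List.nodup_cons.1 hn).2
    refine List.nodup_cons.2 ⟨fun hm => ?_, ih h.2 hn'⟩
    obtain ⟨x, hx, hxd⟩ := List.mem_map.1 hm
    rcases eq_or_eq_flip hxd with rfl | rfl
    · exact (List.nodup_cons.1 hn').1 (List.mem_map.2 ⟨x, hx, rfl⟩)
    · refine (List.nodup_cons.1 hn).1 (List.mem_cons_of_mem _ (List.mem_map.2 ⟨_, hx, ?_⟩))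
      rw [tgt_flip, h.1]

/-- A step together with a walk back that avoids its edge contains a cycle through this edge. -/
theorem exists_cycle_through {d : E × Bool} {l : List (E × Bool)}
    (h : Wk G.src G.tgt (G.tgt d) l (G.src d)) (hd : d.1 ∉ supp l) :
    ∃ C, G.IsCycle C ∧ d.1 ∈ C ∧ C ⊆ {d.1} ∪ supp l := by
  obtain ⟨l', h1, h2, h3⟩ := h.exists_simple
  refine ⟨supp (d :: l'), ⟨G.src d, d :: l', isCycleWalk_iff.2
    ⟨by simp, ⟨rfl, h1⟩, h2, List.nodup_cons.2 ⟨fun hm => hd ?_, h1.nodup_fst h2⟩⟩, rfl⟩,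
    fst_mem_supp (by simp), ?_⟩
  · exact supp_mono h3 (mem_supp.2 hm)
  · rw [supp_cons]
    exact Set.union_subset_union_right _ (supp_mono h3)

theorem exists_cycle_of_closed {u : V} {l : List (E × Bool)} (h : Wk G.src G.tgt u l u)
    (hl : l ≠ []) (hn : (l.map Prod.fst).Nodup) : ∃ C, G.IsCycle C ∧ C ⊆ supp l := by
  obtain ⟨l1, l2, l3, w, rfl, h1, h2, h3⟩ := h.exists_min_closed hl
  refine ⟨supp l2, ⟨w, l2, isCycleWalk_iff.2 ⟨h1, h2, h3, ?_⟩, rfl⟩, supp_mono (by intro; simp; tauto)⟩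
  simp only [List.map_append] at hn
  exact (List.nodup_append.1 (List.nodup_append.1 hn).1).2.1

/-! ### Simple paths -/

namespace SimplePath

variable (P : G.SimplePath)

theorem wk : Wk G.src G.tgt P.init P.steps P.term := isWalk_iff.1 P.isWalk

theorem nodup_edges : (P.steps.map Prod.fst).Nodup := P.wk.nodup_fst P.nodup

theorem nodup_tgt : (P.steps.map G.tgt).Nodup := (List.nodup_cons.1 P.nodup).2

theorem nodup_src : (P.steps.map G.src).Nodup := by
  have := P.nodup
  rw [← P.wk.map_append] at this
  exact (List.nodup_append.1 this).1

theorem tgt_ne_init {d : E × Bool} (hd : d ∈ P.steps) : G.tgt d ≠ P.init := fun h =>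
  (List.nodup_cons.1 P.nodup).1 (List.mem_map.2 ⟨d, hd, h⟩)

theorem src_ne_term {d : E × Bool} (hd : d ∈ P.steps) : G.src d ≠ P.term := by
  have := P.nodup
  rw [← P.wk.map_append] at this
  exact (List.nodup_append.1 this).2.2 _ (List.mem_map.2 ⟨d, hd, rfl⟩) _ (by simp)

theorem edges_nonempty : P.edges.Nonempty := supp_nonempty P.pos

theorem mem_verts_iff {v : V} : v ∈ P.verts ↔ v ∈ P.init :: P.steps.map G.tgt := by
  constructor
  · intro h
    obtain ⟨k, hk, rfl⟩ := mem_verts.1 h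
    rcases mem_supp'.1 hk with hk | hk
    · rw [← P.wk.map_append]
      exact List.mem_append_left _ (List.mem_map.2 ⟨k, hk, rfl⟩)
    · exact List.mem_cons_of_mem _ (List.mem_map.2 ⟨_, hk, by simp⟩)
  · intro h
    rcases List.mem_cons.1 h with rfl | h
    · have hp := P.pos
      have hw := P.wk
      rw [SimplePath.verts, SimplePath.edges]
      revert hp hw
      cases P.steps with
      | nil => simp
      | cons d l => exact fun _ hw => hw.1 ▸ src_mem_verts (fst_mem_supp (by simp))
    · obtain ⟨d, hd, rfl⟩ := List.mem_map.1 h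
      exact tgt_mem_verts (fst_mem_supp hd)

theorem init_mem : P.init ∈ P.verts := P.mem_verts_iff.2 (by simp)

theorem exists_snoc : ∃ l d, P.steps = l ++ [d] ∧ G.tgt d = P.term := by
  obtain h | ⟨l, d, h⟩ := List.eq_nil_or_concat' P.steps
  · exact absurd h P.pos
  · refine ⟨l, d, h, ?_⟩
    have := P.wk
    rw [h] at this
    exact this.last

theorem exists_cons : ∃ d l, P.steps = d :: l ∧ G.src d = P.init := by
  obtain ⟨d, l, h⟩ := List.exists_cons_of_ne_nil P.pos
  refine ⟨d, l, h, ?_⟩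
  have := P.wk
  rw [h] at this
  exact this.1

theorem term_mem : P.term ∈ P.verts := by
  obtain ⟨l, d, h, h'⟩ := P.exists_snoc
  exact h' ▸ tgt_mem_verts (fst_mem_supp (by simp [h]))

theorem init_ne_term : P.init ≠ P.term := by
  obtain ⟨l, d, h, h'⟩ := P.exists_snoc
  rw [← h']
  exact (P.tgt_ne_init (by simp [h])).symm

theorem eq_of_src {d d' : E × Bool} (hd : d ∈ P.steps) (hd' : d' ∈ P.steps)
    (h : G.src d = G.src d') : d = d' := List.inj_on_of_nodup_map P.nodup_src hd hd' h

theorem eq_of_tgt {d d' : E × Bool} (hd : d ∈ P.steps) (hd' : d' ∈ P.steps)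
    (h : G.tgt d = G.tgt d') : d = d' := List.inj_on_of_nodup_map P.nodup_tgt hd hd' h

theorem star_init {d : E × Bool} (hd : d ∈ P.steps) (h : G.src d = P.init) :
    G.star P.edges P.init = {d} := by
  ext k
  constructor
  · rintro ⟨hk, hv⟩
    rcases mem_supp'.1 hk with hk | hk
    · exact P.eq_of_src hk hd (hv.trans h.symm)
    · exact absurd (by simpa using hv) (P.tgt_ne_init hk)
  · rintro rfl
    exact ⟨fst_mem_supp hd, h⟩

theorem star_term {d : E × Bool} (hd : d ∈ P.steps) (h : G.tgt d = P.term) :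
    G.star P.edges P.term = {flip d} := by
  ext k
  constructor
  · rintro ⟨hk, hv⟩
    rcases mem_supp'.1 hk with hk | hk
    · exact absurd hv (P.src_ne_term hk)
    · rw [Set.mem_singleton_iff, ← flip_eq_iff]
      exact P.eq_of_tgt hk hd (by simpa [h] using hv)
  · rintro rfl
    exact ⟨fst_mem_supp (d := d) hd, h⟩

theorem star_interior {d d' : E × Bool} (hd : d ∈ P.steps) (hd' : d' ∈ P.steps)
    (h : G.tgt d = G.src d') : G.star P.edges (G.tgt d) = {flip d, d'} := by
  ext k
  constructor
  · rintro ⟨hk, hv⟩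
    rcases mem_supp'.1 hk with hk | hk
    · exact Or.inr (P.eq_of_src hk hd' (hv.trans h))
    · exact Or.inl (flip_eq_iff.1 (P.eq_of_tgt hk hd (by simpa using hv)))
  · rintro (rfl | rfl)
    · exact ⟨fst_mem_supp (d := d) hd, rfl⟩
    · exact ⟨fst_mem_supp hd', h.symm⟩

theorem flip_not_mem {d : E × Bool} (hd : d ∈ P.steps) : flip d ∉ P.steps := by
  intro h
  have := List.inj_on_of_nodup_map P.nodup_edges hd h rfl
  exact flip_ne d this.symm

theorem exists_src_of_tgt {d : E × Bool} (hd : d ∈ P.steps) (h : G.tgt d ≠ P.term) :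
    ∃ d' ∈ P.steps, G.src d' = G.tgt d := by
  have : G.tgt d ∈ P.steps.map G.src ++ [P.term] := by
    rw [P.wk.map_append]
    exact List.mem_cons_of_mem _ (List.mem_map.2 ⟨d, hd, rfl⟩)
  rcases List.mem_append.1 this with h1 | h1
  · obtain ⟨d', h2, h3⟩ := List.mem_map.1 h1
    exact ⟨d', h2, h3⟩
  · exact absurd (by simpa using h1) h

/-- A simple path has two half-edges at each interior vertex. -/
theorem exists_interior {v : V} (hv : v ∈ P.verts) (h1 : v ≠ P.init) (h2 : v ≠ P.term) :
    ∃ d ∈ P.steps, ∃ d' ∈ P.steps, G.tgt d = v ∧ G.src d' = v ∧ flip d ≠ d' := by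
  obtain ⟨d, hd, rfl⟩ := List.mem_map.1 ((List.mem_cons.1 (P.mem_verts_iff.1 hv)).resolve_left h1)
  obtain ⟨d', hd', h⟩ := P.exists_src_of_tgt hd h2
  refine ⟨d, hd, d', hd', rfl, h, ?_⟩
  rintro rfl
  exact P.flip_not_mem hd hd'

/-- A simple path contains no cycle. -/
theorem not_cycle {C : Set E} (hC : G.IsCycle C) : ¬ C ⊆ P.edges := by
  intro h
  obtain ⟨e, he⟩ := hC.nonempty
  -- follow the path to its end along the cycle
  have key : ∀ l l' : List (E × Bool), P.steps = l ++ l' → ∀ d ∈ l', d.1 ∈ C → False := by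
    intro l l' hl
    induction l' generalizing l with
    | nil => simp
    | cons x l' ih =>
      intro d hd hdC
      have ih' := ih (l ++ [x]) (by simp [hl])
      rcases List.mem_cons.1 hd with rfl | hd
      · have hdP : d ∈ P.steps := by simp [hl]
        obtain ⟨a, b, hab, hst⟩ := hC.star (tgt_mem_verts hdC)
        obtain ⟨k, hk, hkd⟩ : ∃ k ∈ G.star C (G.tgt d), k ≠ flip d := by
          by_cases ha : a = flip d
          · exact ⟨b, by simp [hst], fun hb => hab (ha.trans hb.symm)⟩
          · exact ⟨a, by simp [hst], ha⟩
        have hkP : k ∈ P.steps := by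
          rcases mem_supp'.1 (h hk.1) with h1 | h1
          · exact h1
          · exact absurd (flip_eq_iff.1 (P.eq_of_tgt h1 hdP (by simpa using hk.2))) hkd
        have hkl : k ∈ l' := by
          have hw := P.wk
          rw [hl] at hw
          obtain ⟨w, -, hw⟩ := wk_append.1 hw
          have hw2 := hw.2
          cases l' with
          | nil => exact absurd (hk.2.trans hw2) (P.src_ne_term hkP)
          | cons y l' =>
            rw [P.eq_of_src hkP (d' := y) (by simp [hl]) (hk.2.trans hw2.1.symm)]
            simp
        exact ih' k hkl hk.1
      · exact ih' d hd hdC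
  obtain ⟨b, hb⟩ := h he
  exact key [] P.steps rfl _ hb he

end SimplePath

end SignedGraph

/-! ### Degree sums, Eulerian tours and directed walks -/

namespace SignedGraph

/-- The extremal principle for tours and paths; the bound comes from the total multiplicity or from
the number of edges. -/
theorem exists_longest {D : Type*} {p : List D → Prop} {N : ℕ} (h : ∃ l, p l)
    (hN : ∀ l, p l → l.length ≤ N) : ∃ l, p l ∧ ∀ l', p l' → l'.length ≤ l.length := by
  classical
  obtain ⟨l₀, h₀⟩ := h
  have hex : ∃ n, ∃ l, p l ∧ N - l.length = n := ⟨_, l₀, h₀, rfl⟩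
  obtain ⟨l, hl, hn⟩ := Nat.find_spec hex
  refine ⟨l, hl, fun l' hl' => ?_⟩
  have h1 := Nat.find_min' hex ⟨l', hl', rfl⟩
  have h2 := hN l hl
  have h3 := hN l' hl'
  omega

variable {V E : Type*} {G : SignedGraph V E}

section Degree

variable [Fintype E]

variable (G) in
open Classical in
/-- The sum of `a h * g e` over the half-edges `h` at `v`, where `e` is the edge of `h`. -/
noncomputable def bd (a : E × Bool → ℤ) (g : E → ℤ) (v : V) : ℤ :=
  ∑ h : E × Bool, if G.src h = v then a h * g h.1 else 0

theorem bd_add (a : E × Bool → ℤ) (g g' : E → ℤ) (v : V) :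
    G.bd a (fun e => g e + g' e) v = G.bd a g v + G.bd a g' v := by
  simp only [bd, ← Finset.sum_add_distrib]
  refine Finset.sum_congr rfl fun h _ => ?_
  split_ifs <;> ring

theorem bd_sub (a : E × Bool → ℤ) (g g' : E → ℤ) (v : V) :
    G.bd a (fun e => g e - g' e) v = G.bd a g v - G.bd a g' v := by
  simp only [bd, ← Finset.sum_sub_distrib]
  refine Finset.sum_congr rfl fun h _ => ?_
  split_ifs <;> ring

theorem bd_eq_sum {a : E × Bool → ℤ} {g : E → ℤ} {v : V} (F : Finset (E × Bool))
    (hF : ∀ h ∈ F, G.src h = v) (hg : ∀ h, G.src h = v → h ∉ F → g h.1 = 0) :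
    G.bd a g v = ∑ h ∈ F, a h * g h.1 := by
  classical
  rw [bd, ← Finset.sum_subset (Finset.subset_univ F)]
  · exact Finset.sum_congr rfl fun h hh => by rw [if_pos (hF h hh)]
  · intro h _ hh
    split_ifs with hv
    · rw [hg h hv hh, mul_zero]
    · rfl

open Classical in
theorem bd_single (a : E × Bool → ℤ) (d : E × Bool) (v : V) :
    G.bd a (fun e => if d.1 = e then 1 else 0) v =
      (if G.src d = v then a d else 0) + if G.tgt d = v then a (flip d) else 0 := by
  rw [bd, Fintype.sum_prod_type, Finset.sum_eq_single d.1]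
  · obtain ⟨e, b⟩ := d
    cases b <;> simp [flip, src, tgt, add_comm] <;> rfl
  · intro e _ he
    simp [he.symm]
  · simp

open Classical in
theorem bd_cnt_cons (a : E × Bool → ℤ) (d : E × Bool) (l : List (E × Bool)) (v : V) :
    G.bd a (fun e => cnt (d :: l) e) v = G.bd a (fun e => cnt l e) v +
      ((if G.src d = v then a d else 0) + if G.tgt d = v then a (flip d) else 0) := by
  rw [← bd_single, ← bd_add]
  congr 1
  ext e
  rw [cnt_cons]
  push_cast
  rfl

open Classical in
/-- The degrees of a walk are even except at its ends. -/
theorem Wk.even_bd {u w : V} {l : List (E × Bool)} (h : Wk G.src G.tgt u l w) (v : V) :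
    Even (G.bd 1 (fun e => cnt l e) v + ((if u = v then 1 else 0) + if w = v then 1 else 0)) := by
  induction l generalizing u with
  | nil =>
    obtain rfl : u = w := h
    simp [bd]
  | cons d l ih =>
    rw [bd_cnt_cons, h.1]
    obtain ⟨r, hr⟩ := ih h.2
    simp only [Pi.one_apply]
    by_cases h1 : u = v
    · exact ⟨r + 1, by rw [if_pos h1]; linarith⟩
    · exact ⟨r, by rw [if_neg h1]; linarith⟩

theorem Wk.even_bd_of_closed {u : V} {l : List (E × Bool)} (h : Wk G.src G.tgt u l u) (v : V) :
    Even (G.bd 1 (fun e => cnt l e) v) := by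
  classical
  have h1 := h.even_bd v
  rw [Int.even_add] at h1
  exact h1.2 ⟨_, rfl⟩

theorem length_le_of_cnt_le {g : E → ℤ} {l : List (E × Bool)} (h : ∀ e, (cnt l e : ℤ) ≤ g e) :
    l.length ≤ (∑ e, g e).toNat := by
  have h1 : ((∑ e, cnt l e : ℕ) : ℤ) ≤ ∑ e, g e := by
    push_cast
    exact Finset.sum_le_sum fun e _ => h e
  rw [sum_cnt] at h1
  omega

/-- A connected multigraph with even degrees has an Eulerian tour. -/
theorem exists_euler_tour {S : Set E} (hS : G.IsConnected S) {m : E → ℤ}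
    (hm : ∀ e, 0 < m e ↔ e ∈ S) (hm0 : ∀ e, 0 ≤ m e) (heven : ∀ v, Even (G.bd 1 m v)) :
    ∃ u W, Wk G.src G.tgt u W u ∧ ∀ e, (cnt W e : ℤ) = m e := by
  classical
  obtain ⟨e₀, he₀⟩ := hS.1
  obtain ⟨l, ⟨h1, x, y, h2⟩, h3⟩ := exists_longest (N := (∑ e, m e).toNat)
    (p := fun l => (∀ e, (cnt l e : ℤ) ≤ m e) ∧ ∃ x y, Wk G.src G.tgt x l y)
    ⟨[], by simpa using hm0, G.inc e₀ false, _, rfl⟩ (fun l h => length_le_of_cnt_le h.1)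
  -- a longest walk cannot be extended
  have key : ∀ l' x y, l'.Perm l → Wk G.src G.tgt x l' y → ∀ h : E × Bool, G.src h = y →
      ¬ (cnt l h.1 : ℤ) < m h.1 := by
    intro l' x y hp hw h hh hlt
    have := h3 (l' ++ [h]) ⟨fun e => ?_, x, G.tgt h, hw.append ⟨hh, rfl⟩⟩
    · rw [List.length_append, hp.length_eq] at this
      simp at this
    · rw [cnt_append, cnt_cons, cnt_nil, cnt_perm hp]
      have := h1 e
      split_ifs with he
      · subst he; push_cast; omega
      · simpa using this
  -- Otherwise the unused degree at the end `y` is odd, so a half-edge there has multiplicity left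
  -- and the walk can be extended.
  have hxy : x = y := by
    by_contra hxy
    have h4 := h2.even_bd y
    have h5 : ¬ Even (G.bd 1 (fun e => m e - cnt l e) y) := by
      rw [bd_sub, Int.even_sub]
      rw [if_neg hxy, if_pos rfl, zero_add, Int.even_add_one] at h4
      simp [heven y, h4]
    apply h5
    rw [bd]
    refine Finset.even_sum _ fun h _ => ?_
    split_ifs with hh
    · have h6 := key l x y (List.Perm.refl _) h2 h hh
      have h7 := h1 h.1
      have : m h.1 - cnt l h.1 = 0 := by omega
      simp [this]
    · simp
  subst hxy
  have hne : l ≠ [] := by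
    rintro rfl
    exact key [] (G.inc e₀ false) (G.inc e₀ false) (List.Perm.refl _) rfl (e₀, false) rfl
      (by simpa using (hm e₀).2 he₀)
  obtain ⟨e₁, he₁⟩ := supp_nonempty hne
  have hl : supp l ⊆ S := fun e he => (hm e).1 <|
    lt_of_lt_of_le (by exact_mod_cast cnt_pos.2 he) (h1 e)
  refine ⟨x, l, h2, fun e => ?_⟩
  -- The closed walk can be rotated to end at any of its vertices, so by maximality the edges at all
  -- of them are used up.
  have hvert : ∀ h : E × Bool, G.src h ∈ G.verts (supp l) → (cnt l h.1 : ℤ) = m h.1 := by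
    intro h hh
    obtain ⟨l', hr, hw⟩ := h2.isRotated_at hh
    exact le_antisymm (h1 _) (not_lt.1 (key l' _ _ hr.perm.symm hw h rfl))
  by_cases heS : e ∈ S
  · have := (hS.2 e₁ (hl he₁) e heS).mem_of_closed (A := supp l) he₁ ?_
    · exact hvert (e, false) (src_mem_verts this)
    · intro v _ h hh k hk hA
      have := hvert k (by rw [hk.2, ← hh.2]; exact src_mem_verts hA)
      have h8 := (hm k.1).2 hk.1
      rw [← this] at h8
      exact cnt_pos.1 (by exact_mod_cast h8)
  · have h4 := h1 e
    have h5 := hm0 e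
    have h6 : ¬ 0 < m e := fun h => heS ((hm e).1 h)
    omega

/-- In a subgraph with even degrees, each part that is separated by the vertex `v` has even degree
at `v`. -/
theorem Sep.even_bd [Finite V] {S A B : Set E} {v : V} (h : Sep G S A B v) {g : E → ℤ}
    (hg : ∀ e, e ∉ S → g e = 0) (heven : ∀ w, Even (G.bd 1 g w)) :
    Even (G.bd 1 (A.indicator g) v) := by
  classical
  cases nonempty_fintype V
  -- Handshake lemma on `A`: every vertex of `A` other than `v` keeps its full, even degree, so the
  -- degree at `v` is even too.
  have h1 : Even (∑ w, G.bd 1 (A.indicator g) w) := by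
    simp only [bd]
    rw [Finset.sum_comm]
    simp only [Finset.sum_ite_eq, Finset.mem_univ, if_true]
    rw [Fintype.sum_prod_type]
    refine Finset.even_sum _ fun e _ => ?_
    simp
  rw [← Finset.add_sum_erase _ _ (Finset.mem_univ v), Int.even_add] at h1
  refine h1.2 (Finset.even_sum _ fun w hw => ?_)
  have hw' : w ≠ v := (Finset.mem_erase.1 hw).1
  by_cases hA : w ∈ G.verts A
  · have : G.bd 1 (A.indicator g) w = G.bd 1 g w := by
      refine Finset.sum_congr rfl fun k _ => ?_
      split_ifs with hk
      · by_cases hkS : k.1 ∈ S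
        · rw [Set.indicator_of_mem (h.mem_left_of_star hw' hA ⟨hkS, hk⟩)]
        · have : A.indicator g k.1 = 0 := by
            rw [Set.indicator_apply]; split_ifs <;> simp [hg _ hkS]
          rw [this, hg _ hkS]
      · rfl
    rw [this]
    exact heven w
  · have : G.bd 1 (A.indicator g) w = 0 := by
      refine Finset.sum_eq_zero fun k _ => ?_
      split_ifs with hk
      · rw [Set.indicator_of_notMem fun hkA => hA (mem_verts.2 ⟨k, hkA, hk⟩), mul_zero]
      · rfl
    rw [this]
    exact Even.zero

end Degree

/-! ### Directed walks in an oriented signed graph -/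

namespace Orientation

variable (ε : G.Orientation)

/-- The state in which a directed walk has to be before the step `d`: the vertex, and the arrow of
the half-edge by which it is left. -/
def sst (d : E × Bool) : V × ℤˣ := (G.src d, ε.arrow d.1 d.2)

/-- The state of a directed walk after the step `d`. -/
def tst (d : E × Bool) : V × ℤˣ := (G.tgt d, -ε.arrow d.1 (!d.2))

/-- `l` is a directed walk from the state `x` to the state `y`. -/
def DWk (x : V × ℤˣ) (l : List (E × Bool)) (y : V × ℤˣ) : Prop := Wk ε.sst ε.tst x l y

/-- The arrow of a half-edge. -/
def ar (h : E × Bool) : ℤ := ε.arrow h.1 h.2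

variable {ε}

theorem DWk.wk {x y : V × ℤˣ} {l : List (E × Bool)} (h : ε.DWk x l y) :
    Wk G.src G.tgt x.1 l y.1 := Wk.map Prod.fst h

/-- The reversal of states. -/
def negState (x : V × ℤˣ) : V × ℤˣ := (x.1, -x.2)

theorem DWk.reverse {x y : V × ℤˣ} {l : List (E × Bool)} (h : ε.DWk x l y) :
    ε.DWk (negState y) (l.map flip).reverse (negState x) :=
  Wk.reverse (fun d => by simp [sst, tst, negState, flip, src, tgt])
    (fun d => by simp [sst, tst, negState, flip, src, tgt]) h

theorem ar_flip (d : E × Bool) : ε.ar (flip d) = -((ε.tst d).2 : ℤ) := by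
  simp [ar, tst, flip]

variable [Fintype E]

theorem boundary_eq (f : E → ℤ) (v : V) : ε.boundary f v = G.bd ε.ar f v := by
  classical
  rw [bd, Fintype.sum_prod_type, boundary]
  rfl

open Classical in
-- Telescoping: at an intermediate state the arrows of the arriving and the leaving half-edge
-- cancel. In particular a closed directed walk is a flow.
theorem DWk.bd {x y : V × ℤˣ} {l : List (E × Bool)} (h : ε.DWk x l y) (v : V) :
    G.bd ε.ar (fun e => cnt l e) v = (if x.1 = v then (x.2 : ℤ) else 0) -
      if y.1 = v then (y.2 : ℤ) else 0 := by
  induction l generalizing x with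
  | nil =>
    obtain rfl : x = y := h
    simp [SignedGraph.bd]
  | cons d l ih =>
    obtain ⟨rfl, h⟩ := h
    rw [bd_cnt_cons, ih h, ar_flip]
    have h1 : (ε.sst d).1 = G.src d := rfl
    have h2 : (ε.tst d).1 = G.tgt d := rfl
    have h3 : ((ε.sst d).2 : ℤ) = ε.ar d := rfl
    rw [h1, h2, h3]
    split_ifs <;> ring

theorem units_cases (u : ℤˣ) : (u : ℤ) = 1 ∨ (u : ℤ) = -1 := by
  rcases Int.units_eq_one_or u with rfl | rfl <;> simp

/-- A nontrivial nonnegative flow contains a closed directed walk. -/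
theorem exists_tour {f : E → ℤ} (h0 : ∀ e, 0 ≤ f e) (hf : f ≠ 0) (hbd : ∀ v, G.bd ε.ar f v = 0) :
    ∃ x W, W ≠ [] ∧ ε.DWk x W x ∧ ∀ e, (cnt W e : ℤ) ≤ f e := by
  classical
  obtain ⟨e₀, he₀⟩ : ∃ e, f e ≠ 0 := by
    by_contra! h
    exact hf (funext h)
  obtain ⟨l, ⟨hl, h1, x, y, h2⟩, h3⟩ := exists_longest (N := (∑ e, f e).toNat)
    (p := fun l => l ≠ [] ∧ (∀ e, (cnt l e : ℤ) ≤ f e) ∧ ∃ x y, ε.DWk x l y)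
    ⟨[(e₀, false)], by simp, fun e => by
        rw [cnt_cons]
        have := h0 e
        split_ifs with he
        · obtain rfl : e₀ = e := he
          simp; omega
        · simpa using this, _, _, rfl, rfl⟩ (fun l h => length_le_of_cnt_le h.2.1)
  refine ⟨x, l, hl, ?_, h1⟩
  by_cases hxy : x = y
  · rwa [← hxy] at h2
  exfalso
  -- If the walk is not closed, the unused flow has a nonzero boundary at its end, of the sign of
  -- the state `y`. So some half-edge with this arrow has capacity left, and the walk can be
  -- extended by it.
  have hpos : 0 < ∑ h : E × Bool, if G.src h = y.1
      then ((y.2 : ℤ) * ε.ar h) * (f h.1 - cnt l h.1) else 0 := by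
    have h4 : (y.2 : ℤ) * G.bd ε.ar (fun e => f e - cnt l e) y.1 > 0 := by
      rw [bd_sub, hbd, h2.bd, if_pos rfl]
      split_ifs with h5
      · have h6 : x.2 ≠ y.2 := fun h6 => hxy (Prod.ext h5 h6)
        have h7 : x.2 = -y.2 := by
          rcases Int.units_eq_one_or x.2 with h | h <;>
            rcases Int.units_eq_one_or y.2 with h' | h' <;> simp [h, h'] at h6 ⊢
        rw [h7]
        rcases units_cases y.2 with h | h <;> simp [h]
      · rcases units_cases y.2 with h | h <;> simp [h]
    rw [SignedGraph.bd, Finset.mul_sum] at h4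
    convert h4 using 2
    split_ifs <;> ring
  obtain ⟨h, -, hh⟩ := Finset.exists_lt_of_sum_lt (f := fun _ => (0 : ℤ)) (by simpa using hpos)
  split_ifs at hh with hv
  · have h4 := h1 h.1
    have h5 : (y.2 : ℤ) * ε.ar h = 1 ∧ (cnt l h.1 : ℤ) < f h.1 := by
      rcases units_cases y.2 with h6 | h6 <;>
        rcases units_cases (ε.arrow h.1 h.2) with h7 | h7 <;>
        simp only [h6, h7, ar] at hh ⊢ <;> constructor <;> linarith
    have h6 : ε.sst h = y := by
      refine Prod.ext hv (Units.ext ?_)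
      have := h5.1
      change ε.ar h = y.2
      rcases units_cases y.2 with h6 | h6 <;> rw [h6] at this ⊢ <;> linarith
    have := h3 (l ++ [h]) ⟨by simp, fun e => ?_, x, ε.tst h, Wk.append h2 ⟨h6, rfl⟩⟩
    · simp at this
    · rw [cnt_append, cnt_cons, cnt_nil]
      have := h1 e
      split_ifs with he
      · obtain rfl : h.1 = e := he
        have := h5.2
        push_cast; omega
      · simpa using this
  · exact lt_irrefl _ hh

end Orientation

end SignedGraph

/-! ### Signs of cycles, cut-points and the local structure of cycle-trees -/

namespace SignedGraph

variable {V E : Type*} {G : SignedGraph V E}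

/-- All arrows of `S` at `v` are equal, so that `v` is a sink or a source of `S`. -/
def Orientation.IsConst (ε : G.Orientation) (S : Set E) (v : V) : Prop :=
  ∃ s : ℤˣ, ∀ h ∈ G.star S v, ε.arrow h.1 h.2 = s

/-- The sign of a cycle is determined by the parity of the number of its sinks and sources. -/
theorem IsCycle.sign_eq {C : Set E} (hC : G.IsCycle C) (ε : G.Orientation) :
    G.cycleSign C = (-1) ^ {v ∈ G.verts C | ε.IsConst C v}.ncard := by
  classical
  obtain ⟨u, l, hw, rfl⟩ := id hC
  obtain ⟨h0, h1, h2, h3⟩ := isCycleWalk_iff.1 hw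
  set F := (l.map Prod.fst).toFinset with hF
  set W := (l.map G.tgt).toFinset with hW
  have hF' : supp l = F := by ext e; simp [hF, mem_supp]
  have hW' : ∀ v, v ∈ G.verts (supp l) ↔ v ∈ W := by
    intro v
    rw [hW, List.mem_toFinset]
    constructor
    · intro hv
      exact h1.map_perm.mem_iff.1 (exists_mem_map_src h1 hv)
    · intro hv
      obtain ⟨d, hd, rfl⟩ := List.mem_map.1 hv
      exact tgt_mem_verts (fst_mem_supp hd)
  have hcard : F.card = W.card := by
    rw [List.toFinset_card_of_nodup h3, List.toFinset_card_of_nodup h2]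
    simp
  -- The product of all arrows on the cycle is computed twice. By edges it is the product of the
  -- `-σ(e)`; by vertices a sink or source contributes `1` and any other vertex `-1`. A cycle has as
  -- many edges as vertices, so the powers of `-1` from both sides cancel.
  have e1 : ∏ e ∈ F, -G.sign e = (-1) ^ F.card * G.cycleSign (supp l) := by
    rw [cycleSign, hF', finprod_mem_coe_finset, ← Finset.prod_const, ← Finset.prod_mul_distrib]
    simp
  have e2 : ∏ e ∈ F, -G.sign e = ∏ h ∈ F ×ˢ (Finset.univ : Finset Bool), ε.arrow h.1 h.2 := by
    rw [Finset.prod_product]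
    refine Finset.prod_congr rfl fun e _ => ?_
    rw [← ε.arrow_mul]
    simp [mul_comm]
  have e3 : ∏ h ∈ F ×ˢ (Finset.univ : Finset Bool), ε.arrow h.1 h.2 =
      ∏ v ∈ W, -(if ε.IsConst (supp l) v then (-1 : ℤˣ) else 1) := by
    rw [← Finset.prod_fiberwise_of_maps_to (t := W) (g := G.src)]
    · refine Finset.prod_congr rfl fun v hv => ?_
      obtain ⟨a, b, hab, hst⟩ := hC.star ((hW' v).2 hv)
      have : {h ∈ F ×ˢ (Finset.univ : Finset Bool) | G.src h = v} = {a, b} := by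
        ext h
        have := congrArg (h ∈ ·) hst
        rw [hF'] at this
        simp only [mem_star, Finset.mem_coe, eq_iff_iff] at this
        simp [this]
      rw [this, Finset.prod_pair hab]
      by_cases hc : ε.IsConst (supp l) v
      · obtain ⟨s, hs⟩ := id hc
        rw [if_pos hc, hs a (by simp [hst]), hs b (by simp [hst])]
        simp
      · rw [if_neg hc]
        have hne : ε.arrow a.1 a.2 ≠ ε.arrow b.1 b.2 := by
          intro heq
          refine hc ⟨ε.arrow b.1 b.2, fun h hh => ?_⟩
          rw [hst] at hh
          rcases hh with rfl | rfl
          exacts [heq, rfl]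
        rcases Int.units_eq_one_or (ε.arrow a.1 a.2) with h | h <;>
          rcases Int.units_eq_one_or (ε.arrow b.1 b.2) with h' | h' <;> simp [h, h'] at hne ⊢
    · intro h hh
      rw [← hW', hF']
      exact src_mem_verts (by simpa using hh)
  have e4 : ∏ v ∈ W, -(if ε.IsConst (supp l) v then (-1 : ℤˣ) else 1) =
      (-1) ^ W.card * (-1) ^ {v ∈ G.verts (supp l) | ε.IsConst (supp l) v}.ncard := by
    have h5 : {v ∈ G.verts (supp l) | ε.IsConst (supp l) v} =
        (W.filter (fun v => ε.IsConst (supp l) v) : Set V) := by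
      ext v
      simp [hW']
    rw [h5, Set.ncard_coe_finset, ← Finset.prod_const, ← Finset.prod_const, Finset.prod_filter,
      ← Finset.prod_mul_distrib]
    refine Finset.prod_congr rfl fun v _ => ?_
    split_ifs <;> simp
  rw [e2, e3, e4, hcard] at e1
  exact (mul_left_cancel e1).symm

/-- A vertex is not a cut-point if all edges attached to it are connected outside it. -/
theorem not_isCutPoint {S : Set E} {v : V}
    (h : ∀ a ∈ G.star S v, ∀ b ∈ G.star S v, G.SameComponent S {v} a.1 b.1) :
    ¬ G.IsCutPoint S v := by
  rintro ⟨e, he, e', he', hs, hn⟩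
  refine hn (hs.mem_of_closed (A := {x | G.SameComponent S {v} e x}) (.refl _) ?_)
  intro w _ a ha b hb hea
  by_cases hw : w = v
  · subst hw
    exact SameComponent.trans hea (h a ha b hb)
  · exact SameComponent.trans hea (.of_star ha hb hw)

/-- If the half-edges at a cut-point `v` fall into two parts, each connected outside `v`, then
`v` separates these parts. -/
theorem IsCutPoint.exists_sep {S : Set E} {v : V} (hv : G.IsCutPoint S v) {X Y : Set (E × Bool)}
    (hXY : G.star S v = X ∪ Y)
    (hX : ∀ a ∈ X, ∀ b ∈ X, G.SameComponent S {v} a.1 b.1)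
    (hY : ∀ a ∈ Y, ∀ b ∈ Y, G.SameComponent S {v} a.1 b.1) (hXn : X.Nonempty) :
    ∃ A B, Sep G S A B v ∧ G.star A v = X ∧ G.star B v = Y ∧
      ∀ x ∈ X, ∀ e ∈ S, G.SameComponent S {v} x.1 e → e ∈ A := by
  obtain ⟨x, hx⟩ := hXn
  -- A connection outside `v` between the two parts would connect all half-edges at `v`, which is
  -- impossible at a cut-point.
  have hxy : ∀ y ∈ Y, ¬ G.SameComponent S {v} x.1 y.1 := by
    intro y hy hc
    refine not_isCutPoint ?_ hv
    have key : ∀ a ∈ G.star S v, G.SameComponent S {v} x.1 a.1 := by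
      intro a ha
      rw [hXY] at ha
      rcases ha with ha | ha
      · exact hX x hx a ha
      · exact hc.trans (hY y hy a ha)
    exact fun a ha b hb => (key a ha).symm.trans (key b hb)
  refine ⟨{e ∈ S | G.SameComponent S {v} x.1 e}, {e ∈ S | ¬ G.SameComponent S {v} x.1 e},
    ⟨?_, ?_, ?_⟩, ?_, ?_, ?_⟩
  · ext e
    simp only [Set.mem_union, Set.mem_ofPred_eq]
    tauto
  · rw [Set.disjoint_left]
    exact fun e h h' => h'.2 h.2
  · intro w h1 h2
    by_contra hw
    obtain ⟨a, ha, haw⟩ := mem_verts.1 h1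
    obtain ⟨b, hb, hbw⟩ := mem_verts.1 h2
    exact hb.2 (ha.2.trans (.of_star (h := a) (k := b) ⟨ha.1, haw⟩ ⟨hb.1, hbw⟩ hw))
  · ext a
    constructor
    · rintro ⟨⟨h1, h2⟩, h3⟩
      have : a ∈ X ∪ Y := hXY ▸ ⟨h1, h3⟩
      exact this.resolve_right fun hy => hxy a hy h2
    · intro ha
      have : a ∈ G.star S v := by rw [hXY]; exact Or.inl ha
      exact ⟨⟨this.1, hX x hx a ha⟩, this.2⟩
  · ext a
    constructor
    · rintro ⟨⟨h1, h2⟩, h3⟩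
      have : a ∈ X ∪ Y := hXY ▸ ⟨h1, h3⟩
      exact this.resolve_left fun hy => h2 (hX x hx a hy)
    · intro ha
      have : a ∈ G.star S v := by rw [hXY]; exact Or.inr ha
      exact ⟨⟨this.1, hxy a ha⟩, this.2⟩
  · exact fun y hy e he h => ⟨he, (hX x hx y hy).trans h⟩

/-! ### The local structure of a cycle-tree -/

namespace CycleTree

variable (T : G.CycleTree)

variable {T} in
theorem cycle_subset {C : Set E} (hC : C ∈ T.cycles) : C ⊆ T.edges := hC.2

variable {T} in
theorem path_subset {P : G.SimplePath} (hP : P ∈ T.paths) : P.edges ⊆ T.edges := by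
  intro e he
  rw [T.cover]
  exact Or.inr (Set.mem_iUnion₂.2 ⟨P, hP, he⟩)

theorem mem_edges {e : E} : e ∈ T.edges ↔ (∃ C ∈ T.cycles, e ∈ C) ∨ ∃ P ∈ T.paths, e ∈ P.edges := by
  constructor
  · intro he
    rw [T.cover] at he
    simpa [cycles] using he
  · rintro (⟨C, hC, he⟩ | ⟨P, hP, he⟩)
    exacts [cycle_subset hC he, path_subset hP he]

theorem cycle_eq {C C' : Set E} (hC : C ∈ T.cycles) (hC' : C' ∈ T.cycles) {e : E} (he : e ∈ C)
    (he' : e ∈ C') : C = C' := by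
  by_contra h
  exact Set.disjoint_left.1 (T.cycles_inter C hC C' hC' h).1 he he'

theorem path_eq {P Q : G.SimplePath} (hP : P ∈ T.paths) (hQ : Q ∈ T.paths) {v : V}
    (hv : v ∈ P.verts) (hv' : v ∈ Q.verts) : P = Q := by
  by_contra h
  exact Set.disjoint_left.1 (T.paths_disjoint P hP Q hQ h) hv hv'

variable {T} in
theorem eq_init_or_eq_term {P : G.SimplePath} (hP : P ∈ T.paths) {C : Set E} (hC : C ∈ T.cycles)
    {v : V} (hv : v ∈ P.verts) (hv' : v ∈ G.verts C) :
    (v = P.init ∧ P.verts ∩ G.verts C = {P.init}) ∨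
      (v = P.term ∧ P.verts ∩ G.verts C = {P.term}) := by
  obtain ⟨C₁, h1, C₂, h2, hne, e1, e2, h3⟩ := T.paths_inter P hP
  by_cases hC1 : C = C₁
  · subst hC1
    exact Or.inl ⟨e1.subset ⟨hv, hv'⟩, e1⟩
  · by_cases hC2 : C = C₂
    · subst hC2
      exact Or.inr ⟨e2.subset ⟨hv, hv'⟩, e2⟩
    · exact absurd hv' (Set.disjoint_left.1 (h3 C hC hC1 hC2) hv)

/-- A block path meets one cycle in each of its ends; two cycles at the same vertex would make these
ends coincide. -/
theorem cycle_eq_of_path {P : G.SimplePath} (hP : P ∈ T.paths) {C C' : Set E} (hC : C ∈ T.cycles)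
    (hC' : C' ∈ T.cycles) {v : V} (hv : v ∈ P.verts) (h : v ∈ G.verts C) (h' : v ∈ G.verts C') :
    C = C' := by
  obtain ⟨C₁, h1, C₂, h2, hne, e1, e2, h3⟩ := T.paths_inter P hP
  have key : ∀ D ∈ T.cycles, v ∈ G.verts D → (D = C₁ ∧ v = P.init) ∨ (D = C₂ ∧ v = P.term) := by
    intro D hD hvD
    by_cases hC1 : D = C₁
    · subst hC1
      exact Or.inl ⟨rfl, e1.subset ⟨hv, hvD⟩⟩
    · by_cases hC2 : D = C₂
      · subst hC2
        exact Or.inr ⟨rfl, e2.subset ⟨hv, hvD⟩⟩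
      · exact absurd hvD (Set.disjoint_left.1 (h3 D hD hC1 hC2) hv)
  rcases key C hC h with ⟨rfl, k1⟩ | ⟨rfl, k1⟩ <;> rcases key C' hC' h' with ⟨rfl, k2⟩ | ⟨rfl, k2⟩
  · rfl
  · exact absurd (k1.symm.trans k2) P.init_ne_term
  · exact absurd (k2.symm.trans k1) P.init_ne_term
  · rfl

/-- The path meets the cycle at most in one end-vertex. A common edge would give a step that returns
to the initial vertex or leaves the terminal one. -/
theorem path_not_mem_cycle {P : G.SimplePath} (hP : P ∈ T.paths) {C : Set E} (hC : C ∈ T.cycles)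
    {e : E} (he : e ∈ P.edges) : e ∉ C := by
  intro heC
  obtain ⟨b, hb⟩ := id he
  rcases eq_init_or_eq_term hP hC (src_mem_verts (h := (e, b)) he) (src_mem_verts heC) with
    ⟨-, h2⟩ | ⟨h1, -⟩
  · exact P.tgt_ne_init hb (h2.subset ⟨tgt_mem_verts (h := (e, b)) he, tgt_mem_verts heC⟩)
  · exact P.src_ne_term hb h1

theorem indicator_cycle {C : Set E} (hC : C ∈ T.cycles) {e : E} (he : e ∈ C) :
    T.indicator e = 1 := if_pos ⟨C, hC, he⟩

theorem indicator_path {P : G.SimplePath} (hP : P ∈ T.paths) {e : E} (he : e ∈ P.edges) :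
    T.indicator e = 2 := by
  rw [indicator, if_neg, if_pos ⟨P, hP, he⟩]
  rintro ⟨C, hC, h⟩
  exact T.path_not_mem_cycle hP hC he h

theorem indicator_of_notMem {e : E} (he : e ∉ T.edges) : T.indicator e = 0 := by
  rw [mem_edges, not_or] at he
  rw [indicator, if_neg he.1, if_neg he.2]

theorem indicator_pos {e : E} : 0 < T.indicator e ↔ e ∈ T.edges := by
  by_cases he : e ∈ T.edges
  · rcases T.mem_edges.1 he with ⟨C, hC, h⟩ | ⟨P, hP, h⟩
    · simp [he, T.indicator_cycle hC h]
    · simp [he, T.indicator_path hP h]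
  · simp [he, T.indicator_of_notMem he]

theorem indicator_nonneg (e : E) : 0 ≤ T.indicator e := by
  rw [indicator]
  split_ifs <;> norm_num

theorem exists_cycle_init {P : G.SimplePath} (hP : P ∈ T.paths) :
    ∃ C ∈ T.cycles, P.init ∈ G.verts C := by
  obtain ⟨C₁, h1, C₂, h2, hne, e1, e2, h3⟩ := T.paths_inter P hP
  exact ⟨C₁, h1, (e1.symm.subset rfl).2⟩

theorem exists_cycle_term {P : G.SimplePath} (hP : P ∈ T.paths) :
    ∃ C ∈ T.cycles, P.term ∈ G.verts C := by
  obtain ⟨C₁, h1, C₂, h2, hne, e1, e2, h3⟩ := T.paths_inter P hP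
  exact ⟨C₂, h2, (e2.symm.subset rfl).2⟩

theorem exists_cycle : ∃ C, C ∈ T.cycles := by
  obtain ⟨e, he⟩ := T.connected.1
  rcases T.mem_edges.1 he with ⟨C, hC, -⟩ | ⟨P, hP, -⟩
  · exact ⟨C, hC⟩
  · obtain ⟨C, hC, -⟩ := T.exists_cycle_init hP
    exact ⟨C, hC⟩

theorem exists_cycle_of_inter {v : V} (hv : v ∈ T.interVerts) : ∃ C ∈ T.cycles, v ∈ G.verts C := by
  rcases hv with ⟨C, hC, -, -, -, h, -⟩ | ⟨P, hP, rfl | rfl⟩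
  · exact ⟨C, hC, h⟩
  · exact T.exists_cycle_init hP
  · exact T.exists_cycle_term hP

theorem isCutPoint_of_inter {v : V} (hv : v ∈ T.interVerts) : G.IsCutPoint T.edges v := by
  rcases hv with ⟨C, hC, C', hC', hne, h, h'⟩ | ⟨P, hP, rfl | rfl⟩
  · exact T.cut_cycles C hC C' hC' hne v ⟨h, h'⟩
  · exact (T.cut_paths P hP).1
  · exact (T.cut_paths P hP).2

theorem inter_of_path_cycle {P : G.SimplePath} (hP : P ∈ T.paths) {C : Set E} (hC : C ∈ T.cycles)
    {v : V} (hv : v ∈ P.verts) (hv' : v ∈ G.verts C) : v ∈ T.interVerts := by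
  rcases eq_init_or_eq_term hP hC hv hv' with ⟨h, -⟩ | ⟨h, -⟩
  · exact Or.inr ⟨P, hP, Or.inl h⟩
  · exact Or.inr ⟨P, hP, Or.inr h⟩

/-- An edge that is attached to a vertex of a block cycle that is not an intersection vertex
belongs to this cycle. -/
theorem star_eq_of_not_inter {C : Set E} (hC : C ∈ T.cycles) {v : V} (hv : v ∈ G.verts C)
    (hi : v ∉ T.interVerts) : G.star T.edges v = G.star C v := by
  refine Set.Subset.antisymm (fun k hk => ?_) (star_mono (cycle_subset hC) v)
  refine ⟨?_, hk.2⟩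
  rcases T.mem_edges.1 hk.1 with ⟨D, hD, h⟩ | ⟨P, hP, h⟩
  · by_cases hCD : C = D
    · rwa [hCD]
    · exact absurd (Or.inl ⟨C, hC, D, hD, hCD, hv, mem_verts.2 ⟨k, h, hk.2⟩⟩) hi
  · exact absurd (T.inter_of_path_cycle hP hC (mem_verts.2 ⟨k, h, hk.2⟩) hv) hi

theorem star_eq_of_interior {P : G.SimplePath} (hP : P ∈ T.paths) {v : V} (hv : v ∈ P.verts)
    (hi : v ∉ T.interVerts) : G.star T.edges v = G.star P.edges v := by
  refine Set.Subset.antisymm (fun k hk => ?_) (star_mono (path_subset hP) v)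
  refine ⟨?_, hk.2⟩
  rcases T.mem_edges.1 hk.1 with ⟨D, hD, h⟩ | ⟨Q, hQ, h⟩
  · exact absurd (T.inter_of_path_cycle hP hD hv (mem_verts.2 ⟨k, h, hk.2⟩)) hi
  · rwa [T.path_eq hP hQ hv (mem_verts.2 ⟨k, h, hk.2⟩)]

/-- At a vertex that is not an intersection vertex, a cycle-tree has exactly two half-edges. -/
theorem exists_star_of_not_inter {v : V} (hv : v ∈ G.verts T.edges) (hi : v ∉ T.interVerts) :
    ∃ h k, h ≠ k ∧ G.star T.edges v = {h, k} ∧ T.indicator h.1 = T.indicator k.1 := by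
  obtain ⟨x, hx, hxv⟩ := mem_verts.1 hv
  rcases T.mem_edges.1 hx with ⟨C, hC, h⟩ | ⟨P, hP, h⟩
  · have hvC : v ∈ G.verts C := mem_verts.2 ⟨x, h, hxv⟩
    obtain ⟨a, b, hab, hst⟩ := hC.1.star hvC
    have ha : a ∈ G.star C v := by simp [hst]
    have hb : b ∈ G.star C v := by simp [hst]
    refine ⟨a, b, hab, by rw [T.star_eq_of_not_inter hC hvC hi, hst], ?_⟩
    rw [T.indicator_cycle hC ha.1, T.indicator_cycle hC hb.1]
  · have hvP : v ∈ P.verts := mem_verts.2 ⟨x, h, hxv⟩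
    have h1 : v ≠ P.init := fun h => hi (Or.inr ⟨P, hP, Or.inl h⟩)
    have h2 : v ≠ P.term := fun h => hi (Or.inr ⟨P, hP, Or.inr h⟩)
    obtain ⟨d, hd, d', hd', rfl, h4, h5⟩ := P.exists_interior hvP h1 h2
    refine ⟨flip d, d', h5, by rw [T.star_eq_of_interior hP hvP hi, P.star_interior hd hd' h4.symm],
      ?_⟩
    rw [T.indicator_path hP (e := (flip d).1) (fst_mem_supp (d := d) hd),
      T.indicator_path hP (e := d'.1) (fst_mem_supp hd')]

/-- At an intersection vertex, a block cycle is separated from another block cycle or from a block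
path. -/
theorem exists_sep {C : Set E} (hC : C ∈ T.cycles) {v : V} (hv : v ∈ G.verts C)
    (hi : v ∈ T.interVerts) : ∃ A B, Sep G T.edges A B v ∧ C ⊆ A ∧ G.star A v = G.star C v ∧
      ((∃ C' ∈ T.cycles, C' ⊆ B ∧ v ∈ G.verts C' ∧ G.star B v = G.star C' v) ∨
        ∃ P ∈ T.paths, ∃ k, (v = P.init ∨ v = P.term) ∧ G.star P.edges v = {k} ∧
          G.star B v = {k}) := by
  have hcut := T.isCutPoint_of_inter hi
  obtain ⟨x, hx⟩ := mem_verts.1 hv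
  have hCS := fun a (ha : a ∈ G.star C v) b (hb : b ∈ G.star C v) =>
    hC.1.sameComponent hC.2 v ha.1 hb.1
  have hi' : (∃ C' ∈ T.cycles, C' ≠ C ∧ v ∈ G.verts C') ∨
      ∃ P ∈ T.paths, v = P.init ∨ v = P.term := by
    rcases hi with ⟨C₁, h1, C₂, h2, hne, hv1, hv2⟩ | h
    · by_cases h : C₁ = C
      · exact Or.inl ⟨C₂, h2, fun h' => hne (h.trans h'.symm), hv2⟩
      · exact Or.inl ⟨C₁, h1, h, hv1⟩
    · exact Or.inr h
  rcases hi' with ⟨C', hC', hne, hv'⟩ | ⟨P, hP, hend⟩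
  · have hXY : G.star T.edges v = G.star C v ∪ G.star C' v := by
      refine Set.Subset.antisymm (fun k hk => ?_) (Set.union_subset (star_mono hC.2 v)
        (star_mono hC'.2 v))
      rcases T.mem_edges.1 hk.1 with ⟨D, hD, h⟩ | ⟨Q, hQ, h⟩
      · have hvD : v ∈ G.verts D := mem_verts.2 ⟨k, h, hk.2⟩
        by_cases h1 : D = C
        · exact Or.inl ⟨h1 ▸ h, hk.2⟩
        by_cases h2 : D = C'
        · exact Or.inr ⟨h2 ▸ h, hk.2⟩
        exfalso
        have h3 : ({D, C, C'} : Set (Set E)).encard ≤ 2 := by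
          refine (Set.encard_le_encard ?_).trans (T.cycles_le_two v)
          rintro X (rfl | rfl | rfl)
          exacts [⟨hD, hvD⟩, ⟨hC, hv⟩, ⟨hC', hv'⟩]
        rw [Set.encard_eq_three.2 ⟨D, C, C', h1, h2, hne.symm, rfl⟩] at h3
        exact absurd h3 (by decide)
      · exact absurd (T.cycle_eq_of_path hQ hC hC' (mem_verts.2 ⟨k, h, hk.2⟩) hv hv').symm hne
    obtain ⟨A, B, hsep, hA, hB, hAC⟩ := hcut.exists_sep hXY hCS
      (fun a ha b hb => hC'.1.sameComponent hC'.2 v ha.1 hb.1) ⟨x, hx⟩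
    refine ⟨A, B, hsep, fun e he => hAC x hx e (hC.2 he) (hC.1.sameComponent hC.2 v hx.1 he), hA,
      Or.inl ⟨C', hC', ?_, hv', hB⟩⟩
    obtain ⟨y, hy⟩ := mem_verts.1 hv'
    have hyB : y ∈ G.star B v := by rw [hB]; exact hy
    exact fun e he => hsep.symm.mem_of_sameComponent
      (hC'.1.sameComponent hC'.2 v hy.1 he) hyB.1
  · obtain ⟨k, hk⟩ : ∃ k, G.star P.edges v = {k} := by
      rcases hend with rfl | rfl
      · obtain ⟨d, l, h, hd⟩ := P.exists_cons
        exact ⟨d, P.star_init (by simp [h]) hd⟩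
      · obtain ⟨l, d, h, hd⟩ := P.exists_snoc
        exact ⟨flip d, P.star_term (by simp [h]) hd⟩
    have hvP : v ∈ P.verts := by
      rcases hend with rfl | rfl
      exacts [P.init_mem, P.term_mem]
    -- Here a second block path is excluded by vertex-disjointness.
    have hXY : G.star T.edges v = G.star C v ∪ {k} := by
      rw [← hk]
      refine Set.Subset.antisymm (fun k hk => ?_) (Set.union_subset (star_mono hC.2 v)
        (star_mono (path_subset hP) v))
      rcases T.mem_edges.1 hk.1 with ⟨D, hD, h⟩ | ⟨Q, hQ, h⟩
      · rw [T.cycle_eq_of_path hP hC hD hvP hv (mem_verts.2 ⟨k, h, hk.2⟩)]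
        exact Or.inl ⟨h, hk.2⟩
      · rw [T.path_eq hP hQ hvP (mem_verts.2 ⟨k, h, hk.2⟩)]
        exact Or.inr ⟨h, hk.2⟩
    obtain ⟨A, B, hsep, hA, hB, hAC⟩ := hcut.exists_sep hXY hCS
      (by rintro a rfl b rfl; exact .refl _) ⟨x, hx⟩
    exact ⟨A, B, hsep, fun e he => hAC x hx e (hC.2 he) (hC.1.sameComponent hC.2 v hx.1 he), hA,
      Or.inr ⟨P, hP, k, hend, hk, hB⟩⟩

end CycleTree

end SignedGraph

/-! ### Indecomposability of the indicator of an Eulerian cycle-tree -/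

namespace SignedGraph

variable {V E : Type*} {G : SignedGraph V E}

theorem Orientation.isConst_pair {ε : G.Orientation} {S : Set E} {v : V} {a b : E × Bool}
    (h : G.star S v = {a, b}) : ε.IsConst S v ↔ ε.ar a = ε.ar b := by
  rw [Orientation.IsConst, h]
  constructor
  · rintro ⟨s, hs⟩
    rw [Orientation.ar, Orientation.ar, hs a (by simp), hs b (by simp)]
  · intro hab
    refine ⟨ε.arrow b.1 b.2, ?_⟩
    rintro _ (rfl | rfl)
    exacts [Units.ext hab, rfl]

section

variable [Fintype E]

theorem bd_indicator_pair {A : Set E} {v : V} {a b : E × Bool} (h : G.star A v = {a, b})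
    (hab : a ≠ b) (α : E × Bool → ℤ) (g : E → ℤ) :
    G.bd α (A.indicator g) v = α a * g a.1 + α b * g b.1 := by
  classical
  have ha : a ∈ G.star A v := by simp [h]
  have hb : b ∈ G.star A v := by simp [h]
  rw [bd_eq_sum {a, b}, Finset.sum_pair hab, Set.indicator_of_mem ha.1, Set.indicator_of_mem hb.1]
  · intro k hk
    have : k ∈ G.star A v := by simpa [h] using hk
    exact this.2
  · intro k hk hk'
    refine Set.indicator_of_notMem (fun hA => hk' ?_) _
    have : k ∈ G.star A v := ⟨hA, hk⟩
    simpa [h] using this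

theorem bd_indicator_single {A : Set E} {v : V} {a : E × Bool} (h : G.star A v = {a})
    (α : E × Bool → ℤ) (g : E → ℤ) : G.bd α (A.indicator g) v = α a * g a.1 := by
  classical
  have ha : a ∈ G.star A v := by simp [h]
  rw [bd_eq_sum {a}, Finset.sum_singleton, Set.indicator_of_mem ha.1]
  · intro k hk
    have : k ∈ G.star A v := by simpa [h] using hk
    exact this.2
  · intro k hk hk'
    refine Set.indicator_of_notMem (fun hA => hk' ?_) _
    have : k ∈ G.star A v := ⟨hA, hk⟩
    simpa [h] using this

theorem bd_pair {S : Set E} {v : V} {a b : E × Bool} (h : G.star S v = {a, b})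
    (hab : a ≠ b) (α : E × Bool → ℤ) {g : E → ℤ} (hg : ∀ e, e ∉ S → g e = 0) :
    G.bd α g v = α a * g a.1 + α b * g b.1 := by
  rw [← bd_indicator_pair h hab]
  congr 1
  exact (Set.indicator_eq_self.2 fun e he => by_contra fun h => he (hg e h)).symm

theorem Sep.bd_eq {S A B : Set E} {v : V} (h : Sep G S A B v) (α : E × Bool → ℤ) {g : E → ℤ}
    (hg : ∀ e, e ∉ S → g e = 0) (w : V) :
    G.bd α g w = G.bd α (A.indicator g) w + G.bd α (B.indicator g) w := by
  rw [← bd_add]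
  congr 1
  ext e
  by_cases hA : e ∈ A
  · rw [Set.indicator_of_mem hA, Set.indicator_of_notMem (Set.disjoint_left.1 h.disjoint hA),
      add_zero]
  · rw [Set.indicator_of_notMem hA, zero_add]
    by_cases hB : e ∈ B
    · rw [Set.indicator_of_mem hB]
    · rw [Set.indicator_of_notMem hB]
      refine hg e ?_
      rw [h.union]
      rintro (h | h) <;> contradiction

/-- Arrows are odd, so degree and boundary agree modulo two. -/
theorem Orientation.even_bd_of_flow {ε : G.Orientation} {g : E → ℤ} {v : V}
    (h : G.bd ε.ar g v = 0) : Even (G.bd 1 g v) := by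
  have : Even (G.bd 1 g v - G.bd ε.ar g v) := by
    rw [bd, bd, ← Finset.sum_sub_distrib]
    refine Finset.even_sum _ fun k _ => ?_
    split_ifs
    · rcases Orientation.units_cases (ε.arrow k.1 k.2) with h | h <;> simp [Orientation.ar, h]
    · simp
  simpa [h] using this

end

namespace CycleTree

variable [Fintype E] [Finite V] (T : G.CycleTree) {δ : G.Orientation}

variable (δ) in
/-- `C` passes through the intersection vertex `v`. -/
def IsBad (C : Set E) (v : V) : Prop :=
  C ∈ T.cycles ∧ v ∈ G.verts C ∧ v ∈ T.interVerts ∧ ¬ δ.IsConst C v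

omit [Finite V] in
-- At such a vertex the cycle has all half-edges of `T`, both of weight one, so conservation makes
-- their arrows opposite.
theorem not_isConst (hbd : ∀ v, G.bd δ.ar T.indicator v = 0) {C : Set E} (hC : C ∈ T.cycles) {v : V}
    (hv : v ∈ G.verts C) (hi : v ∉ T.interVerts) : ¬ δ.IsConst C v := by
  obtain ⟨a, b, hab, hst⟩ := hC.1.star hv
  have ha : a ∈ G.star C v := by simp [hst]
  have hb : b ∈ G.star C v := by simp [hst]
  have h1 := hbd v
  rw [bd_pair ((T.star_eq_of_not_inter hC hv hi).trans hst) hab _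
    (fun e he => T.indicator_of_notMem he), T.indicator_cycle hC ha.1,
    T.indicator_cycle hC hb.1] at h1
  rw [Orientation.isConst_pair hst]
  intro h2
  rw [h2] at h1
  rcases Orientation.units_cases (δ.arrow b.1 b.2) with h | h <;>
    simp only [Orientation.ar, h] at h1 <;> norm_num at h1

/-- The sign of `C` fixes the parity of the number of its sinks and sources, and the Parity
Condition that of the number of its intersection vertices. The former are among the latter, so the
two sets cannot differ by exactly one vertex. -/
theorem IsBad.exists_ne (hT : T.IsEulerian) (hbd : ∀ v, G.bd δ.ar T.indicator v = 0) {C : Set E}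
    {v : V} (h : T.IsBad δ C v) : ∃ w ≠ v, T.IsBad δ C w := by
  obtain ⟨hC, hv, hi, hc⟩ := h
  by_contra! hcon
  have h1 : {w ∈ G.verts C | δ.IsConst C w} = (G.verts C ∩ T.interVerts) \ {v} := by
    ext w
    constructor
    · rintro ⟨hw, hcw⟩
      refine ⟨⟨hw, by_contra fun hi' => T.not_isConst hbd hC hw hi' hcw⟩, ?_⟩
      rintro rfl
      exact hc hcw
    · rintro ⟨⟨hw, hiw⟩, hwv⟩
      exact ⟨hw, by_contra fun hcw => hcon w hwv ⟨hC, hw, hiw, hcw⟩⟩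
  have h2 := hC.1.sign_eq δ
  have h3 := Set.ncard_sdiff_singleton_add_one (show v ∈ G.verts C ∩ T.interVerts from ⟨hv, hi⟩)
  rw [h1] at h2
  obtain ⟨h4, h5⟩ := hT C hC
  rcases Nat.even_or_odd ((G.verts C ∩ T.interVerts) \ {v}).ncard with h6 | h6
  · rw [h6.neg_one_pow] at h2
    have := h4 h2
    rw [← h3, Nat.even_add_one] at this
    exact this h6
  · rw [h6.neg_one_pow] at h2
    have := h5 h2
    rw [← h3, Nat.odd_add_one] at this
    exact this h6

/-- The edges connected with `C` outside `v`. -/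
def comp (C : Set E) (v : V) : Set E :=
  {x | x ∈ T.edges ∧ ∃ e ∈ C, G.SameComponent T.edges {v} e x}

/-- Descent. At a second bad vertex `w` the contribution of `C` cancels, so the opposite side has to
balance by itself. A path would contribute `2` or `-2`, so this side is a cycle `C'` that passes
through `w`. Outside `w` it is connected only with edges beyond `w`, and these do not include the
edges of `C`. -/
theorem IsBad.exists_smaller (hT : T.IsEulerian) (hbd : ∀ v, G.bd δ.ar T.indicator v = 0)
    {C : Set E} {v : V} (h : T.IsBad δ C v) :
    ∃ C' w, T.IsBad δ C' w ∧ (T.comp C' w).ncard < (T.comp C v).ncard := by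
  obtain ⟨w, hwv, hb⟩ := h.exists_ne T hT hbd
  obtain ⟨hC, hv, hi, hc⟩ := h
  obtain ⟨-, hw, hiw, hcw⟩ := hb
  obtain ⟨A, B, hsep, hCA, hA, hB⟩ := T.exists_sep hC hw hiw
  obtain ⟨a, b, hab, hst⟩ := hC.1.star hw
  have ha : a ∈ G.star C w := by simp [hst]
  have hb : b ∈ G.star C w := by simp [hst]
  have h1 := hbd w
  rw [hsep.bd_eq _ (fun e he => T.indicator_of_notMem he),
    bd_indicator_pair (hA.trans hst) hab, T.indicator_cycle hC ha.1,
    T.indicator_cycle hC hb.1] at h1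
  rw [Orientation.isConst_pair hst] at hcw
  have h2 : δ.ar a * 1 + δ.ar b * 1 = 0 := by
    rcases Orientation.units_cases (δ.arrow a.1 a.2) with h | h <;>
    rcases Orientation.units_cases (δ.arrow b.1 b.2) with h' | h' <;>
      simp [h, h', Orientation.ar] at hcw ⊢
  rw [h2, zero_add] at h1
  rcases hB with ⟨C', hC', hCB, hw', hB⟩ | ⟨P, hP, k, -, hk, hB⟩
  · obtain ⟨a', b', hab', hst'⟩ := hC'.1.star hw'
    have ha' : a' ∈ G.star C' w := by simp [hst']
    have hb' : b' ∈ G.star C' w := by simp [hst']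
    rw [bd_indicator_pair (hB.trans hst') hab', T.indicator_cycle hC' ha'.1,
      T.indicator_cycle hC' hb'.1] at h1
    refine ⟨C', w, ⟨hC', hw', hiw, fun hc' => ?_⟩, ?_⟩
    · rw [Orientation.isConst_pair hst'] at hc'
      rw [hc'] at h1
      rcases Orientation.units_cases (δ.arrow b'.1 b'.2) with h | h <;>
        simp only [Orientation.ar, h] at h1 <;> norm_num at h1
    · refine Set.ncard_lt_ncard ⟨?_, fun hsub => ?_⟩ (Set.toFinite _)
      · rintro x ⟨hx, e, he, hex⟩
        have hvB : v ∉ G.verts B := fun hvB =>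
          hwv (hsep.verts_inter v (verts_mono hCA hv) hvB).symm
        -- A connection from `C'` outside `w` stays in `B`, which does not contain the vertex `v`,
        -- so it is a connection outside `v` as well.
        have hxB : x ∈ {y | y ∈ B ∧ G.SameComponent T.edges {v} e y} := by
          refine hex.mem_of_closed ⟨hCB he, .refl _⟩ ?_
          rintro u hu y hy z hz ⟨hyB, hyv⟩
          have huB : u ∈ G.verts B := mem_verts.2 ⟨y, hyB, hy.2⟩
          refine ⟨hsep.symm.mem_left_of_star hu huB hz, hyv.trans (.of_star hy hz ?_)⟩
          rintro rfl
          exact hvB huB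
        refine ⟨hx, a.1, ha.1, ?_⟩
        have h3 : G.SameComponent T.edges {v} a.1 a'.1 :=
          .of_star ⟨hC.2 ha.1, ha.2⟩ ⟨hC'.2 ha'.1, ha'.2⟩ hwv
        exact (h3.trans (hC'.1.sameComponent hC'.2 v ha'.1 he)).trans hxB.2
      · have h3 : a.1 ∈ T.comp C v := ⟨hC.2 ha.1, a.1, ha.1, .refl _⟩
        obtain ⟨-, e, he, hea⟩ := hsub h3
        exact Set.disjoint_left.1 hsep.disjoint (hCA ha.1)
          (hsep.symm.mem_of_sameComponent hea (hCB he))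
  · have hk' : k ∈ G.star P.edges w := by simp [hk]
    rw [bd_indicator_single hB, T.indicator_path hP hk'.1] at h1
    exfalso
    rcases Orientation.units_cases (δ.arrow k.1 k.2) with h | h <;>
      simp only [Orientation.ar, h] at h1 <;> norm_num at h1

/-- Each intersection vertex on a block cycle is a sink or a source of the cycle. -/
theorem isConst_of_inter (hT : T.IsEulerian) (hbd : ∀ v, G.bd δ.ar T.indicator v = 0) {C : Set E}
    (hC : C ∈ T.cycles) {v : V} (hv : v ∈ G.verts C) (hi : v ∈ T.interVerts) : δ.IsConst C v := by
  by_contra hc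
  have key : ∀ n C v, T.IsBad δ C v → (T.comp C v).ncard = n → False := by
    intro n
    induction n using Nat.strong_induction_on with
    | _ n ih =>
      intro C v h hn
      obtain ⟨C', w, h1, h2⟩ := h.exists_smaller T hT hbd
      exact ih _ (hn ▸ h2) C' w h1 rfl
  exact key _ C v ⟨hC, hv, hi, hc⟩ rfl

/-- At an intersection vertex each side has even degree in `p`, so the two half-edges of a cycle
there carry equal values; since all arrows on a side agree, conservation then ties the sides
together. At any other vertex conservation alone ties the two half-edges. -/
theorem flow_eq_zero_of_star (hT : T.IsEulerian) (hbd : ∀ v, G.bd δ.ar T.indicator v = 0)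
    {p : E → ℤ} (h0 : ∀ e, 0 ≤ p e) (h1 : ∀ e, p e ≤ T.indicator e)
    (hp : ∀ v, G.bd δ.ar p v = 0) {v : V} {h k : E × Bool} (hh : h ∈ G.star T.edges v)
    (hk : k ∈ G.star T.edges v) (hz : p h.1 = 0) : p k.1 = 0 := by
  have hpS : ∀ e, e ∉ T.edges → p e = 0 := fun e he =>
    le_antisymm ((h1 e).trans (T.indicator_of_notMem he).le) (h0 e)
  have hIS : ∀ e, e ∉ T.edges → T.indicator e = 0 := fun e he => T.indicator_of_notMem he
  have units := fun h : E × Bool => Orientation.units_cases (δ.arrow h.1 h.2)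
  by_cases hi : v ∈ T.interVerts
  · obtain ⟨C, hC, hv⟩ := T.exists_cycle_of_inter hi
    obtain ⟨A, B, hsep, hCA, hA, hB⟩ := T.exists_sep hC hv hi
    obtain ⟨a, b, hab, hst⟩ := hC.1.star hv
    have ha : a ∈ G.star C v := by simp [hst]
    have hb : b ∈ G.star C v := by simp [hst]
    have e1 := hbd v
    have e2 := hp v
    have e3 := hsep.even_bd hpS (fun w => Orientation.even_bd_of_flow (hp w))
    have e4 := hsep.symm.even_bd hpS (fun w => Orientation.even_bd_of_flow (hp w))
    have hcst := T.isConst_of_inter hT hbd hC hv hi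
    rw [Orientation.isConst_pair hst] at hcst
    rw [hsep.bd_eq _ hIS, bd_indicator_pair (hA.trans hst) hab, T.indicator_cycle hC ha.1,
      T.indicator_cycle hC hb.1] at e1
    rw [hsep.bd_eq _ hpS, bd_indicator_pair (hA.trans hst) hab] at e2
    rw [bd_indicator_pair (hA.trans hst) hab] at e3
    have ia := h1 a.1
    have ib := h1 b.1
    rw [T.indicator_cycle hC ha.1] at ia
    rw [T.indicator_cycle hC hb.1] at ib
    have ja := h0 a.1
    have jb := h0 b.1
    obtain ⟨r, hr⟩ := e3
    simp only [Pi.one_apply, one_mul] at hr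
    -- Both values are `0` or `1` and their sum is even.
    have hpab : p a.1 = p b.1 := by omega
    have split : ∀ x ∈ G.star T.edges v, x ∈ G.star A v ∨ x ∈ G.star B v := by
      rintro x ⟨hx, hxv⟩
      rw [hsep.union] at hx
      exact hx.imp (fun h => ⟨h, hxv⟩) (fun h => ⟨h, hxv⟩)
    rw [hA, hst] at split
    -- it suffices that the two sides carry the same amount
    obtain ⟨q, hq, hqA⟩ : ∃ q : ℤ, (∀ x ∈ G.star B v, p x.1 = 0 ↔ q = 0) ∧ (p a.1 = 0 ↔ q = 0) := by
      rcases hB with ⟨C', hC', hCB, hw', hB⟩ | ⟨P, hP, m, -, hm, hB⟩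
      · obtain ⟨a', b', hab', hst'⟩ := hC'.1.star hw'
        have ha' : a' ∈ G.star C' v := by simp [hst']
        have hb' : b' ∈ G.star C' v := by simp [hst']
        have hcst' := T.isConst_of_inter hT hbd hC' hw' hi
        rw [Orientation.isConst_pair hst'] at hcst'
        rw [bd_indicator_pair (hB.trans hst') hab', T.indicator_cycle hC' ha'.1,
          T.indicator_cycle hC' hb'.1] at e1
        rw [bd_indicator_pair (hB.trans hst') hab'] at e2 e4
        have ia' := h1 a'.1
        have ib' := h1 b'.1
        rw [T.indicator_cycle hC' ha'.1] at ia'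
        rw [T.indicator_cycle hC' hb'.1] at ib'
        have ja' := h0 a'.1
        have jb' := h0 b'.1
        obtain ⟨r', hr'⟩ := e4
        simp only [Pi.one_apply, one_mul] at hr'
        have hpab' : p a'.1 = p b'.1 := by omega
        refine ⟨p a'.1, ?_, ?_⟩
        · rw [hB, hst']
          rintro x (rfl | rfl)
          exacts [Iff.rfl, by rw [hpab']]
        · rw [hcst, hcst'] at e1 e2
          rcases units b with h | h <;> rcases units b' with h' | h' <;>
            simp only [Orientation.ar, h, h'] at e1 e2 <;> omega
      · have hm' : m ∈ G.star P.edges v := by simp [hm]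
        rw [bd_indicator_single hB, T.indicator_path hP hm'.1] at e1
        rw [bd_indicator_single hB] at e2
        refine ⟨p m.1, ?_, ?_⟩
        · rw [hB]
          rintro x rfl
          rfl
        · rw [hcst] at e1 e2
          rcases units b with h | h <;> rcases units m with h' | h' <;>
            simp only [Orientation.ar, h, h'] at e1 e2 <;> omega
    have all : ∀ x ∈ G.star T.edges v, p x.1 = 0 ↔ q = 0 := by
      intro x hx
      rcases split x hx with (rfl | rfl) | hx
      · exact hqA
      · rw [← hpab]; exact hqA
      · exact hq x hx
    exact (all k hk).2 ((all h hh).1 hz)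
  · obtain ⟨a, b, hab, hst, hI⟩ := T.exists_star_of_not_inter (mem_verts.2 ⟨h, hh⟩) hi
    have ha : a ∈ G.star T.edges v := by simp [hst]
    have e1 := hbd v
    have e2 := hp v
    rw [bd_pair hst hab _ hIS] at e1
    rw [bd_pair hst hab _ hpS] at e2
    have hpos := (T.indicator_pos (e := a.1)).2 ha.1
    have hpab : p a.1 = p b.1 := by
      rcases units a with h | h <;> rcases units b with h' | h' <;>
        simp only [Orientation.ar, h, h'] at e1 e2 <;> omega
    rw [hst] at hh hk
    rcases hh with rfl | rfl <;> rcases hk with rfl | rfl <;> omega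

/-- The indicator of an Eulerian cycle-tree is indecomposable with respect to a direction. -/
theorem indicator_indecomposable (hT : T.IsEulerian) {p q : E → ℤ} (hp0 : ∀ e, 0 ≤ p e)
    (hq0 : ∀ e, 0 ≤ q e) (hpq : ∀ e, p e + q e = T.indicator e) (hp : ∀ v, G.bd δ.ar p v = 0)
    (hq : ∀ v, G.bd δ.ar q v = 0) : p = 0 ∨ q = 0 := by
  have hbd : ∀ v, G.bd δ.ar T.indicator v = 0 := by
    intro v
    have h := bd_add (G := G) δ.ar p q v
    rw [hp, hq] at h
    rw [← show (fun e => p e + q e) = T.indicator from funext hpq]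
    simpa using h
  have key : ∀ p : E → ℤ, (∀ e, 0 ≤ p e) → (∀ e, p e ≤ T.indicator e) →
      (∀ v, G.bd δ.ar p v = 0) → ∀ e ∈ T.edges, p e = 0 → p = 0 := by
    intro p h0 h1 hp e he hz
    funext e'
    by_cases he' : e' ∈ T.edges
    · exact (T.connected.2 e he e' he').mem_of_closed (A := {x | p x = 0}) hz
        fun v _ x hx y hy hxz => T.flow_eq_zero_of_star hT hbd h0 h1 hp hx hy hxz
    · exact le_antisymm ((h1 e').trans (T.indicator_of_notMem he').le) (h0 e')
  obtain ⟨C, hC⟩ := T.exists_cycle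
  obtain ⟨e, he⟩ := hC.1.nonempty
  have h1 := hpq e
  rw [T.indicator_cycle hC he] at h1
  have h2 := hp0 e
  have h3 := hq0 e
  -- The indicator is one on a cycle edge, so one summand vanishes there, and by connectedness
  -- everywhere.
  rcases (show p e = 0 ∨ q e = 0 by omega) with h | h
  · exact Or.inl (key p hp0 (fun e => by have := hpq e; have := hq0 e; omega) hp e (hC.2 he) h)
  · exact Or.inr (key q hq0 (fun e => by have := hpq e; have := hp0 e; omega) hq e (hC.2 he) h)

end CycleTree

namespace Orientation

variable [Fintype E] {ε : G.Orientation}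

/-- Trades reversed arrows for changed signs, so that `f` with `ε` corresponds to `|f|` with
`ε.ofFun f`. -/
theorem bd_ofFun (f g : E → ℤ) (v : V) :
    G.bd (ε.ofFun f).ar g v = G.bd ε.ar (fun e => if f e < 0 then -g e else g e) v := by
  refine Finset.sum_congr rfl fun h _ => ?_
  simp only [ar, ofFun]
  split_ifs <;> simp

omit [Fintype E] in
theorem abs_eq_of_eq_coupling {f I : E → ℤ} (hI : ∀ e, 0 ≤ I e)
    (h : ∀ e, f e = ε.coupling (ε.ofFun f) e * I e) (e : E) : |f e| = I e := by
  have h1 := h e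
  have h2 := hI e
  rw [coupling] at h1
  split_ifs at h1
  · rw [h1, one_mul, abs_of_nonneg h2]
  · rw [h1, neg_one_mul, abs_neg, abs_of_nonneg h2]

omit [Fintype E] in
theorem eq_coupling (f : E → ℤ) (e : E) : f e = ε.coupling (ε.ofFun f) e * |f e| := by
  rw [coupling]
  by_cases h : f e < 0
  · rw [if_neg, abs_of_neg h]
    · ring
    · intro h'
      have := h' false
      simp only [ofFun, if_pos h] at this
      rcases Int.units_eq_one_or (ε.arrow e false) with h1 | h1 <;> rw [h1] at this <;>
        exact absurd this (by decide)
  · rw [if_pos, abs_of_nonneg (not_lt.1 h), one_mul]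
    intro b
    simp only [ofFun, if_neg h]

/-- Summands without cancellation have absolute values that add up to the indicator and are flows
for `ε.ofFun f`, so `indicator_indecomposable` applies to them. -/
theorem isIndecomposable_of_indicator [Finite V] {f : E → ℤ} (hf : ε.IsFlow f) (T : G.CycleTree)
    (hT : T.IsEulerian) (h : ∀ e, f e = ε.coupling (ε.ofFun f) e * T.indicator e) :
    ε.IsIndecomposable f := by
  have habs := abs_eq_of_eq_coupling T.indicator_nonneg h
  refine ⟨hf, ?_, ?_⟩
  · rintro rfl
    obtain ⟨e, he⟩ := T.connected.1
    have := T.indicator_pos.2 he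
    rw [← habs] at this
    simp at this
  · rintro ⟨f₁, f₂, h1, h2, hn1, hn2, hpos, rfl⟩
    have sgn : ∀ e, (if (f₁ + f₂) e < 0 then -|f₁ e| else |f₁ e|) = f₁ e ∧
        (if (f₁ + f₂) e < 0 then -|f₂ e| else |f₂ e|) = f₂ e ∧
        |f₁ e| + |f₂ e| = T.indicator e := by
      intro e
      rw [← habs e]
      simp only [Pi.add_apply]
      have h3 : (0 ≤ f₁ e ∧ 0 ≤ f₂ e) ∨ (f₁ e ≤ 0 ∧ f₂ e ≤ 0) := mul_nonneg_iff.1 (hpos e)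
      rcases h3 with ⟨h3, h4⟩ | ⟨h3, h4⟩
      · rw [abs_of_nonneg h3, abs_of_nonneg h4, abs_of_nonneg (add_nonneg h3 h4)]
        split_ifs <;> omega
      · rw [abs_of_nonpos h3, abs_of_nonpos h4, abs_of_nonpos (add_nonpos h3 h4)]
        split_ifs <;> omega
    have b1 : ∀ v, G.bd (ε.ofFun (f₁ + f₂)).ar (fun e => |f₁ e|) v = 0 := by
      intro v
      rw [bd_ofFun]
      simp only [(sgn _).1]
      rw [← boundary_eq]
      exact h1 v
    have b2 : ∀ v, G.bd (ε.ofFun (f₁ + f₂)).ar (fun e => |f₂ e|) v = 0 := by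
      intro v
      rw [bd_ofFun]
      simp only [(sgn _).2.1]
      rw [← boundary_eq]
      exact h2 v
    rcases T.indicator_indecomposable hT (fun e => abs_nonneg _) (fun e => abs_nonneg _)
      (fun e => (sgn e).2.2) b1 b2 with h3 | h3
    · exact hn1 (funext fun e => abs_eq_zero.1 (congrFun h3 e))
    · exact hn2 (funext fun e => abs_eq_zero.1 (congrFun h3 e))

end Orientation

end SignedGraph

/-! ### Minimal closed directed walks and the cactus structure -/

namespace SignedGraph

theorem Wk.tail_eq {D X : Type*} {s t : D → X} {u v : X} {l l' l'' : List D} {d d' : D}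
    (h : Wk s t u l v) (h1 : l = d :: l') (h2 : l = l'' ++ [d']) : l'.map s = l''.map t := by
  have h3 := h.map_append
  have h4 : t d' = v := by
    rw [h2] at h
    exact h.last
  nth_rw 1 [h1] at h3
  rw [h2, List.map_cons, List.map_append, List.cons_append] at h3
  have h5 := (List.cons_eq_cons.1 h3).2
  exact (List.append_inj' h5 (by simp)).1

variable {V E : Type*} {G : SignedGraph V E}

theorem Wk.split_at {u v w : V} {l : List (E × Bool)} (h : Wk G.src G.tgt u l v)
    (hw : w ∈ G.verts (supp l)) : ∃ l1 l2, l = l1 ++ l2 ∧ Wk G.src G.tgt u l1 w ∧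
      Wk G.src G.tgt w l2 v := by
  obtain ⟨k, hk, rfl⟩ := mem_verts.1 hw
  rcases mem_supp'.1 hk with hk | hk
  · obtain ⟨l1, l2, rfl⟩ := List.append_of_mem hk
    obtain ⟨x, h1, h2⟩ := wk_append.1 h
    exact ⟨l1, k :: l2, rfl, by rw [h2.1]; exact h1, ⟨rfl, h2.2⟩⟩
  · obtain ⟨l1, l2, rfl⟩ := List.append_of_mem hk
    obtain ⟨x, h1, h2⟩ := wk_append.1 h
    rw [wk_cons, tgt_flip] at h2
    exact ⟨l1 ++ [flip k], l2, by simp, h1.append ⟨h2.1, by simp⟩, h2.2⟩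

namespace Orientation

variable (ε : G.Orientation)

/-- A closed directed walk that does not contain a smaller one. -/
structure IsTour (W : List (E × Bool)) : Prop where
  ne_nil : W ≠ []
  closed : ∃ x, ε.DWk x W x
  min : ∀ x W', W' ≠ [] → ε.DWk x W' x → (∀ e, cnt W' e ≤ cnt W e) → W.length ≤ W'.length

/-- At `v`, the edges of `A` have a single half-edge, of weight two, or two half-edges, of weight
one and with the same arrow. -/
def IsSide (g : E → ℤ) (A : Set E) (v : V) : Prop :=
  ∃ h k, G.star A v = {h, k} ∧ ε.ar h = ε.ar k ∧ (h = k → g h.1 = 2) ∧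
    (h ≠ k → g h.1 = 1 ∧ g k.1 = 1)

/-- The structure of the support `S` of an indecomposable flow: each vertex `v` either has exactly
two half-edges, or separates `S` in two sides. -/
structure IsCactus (S : Set E) (g : E → ℤ) : Prop where
  connected : G.IsConnected S
  pos : ∀ e, 0 < g e ↔ e ∈ S
  nonneg : ∀ e, 0 ≤ g e
  cyc : ∀ e, g e = 1 → ∃ C, G.IsCycle C ∧ C ⊆ S ∧ e ∈ C
  loc : ∀ v ∈ G.verts S,
    (∃ h k, h ≠ k ∧ G.star S v = {h, k} ∧ g h.1 = 1 ∧ g k.1 = 1 ∧ ε.ar h ≠ ε.ar k) ∨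
    ∃ A B, Sep G S A B v ∧ ε.IsSide g A v ∧ ε.IsSide g B v

variable {ε}

theorem IsTour.of_isRotated {W W' : List (E × Bool)} (h : ε.IsTour W) (hr : W.IsRotated W') :
    ε.IsTour W' := by
  refine ⟨?_, ?_, ?_⟩
  · rintro rfl
    exact h.ne_nil (List.perm_nil.1 hr.perm)
  · obtain ⟨x, hx⟩ := h.closed
    exact Wk.of_isRotated hx hr
  · rw [← cnt_perm hr.perm, ← hr.perm.length_eq]
    exact h.min

theorem IsTour.infix {l1 l2 l3 : List (E × Bool)} (h : ε.IsTour (l1 ++ l2 ++ l3)) (h2 : l2 ≠ [])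
    {x : V × ℤˣ} (hx : ε.DWk x l2 x) : l1 = [] ∧ l3 = [] := by
  have := h.min x l2 h2 hx (fun e => by simp only [cnt_append]; omega)
  simp only [List.length_append] at this
  exact ⟨List.length_eq_zero_iff.1 (by omega), List.length_eq_zero_iff.1 (by omega)⟩

/-- A repeated state would cut out a shorter closed directed walk. As a vertex has only two states,
it is visited at most twice. -/
theorem IsTour.nodup {W : List (E × Bool)} (h : ε.IsTour W) : (W.map ε.tst).Nodup := by
  by_contra hn
  obtain ⟨d, l, rfl⟩ := List.exists_cons_of_ne_nil h.ne_nil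
  obtain ⟨x, hx⟩ := h.closed
  obtain ⟨l1, l2, l3, w, rfl, h1, h2, h3, h4⟩ := hx.2.exists_closed_infix hn
  have := (IsTour.infix (l1 := d :: l1) (by simpa using h) h1 h3).1
  simp at this

theorem DWk.split_at {x y : V × ℤˣ} {w : V} {l : List (E × Bool)} (h : ε.DWk x l y)
    (hw : w ∈ G.verts (supp l)) : ∃ l1 l2 r, l = l1 ++ l2 ∧ ε.DWk x l1 (w, r) ∧
      ε.DWk (w, r) l2 y := by
  obtain ⟨l1, l2, rfl, h1, h2⟩ := h.wk.split_at hw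
  obtain ⟨z, h3, h4⟩ := wk_append.1 h
  have : z.1 = w := (DWk.wk h3).eq_end h1
  subst this
  exact ⟨l1, l2, z.2, rfl, h3, h4⟩

theorem units_eq_neg {a b : ℤˣ} (h : a ≠ b) : a = -b := by
  rcases Int.units_eq_one_or a with rfl | rfl <;> rcases Int.units_eq_one_or b with rfl | rfl <;>
    simp at h ⊢

theorem ne_neg_units (a : ℤˣ) : a ≠ -a := by
  rcases Int.units_eq_one_or a with rfl | rfl <;> decide

/-- The two parts in which a tour is divided by a vertex do not cross. -/
theorem IsTour.verts_inter {A B : List (E × Bool)} (h : ε.IsTour (A ++ B)) {v : V} {s : ℤˣ}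
    (hA : ε.DWk (v, s) A (v, -s)) (hB : ε.DWk (v, -s) B (v, s)) {w : V}
    (hwA : w ∈ G.verts (supp A)) (hwB : w ∈ G.verts (supp B)) : w = v := by
  by_contra hwv
  obtain ⟨A1, A2, r, rfl, a1, a2⟩ := hA.split_at hwA
  obtain ⟨B1, B2, r', rfl, b1, b2⟩ := hB.split_at hwB
  have hA1 : A1 ≠ [] := by
    rintro rfl
    exact hwv (congrArg Prod.fst (show (v, s) = (w, r) from a1)).symm
  have hA2 : A2 ≠ [] := by
    rintro rfl
    exact hwv (congrArg Prod.fst (show (w, r) = (v, -s) from a2))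
  -- If both parts reach `w` in the same state, the piece from `w` through `v` back to `w` is
  -- closed. If the states are opposite, one can go from `v` to `w` along `A1` and return along the
  -- reverse of `B1`. Either way there is a shorter closed directed walk.
  by_cases hr : r' = r
  · subst hr
    exact hA1 (IsTour.infix (l1 := A1) (l2 := A2 ++ B1) (l3 := B2) (by simpa using h) (by simp [hA2])
      (Wk.append a2 b1)).1
  · have h1 := b1.reverse
    simp only [negState, neg_neg, units_eq_neg hr] at h1
    have h2 := h.min _ (A1 ++ (B1.map flip).reverse) (by simp [hA1]) (Wk.append a1 h1) ?_
    · have := List.length_pos_iff.2 hA2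
      simp at h2
      omega
    · intro e
      have : cnt (B1.map flip).reverse e = cnt B1 e := by
        rw [cnt_perm (List.reverse_perm _), cnt, cnt, List.map_map]
        rfl
      simp only [cnt_append, this]
      omega

/-- A directed walk from `(v, s)` to `(v, -s)` that does not visit `v` in between. -/
theorem DWk.isSide {A l'' : List (E × Bool)} {d' : E × Bool} {v : V} {s : ℤˣ}
    (h : ε.DWk (v, s) A (v, -s)) (hA : A = l'' ++ [d']) (hv : ∀ x ∈ l'', G.tgt x ≠ v) {g : E → ℤ}
    (hg : ∀ e ∈ supp A, g e = cnt A e) :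
    ε.IsSide g (supp A) v ∧ ∀ h ∈ G.star (supp A) v, ε.arrow h.1 h.2 = s := by
  classical
  obtain ⟨d, l', hd⟩ := List.exists_cons_of_ne_nil (show A ≠ [] by simp [hA])
  have e1 : ε.sst d = (v, s) := by
    rw [hd] at h
    exact h.1
  have e2 : ε.tst d' = (v, -s) := by
    rw [hA] at h
    exact h.last
  have hs : ∀ x ∈ l', G.src x ≠ v := by
    intro x hx hxv
    have h1 := h.wk.tail_eq hd hA
    have h2 : v ∈ l'.map G.src := List.mem_map.2 ⟨x, hx, hxv⟩
    rw [h1] at h2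
    obtain ⟨y, hy, hyv⟩ := List.mem_map.1 h2
    exact hv y hy hyv
  have e3 : G.src d = v := congrArg Prod.fst e1
  have e4 : G.tgt d' = v := congrArg Prod.fst e2
  have e5 : ε.arrow d.1 d.2 = s := congrArg Prod.snd e1
  have e6 : ε.arrow (flip d').1 (flip d').2 = s := neg_injective (congrArg Prod.snd e2)
  have hst := star_of_ends hd hA e3 e4 hs hv
  have m1 : d.1 ∈ supp A := fst_mem_supp (by simp [hd])
  have m2 : (flip d').1 ∈ supp A := fst_mem_supp (d := d') (by simp [hA])
  -- The walk leaves `v` by the half-edge `d` and returns by `flip d'`. If these coincide the edge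
  -- is used twice, otherwise each of the half-edges is used once.
  refine ⟨⟨d, flip d', hst, by rw [ar, ar, e5, e6], fun heq => ?_, fun hne => ?_⟩, ?_⟩
  · rw [hg _ m1, cnt_of_ends hd hA hs hv e3, if_pos rfl, if_pos heq]
    norm_num
  · rw [hg _ m1, hg _ m2, cnt_of_ends hd hA hs hv e3, cnt_of_ends hd hA hs hv (h := flip d') e4,
      if_pos rfl, if_neg hne, if_pos rfl, if_neg hne.symm]
    norm_num
  · rw [hst]
    rintro _ (rfl | rfl)
    exacts [e5, e6]

/-- A vertex visited once has just the arriving and the leaving half-edge, with opposite arrows. A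
second visit is in the opposite state, and it splits the tour into two parts that meet only in `v`
by `verts_inter`. -/
theorem IsTour.loc {W : List (E × Bool)} (h : ε.IsTour W) {v : V} (hv : v ∈ G.verts (supp W)) :
    (∃ h k, h ≠ k ∧ G.star (supp W) v = {h, k} ∧ (cnt W h.1 : ℤ) = 1 ∧ (cnt W k.1 : ℤ) = 1 ∧
      ε.ar h ≠ ε.ar k) ∨
    ∃ A B, Sep G (supp W) A B v ∧ ε.IsSide (fun e => cnt W e) A v ∧
      ε.IsSide (fun e => cnt W e) B v := by
  classical
  obtain ⟨x, hx⟩ := h.closed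
  obtain ⟨d₀, hd₀, rfl⟩ := List.mem_map.1 (exists_mem_map_src hx.wk hv)
  obtain ⟨W', hr, hx'⟩ := Wk.rotate hx (List.mem_map.2 ⟨d₀, hd₀, rfl⟩)
  have h' := h.of_isRotated hr
  rw [supp_perm hr.perm, cnt_perm hr.perm]
  obtain ⟨v, s, hvs⟩ : ∃ v s, ε.sst d₀ = (v, s) := ⟨_, _, rfl⟩
  obtain rfl : G.src d₀ = v := congrArg Prod.fst hvs
  rw [hvs] at hx'
  clear hx hr h hv hvs hd₀
  generalize G.src d₀ = v at *
  obtain ⟨d, l', l'', d', e1, e2, e3, e4, hs, ht⟩ := hx'.ends h'.ne_nil h'.nodup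
  have f3 : G.src d = v := congrArg Prod.fst e3
  have f4 : G.tgt d' = v := congrArg Prod.fst e4
  by_cases hvis : ∃ y ∈ l'', G.tgt y = v
  · right
    obtain ⟨y, hy, hyv⟩ := hvis
    have tst_eq : ∀ z ∈ l'', G.tgt z = v → ε.tst z = (v, -s) := by
      intro z hz hzv
      refine Prod.ext hzv (units_eq_neg fun hc => ht z hz (Prod.ext hzv hc))
    obtain ⟨p, q, rfl⟩ := List.append_of_mem hy
    have hnd := h'.nodup
    rw [e2] at hnd
    simp only [List.append_assoc, List.cons_append, List.map_append, List.map_cons] at hnd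
    rw [List.nodup_append, List.nodup_cons] at hnd
    have hp : ∀ z ∈ p, G.tgt z ≠ v := fun z hz hzv =>
      hnd.2.2 (ε.tst z) (List.mem_map.2 ⟨z, hz, rfl⟩) (ε.tst y) (by simp)
        ((tst_eq z (by simp [hz]) hzv).trans (tst_eq y hy hyv).symm)
    have hq : ∀ z ∈ q, G.tgt z ≠ v := fun z hz hzv =>
      hnd.2.1.1 ((tst_eq y hy hyv).trans (tst_eq z (by simp [hz]) hzv).symm ▸
        List.mem_append_left _ (List.mem_map.2 ⟨z, hz, rfl⟩))
    have hW : W' = (p ++ [y]) ++ (q ++ [d']) := by simp [e2]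
    rw [hW] at hx' h' ⊢
    obtain ⟨z, hA, hB⟩ := wk_append.1 hx'
    have hz : z = (v, -s) := by
      rw [← hA.last, tst_eq y hy hyv]
    subst hz
    have hdis : ∀ g : E × Bool, g ∈ G.star (supp (p ++ [y])) v →
        g ∈ G.star (supp (q ++ [d'])) v → False := by
      intro g hg hg'
      have a1 := (DWk.isSide hA rfl hp (fun e _ => rfl)).2 g hg
      have a2 := (DWk.isSide (s := -s) (by rwa [neg_neg]) rfl hq (fun e _ => rfl)).2 g hg'
      exact ne_neg_units s (a1.symm.trans a2)
    -- A common edge would be attached to `v`, the only common vertex, but the arrows at `v` are `s`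
    -- in the first part and `-s` in the second.
    have hdisj : Disjoint (supp (p ++ [y])) (supp (q ++ [d'])) := by
      rw [Set.disjoint_left]
      intro e he he'
      have hev := h'.verts_inter hA hB (src_mem_verts (h := (e, false)) he)
        (src_mem_verts (h := (e, false)) he')
      exact hdis (e, false) ⟨he, hev⟩ ⟨he', hev⟩
    refine ⟨supp (p ++ [y]), supp (q ++ [d']), ⟨supp_append _ _, hdisj, fun w hw hw' =>
      h'.verts_inter hA hB hw hw'⟩, (DWk.isSide hA rfl hp ?_).1,
      (DWk.isSide (s := -s) (by rwa [neg_neg]) rfl hq ?_).1⟩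
    · intro e he
      have : cnt (q ++ [d']) e = 0 := by
        exact Nat.eq_zero_of_not_pos fun h => Set.disjoint_left.1 hdisj he (cnt_pos.1 h)
      rw [cnt_append, this, add_zero]
    · intro e he
      have : cnt (p ++ [y]) e = 0 := by
        exact Nat.eq_zero_of_not_pos fun h => Set.disjoint_right.1 hdisj he (cnt_pos.1 h)
      rw [cnt_append, this, zero_add]
  · left
    push Not at hvis
    have hs' : ∀ x ∈ l', G.src x ≠ v := by
      intro x hx hxv
      have h1 := (DWk.wk hx').tail_eq e1 e2
      have h2 : v ∈ l'.map G.src := List.mem_map.2 ⟨x, hx, hxv⟩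
      rw [h1] at h2
      obtain ⟨y, hy, hyv⟩ := List.mem_map.1 h2
      exact hvis y hy hyv
    have a1 : ε.arrow d.1 d.2 = s := congrArg Prod.snd e3
    have a2 : -ε.arrow (flip d').1 (flip d').2 = s := congrArg Prod.snd e4
    have hne : ε.ar d ≠ ε.ar (flip d') := by
      intro hc
      have : ε.arrow d.1 d.2 = ε.arrow (flip d').1 (flip d').2 := Units.ext hc
      rw [← this, a1] at a2
      exact ne_neg_units s a2.symm
    have hne' : d ≠ flip d' := fun hc => hne (by rw [← hc])
    refine ⟨d, flip d', hne', star_of_ends e1 e2 f3 f4 hs' hvis, ?_, ?_, hne⟩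
    · rw [cnt_of_ends e1 e2 hs' hvis f3, if_pos rfl, if_neg hne']
      norm_num
    · rw [cnt_of_ends e1 e2 hs' hvis (h := flip d') f4, if_pos rfl, if_neg hne'.symm]
      norm_num

/-- Besides the local structure, only the edges of weight one need an argument: the rest of the tour
joins the ends of such an edge without using it, and so closes a cycle through it. -/
theorem IsTour.isCactus {W : List (E × Bool)} (h : ε.IsTour W) :
    ε.IsCactus (supp W) (fun e => cnt W e) := by
  obtain ⟨x, hx⟩ := h.closed
  refine ⟨⟨supp_nonempty h.ne_nil, fun e he e' he' =>
    hx.wk.sameComponent_of_mem subset_rfl he he'⟩, fun e => ?_, fun e => by positivity, ?_,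
    fun v hv => h.loc hv⟩
  · rw [← cnt_pos]
    exact_mod_cast Iff.rfl
  · intro e he
    have he1 : cnt W e = 1 := by exact_mod_cast he
    obtain ⟨b, hb⟩ : e ∈ supp W := cnt_pos.1 (by omega)
    obtain ⟨l1, l2, hl⟩ := List.append_of_mem hb
    have hw := hx.wk
    rw [hl] at hw
    obtain ⟨w, h1, h2⟩ := wk_append.1 hw
    have hns : e ∉ supp (l2 ++ l1) := by
      classical
      rw [← cnt_pos]
      rw [hl, cnt_append, cnt_cons, if_pos rfl] at he1
      rw [cnt_append]
      omega
    obtain ⟨C, hC, heC, hCS⟩ := exists_cycle_through (d := (e, b)) (l := l2 ++ l1)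
      (h2.2.append (by rw [h2.1]; exact h1)) hns
    refine ⟨C, hC, fun e' he' => ?_, heC⟩
    have h3 := hCS he'
    rw [hl]
    rw [← supp_cons] at h3
    exact supp_mono (by intro; simp; tauto) h3

/-- The absolute value of an indecomposable flow has the structure of a cactus. -/
theorem IsIndecomposable.isCactus [Fintype E] {f : E → ℤ} (h : ε.IsIndecomposable f) :
    (ε.ofFun f).IsCactus {e | f e ≠ 0} (fun e => |f e|) := by
  obtain ⟨hf, hne, hind⟩ := h
  have sgn : ∀ e, (if f e < 0 then -|f e| else |f e|) = f e := by
    intro e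
    split_ifs with h
    · rw [abs_of_neg h, neg_neg]
    · rw [abs_of_nonneg (not_lt.1 h)]
  have hbd : ∀ v, G.bd (ε.ofFun f).ar (fun e => |f e|) v = 0 := by
    intro v
    rw [bd_ofFun]
    simp only [sgn]
    rw [← boundary_eq]
    exact hf v
  -- A closed directed walk below `|f|` is a flow, and splitting it off leaves a flow without
  -- cancellation. By indecomposability nothing is left. So all such walks have the same counts,
  -- which also makes any one of them minimal.
  have key : ∀ x W, W ≠ [] → (ε.ofFun f).DWk x W x → (∀ e, (cnt W e : ℤ) ≤ |f e|) →
      ∀ e, (cnt W e : ℤ) = |f e| := by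
    classical
    intro x W hW hx hle
    set f₁ : E → ℤ := fun e => if f e < 0 then -(cnt W e : ℤ) else cnt W e with hf₁
    have h1 : ε.IsFlow f₁ := by
      intro v
      rw [boundary_eq, hf₁, ← bd_ofFun, hx.bd, sub_self]
    by_contra! hcon
    refine hind ⟨f₁, fun e => f e - f₁ e, h1, ?_, ?_, ?_, ?_, ?_⟩
    · intro v
      rw [boundary_eq, bd_sub, ← boundary_eq, ← boundary_eq, hf v, h1 v, sub_self]
    · intro h0
      obtain ⟨e, he⟩ := supp_nonempty hW
      have h2 := congrFun h0 e
      have h3 := cnt_pos.2 he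
      simp only [hf₁, Pi.zero_apply] at h2
      split_ifs at h2 <;> omega
    · intro h0
      obtain ⟨e, he⟩ := hcon
      have h2 := congrFun h0 e
      simp only [hf₁, Pi.zero_apply] at h2
      have h3 := sgn e
      split_ifs at h2 h3 <;> omega
    · intro e
      have h2 := hle e
      have h3 := sgn e
      simp only [hf₁]
      have h4 : (0 : ℤ) ≤ cnt W e := by positivity
      split_ifs at h3 ⊢
      · exact mul_nonneg_of_nonpos_of_nonpos (by omega) (by omega)
      · exact mul_nonneg (by omega) (by omega)
    · ext e
      simp
  obtain ⟨x, W, hW, hx, hle⟩ := exists_tour (ε := ε.ofFun f) (f := fun e => |f e|)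
    (fun e => abs_nonneg _) (fun h0 => hne (funext fun e => abs_eq_zero.1 (congrFun h0 e))) hbd
  have heq := key x W hW hx hle
  have htour : (ε.ofFun f).IsTour W := by
    refine ⟨hW, ⟨x, hx⟩, fun y W' hW' hy hle' => ?_⟩
    have h2 := key y W' hW' hy (fun e => (Int.ofNat_le.2 (hle' e)).trans (heq e).le)
    rw [← sum_cnt W, ← sum_cnt W']
    refine Finset.sum_le_sum fun e _ => ?_
    have := (heq e).trans (h2 e).symm
    omega
  have h3 := htour.isCactus
  have h4 : (fun e => (cnt W e : ℤ)) = fun e => |f e| := funext heq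
  have h5 : supp W = {e | f e ≠ 0} := by
    ext e
    rw [← h3.pos, heq e]
    exact abs_pos
  rwa [h4, h5] at h3

end Orientation

end SignedGraph

/-! ### From the cactus structure to an Eulerian cycle-tree -/

namespace SignedGraph

variable {V E : Type*} {G : SignedGraph V E} {ε : G.Orientation} {S : Set E} {g : E → ℤ}

namespace Orientation.IsCactus

/-- The cycle has two half-edges at `v` and a side has at most two, so the cycle exhausts its side,
which is then of the kind with weights one. -/
theorem side_of_cycle {A C : Set E} {v : V} (hA : ε.IsSide g A v) (hC : G.IsCycle C) (hCA : C ⊆ A)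
    (hv : v ∈ G.verts C) : G.star C v = G.star A v ∧ ε.IsConst C v ∧
      ∀ x ∈ G.star A v, g x.1 = 1 := by
  obtain ⟨a, b, hab, hst⟩ := hC.star hv
  obtain ⟨h, k, hst', har, h2, h1⟩ := hA
  have hsub := star_mono (G := G) hCA v
  rw [hst, hst'] at hsub
  have heq := pair_eq_of_subset hab hsub
  have hne : h ≠ k := by
    rintro rfl
    have ha : a = h := by simpa using hsub (show a ∈ ({a, b} : Set _) by simp)
    have hb : b = h := by simpa using hsub (show b ∈ ({a, b} : Set _) by simp)
    exact hab (ha.trans hb.symm)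
  refine ⟨by rw [hst, hst', heq], (Orientation.isConst_pair (hst.trans heq)).2 har, ?_⟩
  rw [hst']
  rintro _ (rfl | rfl)
  exacts [(h1 hne).1, (h1 hne).2]

theorem side_heavy {A : Set E} {v : V} (hA : ε.IsSide g A v) {x : E × Bool}
    (hx : x ∈ G.star A v) (h2 : g x.1 = 2) : G.star A v = {x} := by
  obtain ⟨h, k, hst, -, -, h1⟩ := hA
  rw [hst] at hx ⊢
  by_cases hk : h = k
  · subst hk
    simp only [Set.mem_insert_iff, Set.mem_singleton_iff, or_self] at hx
    rw [hx, Set.pair_eq_singleton]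
  · rcases hx with rfl | rfl
    · have := (h1 hk).1; omega
    · have := (h1 hk).2; omega

theorem star_union {A B : Set E} {v : V} (h : Sep G S A B v) :
    G.star S v = G.star A v ∪ G.star B v := by
  ext x
  simp only [mem_star, Set.mem_union, h.union]
  tauto

variable (K : ε.IsCactus S g)
include K

/-- The local structure at a vertex of a cycle. -/
theorem loc_cycle {C : Set E} (hC : G.IsCycle C) (hCS : C ⊆ S) {v : V} (hv : v ∈ G.verts C) :
    (G.star C v = G.star S v ∧ ¬ ε.IsConst C v ∧ ∀ x ∈ G.star S v, g x.1 = 1) ∨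
    ∃ A B, Sep G S A B v ∧ ε.IsSide g A v ∧ ε.IsSide g B v ∧ C ⊆ A := by
  rcases K.loc v (verts_mono hCS hv) with ⟨h, k, hne, hst, h1, h2, h3⟩ | ⟨A, B, hsep, hA, hB⟩
  · left
    obtain ⟨a, b, hab, hst'⟩ := hC.star hv
    have hsub := star_mono (G := G) hCS v
    rw [hst, hst'] at hsub
    have heq := pair_eq_of_subset hab hsub
    refine ⟨by rw [hst, hst', heq], ?_, ?_⟩
    · rwa [Orientation.isConst_pair (hst'.trans heq)]
    · rw [hst]
      rintro _ (rfl | rfl)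
      exacts [h1, h2]
  · right
    rcases hsep.cycle hC hCS with h | h
    · exact ⟨A, B, hsep, hA, hB, h⟩
    · exact ⟨B, A, hsep.symm, hB, hA, h⟩

/-- Together with the field `cyc`, this makes the weights tell cycle edges from path edges. -/
theorem eq_one_of_cycle {C : Set E} (hC : G.IsCycle C) (hCS : C ⊆ S) {e : E} (he : e ∈ C) :
    g e = 1 := by
  have hv : G.src (e, false) ∈ G.verts C := src_mem_verts he
  rcases K.loc_cycle hC hCS hv with ⟨-, -, h⟩ | ⟨A, B, hsep, hA, hB, hCA⟩
  · exact h (e, false) ⟨hCS he, rfl⟩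
  · exact (side_of_cycle hA hC hCA hv).2.2 (e, false) ⟨hCA he, rfl⟩

/-- At a vertex with a common half-edge, `C'` exhausts the whole star or that of its side, and `C`
lies on the same side. So `C` never leaves `C'`. -/
theorem cycle_subset_of_mem {C C' : Set E} (hC : G.IsCycle C) (hCS : C ⊆ S) (hC' : G.IsCycle C')
    (hCS' : C' ⊆ S) {e : E} (he : e ∈ C) (he' : e ∈ C') : C ⊆ C' := by
  refine hC.subset_of_star he he' ?_
  rintro v ⟨x, hx, hx'⟩
  have hv' : v ∈ G.verts C' := mem_verts.2 ⟨x, hx'⟩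
  have hv : v ∈ G.verts C := mem_verts.2 ⟨x, hx⟩
  rcases K.loc_cycle hC' hCS' hv' with ⟨h, -, -⟩ | ⟨A, B, hsep, hA, hB, hCA'⟩
  · rw [h]
    exact star_mono hCS v
  · rcases hsep.cycle hC hCS with h | h
    · rw [(side_of_cycle hA hC' hCA' hv').1]
      exact star_mono h v
    · exact absurd (h hx.1) (Set.disjoint_left.1 hsep.disjoint (hCA' hx'.1))

theorem cycle_eq {C C' : Set E} (hC : C ∈ G.cyclesIn S) (hC' : C' ∈ G.cyclesIn S) {e : E}
    (he : e ∈ C) (he' : e ∈ C') : C = C' :=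
  (K.cycle_subset_of_mem hC.1 hC.2 hC'.1 hC'.2 he he').antisymm
    (K.cycle_subset_of_mem hC'.1 hC'.2 hC.1 hC.2 he' he)

/-- A common vertex of two cycles separates them. -/
theorem sep_of_cycles {C C' : Set E} (hC : C ∈ G.cyclesIn S) (hC' : C' ∈ G.cyclesIn S)
    (hne : C ≠ C') {v : V} (hv : v ∈ G.verts C) (hv' : v ∈ G.verts C') :
    ∃ A B, Sep G S A B v ∧ ε.IsSide g A v ∧ ε.IsSide g B v ∧ C ⊆ A ∧ C' ⊆ B := by
  obtain ⟨x, hx⟩ := mem_verts.1 hv'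
  rcases K.loc_cycle hC.1 hC.2 hv with ⟨h, -, -⟩ | ⟨A, B, hsep, hA, hB, hCA⟩
  · have := star_mono (G := G) hC'.2 v hx
    rw [← h] at this
    exact absurd (K.cycle_eq hC hC' this.1 hx.1) hne
  · rcases hsep.cycle hC'.1 hC'.2 with h | h
    · have := star_mono (G := G) h v hx
      rw [← (side_of_cycle hA hC.1 hCA hv).1] at this
      exact absurd (K.cycle_eq hC hC' this.1 hx.1) hne
    · exact ⟨A, B, hsep, hA, hB, hCA, h⟩

/-- Two cycles at `v` exhaust the two sides, so a third one would share a half-edge with one of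
them. -/
theorem cycles_le_two (v : V) : {C ∈ G.cyclesIn S | v ∈ G.verts C}.encard ≤ 2 := by
  by_contra hcon
  rw [not_le] at hcon
  obtain ⟨t, ht, ht3⟩ := Set.exists_subset_encard_eq (Order.add_one_le_of_lt hcon)
  obtain ⟨C₁, C₂, C₃, h12, h13, h23, rfl⟩ := Set.encard_eq_three.1 (ht3.trans (by norm_num))
  obtain ⟨m1, v1⟩ := ht (show C₁ ∈ ({C₁, C₂, C₃} : Set _) by simp)
  obtain ⟨m2, v2⟩ := ht (show C₂ ∈ ({C₁, C₂, C₃} : Set _) by simp)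
  obtain ⟨m3, v3⟩ := ht (show C₃ ∈ ({C₁, C₂, C₃} : Set _) by simp)
  obtain ⟨A, B, hsep, hA, hB, hA1, hB2⟩ := K.sep_of_cycles m1 m2 h12 v1 v2
  obtain ⟨x, hx⟩ := mem_verts.1 v3
  rcases hsep.cycle m3.1 m3.2 with h | h
  · have := star_mono (G := G) h v hx
    rw [← (side_of_cycle hA m1.1 hA1 v1).1] at this
    exact h13 (K.cycle_eq m1 m3 this.1 hx.1)
  · have := star_mono (G := G) h v hx
    rw [← (side_of_cycle hB m2.1 hB2 v2).1] at this
    exact h23 (K.cycle_eq m2 m3 this.1 hx.1)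

theorem eq_one_or_two {e : E} (he : e ∈ S) : g e = 1 ∨ g e = 2 := by
  have key : ∀ A v, (e, false) ∈ G.star A v → ε.IsSide g A v → g e = 1 ∨ g e = 2 := by
    rintro A v hx ⟨h, k, hst, -, h2, h1⟩
    rw [hst] at hx
    by_cases hk : h = k
    · subst hk
      simp only [Set.mem_insert_iff, Set.mem_singleton_iff, or_self] at hx
      rw [← hx] at h2
      exact Or.inr (h2 rfl)
    · rcases hx with hx | hx
      · rw [← hx] at h1
        exact Or.inl (h1 (hx ▸ hk)).1
      · rw [← hx] at h1
        exact Or.inl (h1 (hx ▸ hk)).2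
  have hx : (e, false) ∈ G.star S (G.src (e, false)) := ⟨he, rfl⟩
  rcases K.loc _ (src_mem_verts (h := (e, false)) he) with
    ⟨h, k, hne, hst, h1, h2, h3⟩ | ⟨A, B, hsep, hA, hB⟩
  · rw [hst] at hx
    rcases hx with hx | hx
    · rw [← hx] at h1; exact Or.inl h1
    · rw [← hx] at h2; exact Or.inl h2
  · rw [hsep.union] at he
    rcases he with he | he
    · exact key A _ ⟨he, rfl⟩ hA
    · exact key B _ ⟨he, rfl⟩ hB

/-- An edge of weight two is separated at its ends from all other edges. -/
theorem sep_of_heavy {v : V} {x : E × Bool} (hx : x ∈ G.star S v) (h2 : g x.1 = 2) :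
    ∃ A B, Sep G S A B v ∧ ε.IsSide g A v ∧ ε.IsSide g B v ∧ G.star A v = {x} := by
  rcases K.loc v (mem_verts.2 ⟨x, hx⟩) with ⟨h, k, hne, hst, h1, h2', h3⟩ | ⟨A, B, hsep, hA, hB⟩
  · rw [hst] at hx
    rcases hx with rfl | rfl <;> omega
  · have := hx.1
    rw [hsep.union] at this
    rcases this with h | h
    · exact ⟨A, B, hsep, hA, hB, side_heavy hA ⟨h, hx.2⟩ h2⟩
    · exact ⟨B, A, hsep.symm, hB, hA, side_heavy hB ⟨h, hx.2⟩ h2⟩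

theorem src_ne_tgt_of_heavy {x : E × Bool} (hx : x.1 ∈ S) (h2 : g x.1 = 2) :
    G.src x ≠ G.tgt x := by
  intro h
  obtain ⟨A, B, hsep, -, -, hst⟩ := K.sep_of_heavy (x := x) ⟨hx, rfl⟩ h2
  have hxA : x ∈ G.star A (G.src x) := by simp [hst]
  have : flip x ∈ G.star A (G.src x) := ⟨hxA.1, h.symm⟩
  rw [hst] at this
  exact flip_ne x this

end Orientation.IsCactus

variable (G S g) in
/-- A maximal simple path that consists of edges of weight two. -/
structure IsMaxHeavy (P : G.SimplePath) : Prop where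
  subset : P.edges ⊆ S
  heavy : ∀ e ∈ P.edges, g e = 2
  init : ∀ x ∈ G.star S P.init, g x.1 = 2 → x.1 ∈ P.edges
  term : ∀ x ∈ G.star S P.term, g x.1 = 2 → x.1 ∈ P.edges

namespace Orientation.IsCactus

variable (K : ε.IsCactus S g)
include K

/-- Take a longest simple path of edges of weight two through `e`. A further edge of weight two at
one of its ends would prolong it or close a cycle, and cycle edges have weight one. -/
theorem exists_maxHeavy [Fintype E] {e : E} (he : e ∈ S) (h2 : g e = 2) :
    ∃ P : G.SimplePath, IsMaxHeavy G S g P ∧ e ∈ P.edges := by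
  classical
  have hlen : ∀ l : List (E × Bool), (∃ u v, Wk G.src G.tgt u l v ∧ (u :: l.map G.tgt).Nodup ∧
      supp l ⊆ {e | e ∈ S ∧ g e = 2} ∧ e ∈ supp l) → l.length ≤ Fintype.card E := by
    rintro l ⟨u, v, h1, hn, -⟩
    rw [← List.length_map (f := Prod.fst), ← List.toFinset_card_of_nodup (h1.nodup_fst hn)]
    exact Finset.card_le_univ _
  obtain ⟨l, ⟨u, v, h1, hn, h3, h4⟩, hmax⟩ := exists_longest ⟨[(e, false)], _, _, ⟨rfl, rfl⟩,
    by simpa using K.src_ne_tgt_of_heavy (x := (e, false)) he h2,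
    by rw [supp_cons]; simp [he, h2], fst_mem_supp (d := (e, false)) (by simp)⟩ hlen
  have hpos : l ≠ [] := by
    rintro rfl
    simp at h4
  -- a step of weight two that leaves the path at one of its ends does not return to it
  have back : ∀ (a b : V) (m : List (E × Bool)) (d : E × Bool), m ⊆ l → d.1 ∈ S → g d.1 = 2 →
      d.1 ∉ supp l → Wk G.src G.tgt (G.tgt d) m (G.src d) → False := by
    intro a b m d hm hd hd2 hdl hw
    obtain ⟨C, hC, hdC, hCs⟩ := exists_cycle_through hw fun h => hdl (supp_mono hm h)
    have := K.eq_one_of_cycle hC (fun x hx => ?_) hdC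
    · omega
    · rcases hCs hx with rfl | hx
      · exact hd
      · exact (h3 (supp_mono hm hx)).1
  have hv_split : ∀ w, w ∈ u :: l.map G.tgt → ∃ l1 l2, l = l1 ++ l2 ∧ Wk G.src G.tgt u l1 w ∧
      Wk G.src G.tgt w l2 v := by
    intro w hw
    refine h1.split_at ?_
    exact (⟨u, v, l, isWalk_iff.2 h1, hn, hpos⟩ : G.SimplePath).mem_verts_iff.2 hw
  refine ⟨⟨u, v, l, isWalk_iff.2 h1, hn, hpos⟩, ⟨fun x hx => (h3 hx).1, fun x hx => (h3 hx).2,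
    ?_, ?_⟩, h4⟩
  · rintro x ⟨hx, hxu⟩ hx2
    by_contra hxl
    have hnew : G.tgt x ∉ u :: l.map G.tgt := by
      intro hmem
      obtain ⟨l1, l2, rfl, w1, w2⟩ := hv_split _ hmem
      refine back u v l1 (flip x) (by intro; simp; tauto) hx hx2 hxl ?_
      rw [tgt_flip, src_flip, hxu]
      exact w1
    have := hmax (flip x :: l) ⟨G.tgt x, v, ⟨rfl, by rw [tgt_flip, hxu]; exact h1⟩, ?_, ?_, ?_⟩
    · simp at this
    · rw [List.map_cons, tgt_flip, hxu]
      exact List.nodup_cons.2 ⟨hnew, hn⟩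
    · rw [supp_cons]
      exact Set.union_subset (by simpa using ⟨hx, hx2⟩) h3
    · rw [supp_cons]
      exact Or.inr h4
  · rintro x ⟨hx, hxv⟩ hx2
    by_contra hxl
    have hnew : G.tgt x ∉ u :: l.map G.tgt := by
      intro hmem
      obtain ⟨l1, l2, rfl, w1, w2⟩ := hv_split _ hmem
      refine back u v l2 x (by intro; simp; tauto) hx hx2 hxl ?_
      rw [hxv]
      exact w2
    have := hmax (l ++ [x]) ⟨u, G.tgt x, h1.append ⟨hxv, rfl⟩, ?_, ?_, ?_⟩
    · simp at this
    · rw [List.map_append, ← List.cons_append, List.nodup_append]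
      refine ⟨hn, by simp, ?_⟩
      rintro a ha b hb rfl
      obtain rfl : a = G.tgt x := by simpa using hb
      exact hnew ha
    · rw [supp_append, supp_cons]
      exact Set.union_subset h3 (by simpa using ⟨hx, hx2⟩)
    · rw [supp_append]
      exact Or.inl h4

/-- The structure at an interior vertex of a path of weight two. -/
theorem star_interior {P : G.SimplePath} (hP : IsMaxHeavy G S g P) {v : V} (hv : v ∈ P.verts)
    (h1 : v ≠ P.init) (h2 : v ≠ P.term) : G.star S v = G.star P.edges v := by
  obtain ⟨d, hd, d', hd', rfl, h3, h4⟩ := P.exists_interior hv h1 h2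
  have e1 : d.1 ∈ P.edges := fst_mem_supp hd
  have e2 : d'.1 ∈ P.edges := fst_mem_supp hd'
  obtain ⟨A, B, hsep, hA, hB, hst⟩ := K.sep_of_heavy (v := G.tgt d) (x := flip d) ⟨hP.subset e1, rfl⟩
    (hP.heavy _ e1)
  have hd'S : d' ∈ G.star S (G.tgt d) := ⟨hP.subset e2, h3⟩
  have hd'B : d' ∈ G.star B (G.tgt d) := by
    rw [star_union hsep, hst] at hd'S
    exact hd'S.resolve_left fun h => h4 (Set.mem_singleton_iff.1 h).symm
  rw [star_union hsep, hst, side_heavy hB hd'B (hP.heavy _ e2), P.star_interior hd hd' h3.symm]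
  rfl

/-- By maximality the side opposite to the path has no edge of weight two, so it consists of two
half-edges of weight one, and the cycle through one of them fills this side. -/
theorem star_end {P : G.SimplePath} (hP : IsMaxHeavy G S g P) {v : V} {x : E × Bool}
    (hst : G.star P.edges v = {x}) (hmax : ∀ x ∈ G.star S v, g x.1 = 2 → x.1 ∈ P.edges) :
    ∃ A B, Sep G S A B v ∧ ε.IsSide g A v ∧ ε.IsSide g B v ∧ x ∈ G.star A v ∧ P.edges ⊆ A ∧
      ∃ C, G.IsCycle C ∧ C ⊆ B ∧ v ∈ G.verts C ∧ G.star C v = G.star B v := by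
  have hx : x ∈ G.star P.edges v := by simp [hst]
  have hx2 := hP.heavy _ hx.1
  obtain ⟨A, B, hsep, hA, hB, hstA⟩ := K.sep_of_heavy (star_mono hP.subset v hx) hx2
  obtain ⟨h, k, hstB, -, h2, h1⟩ := id hB
  have hhB : h ∈ G.star B v := by simp [hstB]
  have hxA : x ∈ G.star A v := by simp [hstA]
  have hhS : h ∈ G.star S v := by rw [star_union hsep]; exact Or.inr hhB
  have hnA : ∀ y ∈ G.star B v, y.1 ∉ A := fun y hy => Set.disjoint_right.1 hsep.disjoint hy.1
  have hne : h ≠ k := by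
    intro hk
    have : h ∈ G.star P.edges v := ⟨hmax h hhS (h2 hk), hhS.2⟩
    rw [hst] at this
    obtain rfl : h = x := this
    exact hnA h hhB hxA.1
  have hg1 := (h1 hne).1
  obtain ⟨C, hC, hCS, hhC⟩ := K.cyc _ hg1
  have hvC : v ∈ G.verts C := mem_verts.2 ⟨h, hhC, hhB.2⟩
  have hCB : C ⊆ B := (hsep.cycle hC hCS).resolve_left fun hc => hnA h hhB (hc hhC)
  refine ⟨A, B, hsep, hA, hB, hxA, ?_, C, hC, hCB, hvC, (side_of_cycle hB hC hCB hvC).1⟩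
  -- the path does not return to `v`
  intro e he
  have hPA : ∀ e ∈ P.edges, G.SameComponent P.edges {v} x.1 e := by
    have hX : ∀ e ∈ P.edges, G.SameComponent P.edges ∅ x.1 e := fun e he =>
      P.wk.sameComponent_of_mem subset_rfl hx.1 he
    intro e he
    refine (hX e he).mem_of_closed (A := {y | G.SameComponent P.edges {v} x.1 y}) (.refl _) ?_
    intro w _ y hy z hz hyw
    by_cases hwv : w = v
    · subst hwv
      rw [hst] at hy hz
      rwa [hz.trans hy.symm]
    · exact SameComponent.trans hyw (.of_star hy hz hwv)
  exact hsep.mem_of_sameComponent ((hPA e he).mono hP.subset subset_rfl) hxA.1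

theorem mem_of_heavy {P : G.SimplePath} (hP : IsMaxHeavy G S g P) {v : V} (hv : v ∈ P.verts)
    {x : E × Bool} (hx : x ∈ G.star S v) (h2 : g x.1 = 2) : x.1 ∈ P.edges := by
  by_cases h3 : v = P.init
  · subst h3; exact hP.init x hx h2
  by_cases h4 : v = P.term
  · subst h4; exact hP.term x hx h2
  rw [K.star_interior hP hv h3 h4] at hx
  exact hx.1

/-- At each of its vertices a maximal path contains all edges of weight two, so it absorbs every
such path that it meets. Maximal paths with different edge sets are therefore vertex-disjoint. -/
theorem maxHeavy_subset {P Q : G.SimplePath} (hP : IsMaxHeavy G S g P) (hQ : IsMaxHeavy G S g Q)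
    {v : V} (hv : v ∈ P.verts) (hv' : v ∈ Q.verts) : Q.edges ⊆ P.edges := by
  obtain ⟨x, hx⟩ := mem_verts.1 hv'
  have hxP := K.mem_of_heavy hP hv (star_mono hQ.subset v hx) (hQ.heavy _ hx.1)
  intro e he
  refine (Q.wk.sameComponent_of_mem subset_rfl hx.1 he).mem_of_closed hxP ?_
  intro w _ y hy z hz hyP
  exact K.mem_of_heavy hP (mem_verts.2 ⟨y, hyP, hy.2⟩) (star_mono hQ.subset w hz)
    (hQ.heavy _ hz.1)

/-- A path of weight two meets a cycle only in its ends. -/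
theorem end_of_cycle {P : G.SimplePath} (hP : IsMaxHeavy G S g P) {C : Set E}
    (hC : C ∈ G.cyclesIn S) {v : V} (hv : v ∈ P.verts) (hvC : v ∈ G.verts C) :
    v = P.init ∨ v = P.term := by
  by_contra! h
  obtain ⟨x, hx⟩ := mem_verts.1 hvC
  have hxP := star_mono hC.2 v hx
  rw [K.star_interior hP hv h.1 h.2] at hxP
  have h1 := hP.heavy _ hxP.1
  have h2 := K.eq_one_of_cycle hC.1 hC.2 hx.1
  omega

theorem star_init {P : G.SimplePath} (hP : IsMaxHeavy G S g P) :
    ∃ A B, Sep G S A B P.init ∧ ε.IsSide g A P.init ∧ ε.IsSide g B P.init ∧ A.Nonempty ∧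
      P.edges ⊆ A ∧
      ∃ C, G.IsCycle C ∧ C ⊆ B ∧ P.init ∈ G.verts C ∧ G.star C P.init = G.star B P.init := by
  obtain ⟨d, l, h, hd⟩ := P.exists_cons
  obtain ⟨A, B, h1, h2, h3, h4, h5⟩ := K.star_end hP (P.star_init (d := d) (by simp [h]) hd) hP.init
  exact ⟨A, B, h1, h2, h3, ⟨_, h4.1⟩, h5⟩

theorem star_term {P : G.SimplePath} (hP : IsMaxHeavy G S g P) :
    ∃ A B, Sep G S A B P.term ∧ ε.IsSide g A P.term ∧ ε.IsSide g B P.term ∧ A.Nonempty ∧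
      P.edges ⊆ A ∧
      ∃ C, G.IsCycle C ∧ C ⊆ B ∧ P.term ∈ G.verts C ∧ G.star C P.term = G.star B P.term := by
  obtain ⟨l, d, h, hd⟩ := P.exists_snoc
  obtain ⟨A, B, h1, h2, h3, h4, h5⟩ := K.star_end hP (P.star_term (d := d) (by simp [h]) hd) hP.term
  exact ⟨A, B, h1, h2, h3, ⟨_, h4.1⟩, h5⟩

/-- The only cycle at the end of a path of weight two. -/
theorem cycle_eq_of_end {P : G.SimplePath} (hP : IsMaxHeavy G S g P) {v : V} {A B C D : Set E}
    (hsep : Sep G S A B v) (hPA : P.edges ⊆ A) (hv : v ∈ P.verts) (hA : ε.IsSide g A v)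
    (hC : G.IsCycle C) (hCB : C ⊆ B) (hst : G.star C v = G.star B v)
    (hD : D ∈ G.cyclesIn S) (hvD : v ∈ G.verts D) : D = C := by
  obtain ⟨x, hx⟩ := mem_verts.1 hvD
  obtain ⟨y, hy⟩ := mem_verts.1 hv
  rcases hsep.cycle hD.1 hD.2 with h | h
  · have h1 := (side_of_cycle hA hD.1 h hvD).2.2 y (star_mono hPA v hy)
    have h2 := hP.heavy _ hy.1
    omega
  · have h1 := star_mono (G := G) h v hx
    rw [← hst] at h1
    exact K.cycle_eq hD ⟨hC, hCB.trans hsep.symm.left⟩ hx.1 h1.1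

theorem paths_inter {P : G.SimplePath} (hP : IsMaxHeavy G S g P) :
    ∃ C ∈ G.cyclesIn S, ∃ C' ∈ G.cyclesIn S, C ≠ C' ∧
    P.verts ∩ G.verts C = {P.init} ∧ P.verts ∩ G.verts C' = {P.term} ∧
    ∀ D ∈ G.cyclesIn S, D ≠ C → D ≠ C' → Disjoint P.verts (G.verts D) := by
  obtain ⟨A, B, hsep, hA, hB, -, hPA, C, hC, hCB, hv, hst⟩ := K.star_init hP
  obtain ⟨A', B', hsep', hA', hB', -, hPA', C', hC', hCB', hv', hst'⟩ := K.star_term hP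
  have hCS : C ∈ G.cyclesIn S := ⟨hC, fun x hx => hsep.symm.left (hCB hx)⟩
  have hCS' : C' ∈ G.cyclesIn S := ⟨hC', fun x hx => hsep'.symm.left (hCB' hx)⟩
  have h1 : P.verts ∩ G.verts C = {P.init} := by
    ext w
    constructor
    · rintro ⟨hw, hwC⟩
      exact hsep.verts_inter w (verts_mono hPA hw) (verts_mono hCB hwC)
    · rintro rfl
      exact ⟨P.init_mem, hv⟩
  have h2 : P.verts ∩ G.verts C' = {P.term} := by
    ext w
    constructor
    · rintro ⟨hw, hwC⟩
      exact hsep'.verts_inter w (verts_mono hPA' hw) (verts_mono hCB' hwC)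
    · rintro rfl
      exact ⟨P.term_mem, hv'⟩
  refine ⟨C, hCS, C', hCS', ?_, h1, h2, ?_⟩
  · rintro rfl
    rw [h1, Set.singleton_eq_singleton_iff] at h2
    exact P.init_ne_term h2
  · intro D hD hDC hDC'
    rw [Set.disjoint_left]
    intro w hw hwD
    rcases K.end_of_cycle hP hD hw hwD with rfl | rfl
    · exact hDC (K.cycle_eq_of_end hP hsep hPA hw hA hC hCB hst hD hwD)
    · exact hDC' (K.cycle_eq_of_end hP hsep' hPA' hw hA' hC' hCB' hst' hD hwD)

/-- The support of an indecomposable flow is an Eulerian cycle-tree, of which the absolute value of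
the flow is the indicator. -/
theorem exists_cycleTree [Fintype E] : ∃ T : G.CycleTree, T.IsEulerian ∧ T.indicator = g := by
  -- One path is chosen for each edge set, because the reverse of a maximal path is maximal too and
  -- would violate vertex-disjointness.
  obtain ⟨Ps, hsub, hbij⟩ := Set.exists_subset_bijOn {P | IsMaxHeavy G S g P}
    (SimplePath.edges (G := G))
  have hmax : ∀ P ∈ Ps, IsMaxHeavy G S g P := fun P hP => hsub hP
  have hpath : ∀ e ∈ S, g e = 2 → ∃ P ∈ Ps, e ∈ P.edges := by
    intro e he h2
    obtain ⟨Q, hQ, heQ⟩ := K.exists_maxHeavy he h2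
    obtain ⟨P, hP, hPQ⟩ := hbij.surjOn ⟨Q, hQ, rfl⟩
    exact ⟨P, hP, by rw [hPQ]; exact heQ⟩
  let T : G.CycleTree :=
    { edges := S
      paths := Ps
      connected := K.connected
      cover := by
        ext e
        simp only [Set.mem_union, Set.mem_iUnion]
        constructor
        · intro he
          rcases K.eq_one_or_two he with h | h
          · obtain ⟨C, hC, hCS, heC⟩ := K.cyc e h
            exact Or.inl ⟨C, ⟨hC, hCS⟩, heC⟩
          · obtain ⟨P, hP, heP⟩ := hpath e he h
            exact Or.inr ⟨P, hP, heP⟩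
        · rintro (⟨C, hC, he⟩ | ⟨P, hP, he⟩)
          exacts [hC.2 he, (hmax P hP).subset he]
      cycles_inter := by
        intro C hC C' hC' hne
        refine ⟨Set.disjoint_left.2 fun e he he' => hne (K.cycle_eq hC hC' he he'), ?_⟩
        rintro v ⟨hv, hv'⟩ w ⟨hw, hw'⟩
        obtain ⟨A, B, hsep, -, -, hA, hB⟩ := K.sep_of_cycles hC hC' hne hv hv'
        exact (hsep.verts_inter w (verts_mono hA hw) (verts_mono hB hw')).symm
      cycles_le_two := K.cycles_le_two
      paths_disjoint := by
        intro P hP Q hQ hne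
        refine Set.disjoint_left.2 fun v hv hv' => hne (hbij.injOn hP hQ ?_)
        exact (K.maxHeavy_subset (hmax Q hQ) (hmax P hP) hv' hv).antisymm
          (K.maxHeavy_subset (hmax P hP) (hmax Q hQ) hv hv')
      paths_inter := fun P hP => K.paths_inter (hmax P hP)
      cut_cycles := by
        rintro C hC C' hC' hne v ⟨hv, hv'⟩
        obtain ⟨A, B, hsep, -, -, hA, hB⟩ := K.sep_of_cycles hC hC' hne hv hv'
        exact hsep.isCutPoint K.connected (hC.1.nonempty.mono hA) (hC'.1.nonempty.mono hB)
      cut_paths := by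
        intro P hP
        constructor
        · obtain ⟨A, B, hsep, hA, hB, hAn, -, C, hC, hCB, -⟩ := K.star_init (hmax P hP)
          exact hsep.isCutPoint K.connected hAn (hC.nonempty.mono hCB)
        · obtain ⟨A, B, hsep, hA, hB, hAn, -, C, hC, hCB, -⟩ := K.star_term (hmax P hP)
          exact hsep.isCutPoint K.connected hAn (hC.nonempty.mono hCB) }
  have hcyc : ∀ {C}, C ∈ T.cycles ↔ C ∈ G.cyclesIn S := Iff.rfl
  refine ⟨T, ?_, ?_⟩
  · intro C hC
    -- The intersection vertices on a cycle are exactly its sinks and sources, so the Parity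
    -- Condition becomes the sign formula.
    have heq : G.verts C ∩ T.interVerts = {v ∈ G.verts C | ε.IsConst C v} := by
      ext v
      refine and_congr_right fun hv => ⟨?_, fun hc => ?_⟩
      · rintro (⟨C₁, hC₁, C₂, hC₂, hne, h1, h2⟩ | ⟨P, hP, hend⟩)
        · obtain ⟨C', hC', hne', hv'⟩ : ∃ C' ∈ G.cyclesIn S, C ≠ C' ∧ v ∈ G.verts C' := by
            by_cases h : C = C₁
            · exact ⟨C₂, hC₂, h ▸ hne, h2⟩
            · exact ⟨C₁, hC₁, h, h1⟩
          obtain ⟨A, B, hsep, hA, hB, hCA, -⟩ := K.sep_of_cycles hC hC' hne' hv hv'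
          exact (side_of_cycle hA hC.1 hCA hv).2.1
        · have hvP : v ∈ P.verts := by
            rcases hend with rfl | rfl
            exacts [P.init_mem, P.term_mem]
          obtain ⟨x, hx⟩ := mem_verts.1 hvP
          obtain ⟨A, B, hsep, hA, hB, hst⟩ := K.sep_of_heavy (star_mono (hmax P hP).subset v hx)
            ((hmax P hP).heavy _ hx.1)
          rcases hsep.cycle hC.1 hC.2 with h | h
          · exact (side_of_cycle hA hC.1 h hv).2.1
          · exact (side_of_cycle hB hC.1 h hv).2.1
      · rcases K.loc_cycle hC.1 hC.2 hv with ⟨-, h, -⟩ | ⟨A, B, hsep, hA, hB, hCA⟩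
        · exact absurd hc h
        -- The side opposite to the cycle is an edge of weight two, so `v` is an end of a block
        -- path, or it has weight one and belongs to another cycle.
        · obtain ⟨h, k, hst, -, h2, h1⟩ := id hB
          have hh : h ∈ G.star B v := by simp [hst]
          have hhS : h.1 ∈ S := hsep.symm.left hh.1
          by_cases hk : h = k
          · obtain ⟨P, hP, hhP⟩ := hpath _ hhS (h2 hk)
            exact Or.inr ⟨P, hP, K.end_of_cycle (hmax P hP) hC (mem_verts.2 ⟨h, hhP, hh.2⟩) hv⟩
          · obtain ⟨C', hC', hCS', hhC'⟩ := K.cyc _ (h1 hk).1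
            refine Or.inl ⟨C, hC, C', ⟨hC', hCS'⟩, ?_, hv, mem_verts.2 ⟨h, hhC', hh.2⟩⟩
            rintro rfl
            exact Set.disjoint_right.1 hsep.disjoint hh.1 (hCA hhC')
    rw [heq, hC.1.sign_eq ε]
    constructor
    · intro h
      by_contra hodd
      rw [Nat.not_even_iff_odd] at hodd
      rw [hodd.neg_one_pow] at h
      exact absurd h (by decide)
    · intro h
      by_contra heven
      rw [Nat.not_odd_iff_even] at heven
      rw [heven.neg_one_pow] at h
      exact absurd h (by decide)
  · funext e
    by_cases he : e ∈ S
    · rcases K.eq_one_or_two he with h | h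
      · obtain ⟨C, hC, hCS, heC⟩ := K.cyc e h
        rw [h, T.indicator_cycle (hcyc.2 ⟨hC, hCS⟩) heC]
      · obtain ⟨P, hP, heP⟩ := hpath e he h
        rw [h, T.indicator_path (P := P) hP heP]
    · rw [T.indicator_of_notMem he]
      have h1 := K.nonneg e
      have h2 : ¬ 0 < g e := fun h => he ((K.pos e).1 h)
      omega

end Orientation.IsCactus

/-- Classification of indecomposable integral flows. -/
theorem Orientation.isIndecomposable_iff [Finite V] [Fintype E] {f : E → ℤ} (hf : ε.IsFlow f) :
    ε.IsIndecomposable f ↔ ∃ T : G.CycleTree, T.IsEulerian ∧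
      ∀ e, f e = ε.coupling (ε.ofFun f) e * T.indicator e := by
  constructor
  · intro h
    obtain ⟨T, hT, hI⟩ := h.isCactus.exists_cycleTree
    exact ⟨T, hT, fun e => by rw [hI]; exact Orientation.eq_coupling f e⟩
  · rintro ⟨T, hT, h⟩
    exact Orientation.isIndecomposable_of_indicator hf T hT h

end SignedGraph

/-! ### Minimum covering walks as Eulerian tours -/

namespace SignedGraph

variable {V E : Type*} {G : SignedGraph V E}

/-- A closed walk without repeated vertices does not repeat edges, unless it goes back and forth
along a single edge. -/
theorem Wk.nodup_fst_of_closed {v : V} {l : List (E × Bool)} (h : Wk G.src G.tgt v l v)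
    (hn : (l.map G.tgt).Nodup) (hb : ∀ d, l ≠ [d, flip d]) : (l.map Prod.fst).Nodup := by
  cases l with
  | nil => simp
  | cons d l =>
    obtain ⟨rfl, h⟩ := h
    rw [List.map_cons] at hn
    refine List.nodup_cons.2 ⟨fun hm => ?_, h.nodup_fst hn⟩
    obtain ⟨x, hx, hxd⟩ := List.mem_map.1 hm
    rcases eq_or_eq_flip hxd with rfl | rfl
    · exact (List.nodup_cons.1 hn).1 (List.mem_map.2 ⟨x, hx, rfl⟩)
    · obtain ⟨l1, l2, rfl⟩ := List.append_of_mem hx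
      obtain ⟨w, h1, h2⟩ := wk_append.1 h
      rw [wk_cons, src_flip, tgt_flip] at h2
      obtain ⟨rfl, h3⟩ := h2
      have hl1 : l1 = [] := by
        rcases List.eq_nil_or_concat' l1 with rfl | ⟨m, y, rfl⟩
        · rfl
        · have := h1.last
          exact absurd (List.mem_map.2 ⟨y, by simp, this⟩) (List.nodup_cons.1 hn).1
      have hl2 : l2 = [] := by
        rcases List.eq_nil_or_concat' l2 with rfl | ⟨m, y, rfl⟩
        · rfl
        · have h4 := h3.last
          have h5 := (List.nodup_cons.1 hn).2
          rw [List.map_append, List.nodup_append] at h5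
          have h6 := (List.nodup_cons.1 h5.2.1).1
          exact absurd (List.mem_map.2 ⟨y, by simp, by rw [h4, tgt_flip]⟩) h6
      subst hl1 hl2
      exact hb d rfl

theorem SimplePath.src_ne_tgt (P : G.SimplePath) {d : E × Bool} (hd : d ∈ P.steps) :
    G.src d ≠ G.tgt d := by
  intro heq
  obtain ⟨l1, l2, hl⟩ := List.append_of_mem hd
  have hn := P.nodup
  have hw := P.wk
  rw [hl] at hw
  obtain ⟨w, h1, h2⟩ := wk_append.1 hw
  rw [← P.wk.map_append, hl, List.map_append, List.map_cons, List.append_assoc, List.cons_append,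
    h2.2.map_append] at hn
  exact (List.nodup_cons.1 (List.nodup_append.1 hn).2.1).1 (by simp [heq])

section Usage

variable [Fintype E]

open Classical in
-- Each step uses one half-edge at its start and one at its end, so the degree counts departures and
-- arrivals.
theorem bd_indicator_cnt (A : Set E) (l : List (E × Bool)) (v : V) :
    G.bd 1 (A.indicator fun e => cnt l e) v =
      l.countP (fun h => h.1 ∈ A ∧ G.src h = v) + l.countP (fun h => h.1 ∈ A ∧ G.tgt h = v) := by
  induction l with
  | nil => simp [bd]
  | cons d l ih =>
    have h1 : (A.indicator fun e => (cnt (d :: l) e : ℤ)) = fun e =>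
        (A.indicator (fun e => (cnt l e : ℤ)) e) +
          A.indicator (fun e => if d.1 = e then (1 : ℤ) else 0) e := by
      ext e
      by_cases he : e ∈ A <;> simp [he, cnt_cons]
    rw [h1, bd_add, ih, List.countP_cons, List.countP_cons]
    by_cases hd : d.1 ∈ A
    · have h2 : A.indicator (fun e => if d.1 = e then (1 : ℤ) else 0) =
          fun e => if d.1 = e then (1 : ℤ) else 0 := by
        refine Set.indicator_eq_self.2 fun e he => ?_
        obtain rfl : d.1 = e := by
          by_contra h
          simp [h] at he
        exact hd
      rw [h2, bd_single]
      simp only [hd, true_and, Pi.one_apply, decide_eq_true_eq]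
      push_cast
      ring
    · have h2 : A.indicator (fun e => if d.1 = e then (1 : ℤ) else 0) = fun _ => 0 := by
        ext e
        rw [Set.indicator_apply]
        split_ifs with h1 h2
        · exact absurd (h2 ▸ h1) hd
        · rfl
        · rfl
      rw [h2]
      simp [hd, bd]

/-- A closed walk that uses the half-edges of `A` at the separating vertex `v` only twice has to
change sides whenever it visits `v`. -/
theorem Sep.crossing {S A B : Set E} {v : V} (h : Sep G S A B v) {u : V} {d d' : E × Bool}
    {l : List (E × Bool)} (hw : Wk G.src G.tgt u (d :: d' :: l) u) (hS : supp (d :: d' :: l) = S)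
    (hB : B.Nonempty) (hA : G.bd 1 (A.indicator fun e => cnt (d :: d' :: l) e) v ≤ 2)
    (hv : G.tgt d = v) (hdA : d.1 ∈ A) : d'.1 ∉ A := by
  classical
  intro hd'A
  obtain ⟨e, he⟩ := hB
  have heS := h.symm.left he
  rw [← hS] at heS
  have heA : e ∉ A := Set.disjoint_right.1 h.disjoint he
  obtain ⟨b, hb⟩ := heS
  have hbl : (e, b) ∈ l := by
    simp only [List.mem_cons] at hb
    rcases hb with rfl | rfl | hb
    exacts [absurd hdA heA, absurd hd'A heA, hb]
  -- the first step outside `A`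
  obtain ⟨p, x, q, hpq, hp, hx⟩ : ∃ p x q, d' :: l = p ++ x :: q ∧ (∀ y ∈ p, y.1 ∈ A) ∧
      x.1 ∉ A := by
    have key : ∀ m : List (E × Bool), (∃ y ∈ m, y.1 ∉ A) → ∃ p x q, m = p ++ x :: q ∧
        (∀ y ∈ p, y.1 ∈ A) ∧ x.1 ∉ A := by
      intro m
      induction m with
      | nil => simp
      | cons z m ih =>
        rintro ⟨y, hy, hyA⟩
        by_cases hz : z.1 ∈ A
        · obtain ⟨p, x, q, rfl, hp, hx⟩ := ih ⟨y, by
            rcases List.mem_cons.1 hy with rfl | hy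
            · exact absurd hz hyA
            · exact hy, hyA⟩
          exact ⟨z :: p, x, q, rfl, by
            intro y hy
            rcases List.mem_cons.1 hy with rfl | hy
            exacts [hz, hp y hy], hx⟩
        · exact ⟨[], z, m, rfl, by simp, hz⟩
    exact key _ ⟨(e, b), by simp [hbl], heA⟩
  rcases List.eq_nil_or_concat' p with rfl | ⟨p, z, rfl⟩
  · rw [List.nil_append, List.cons_eq_cons] at hpq
    exact hx (hpq.1 ▸ hd'A)
  have hzA : z.1 ∈ A := hp z (by simp)
  have hxB : x.1 ∈ B := by
    have : x.1 ∈ S := by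
      rw [← hS, hpq]
      exact fst_mem_supp (by simp)
    rw [h.union] at this
    exact this.resolve_left hx
  have hzx : G.tgt z = G.src x := by
    have h1 := hw.2
    rw [hpq] at h1
    obtain ⟨w, h2, h3⟩ := wk_append.1 h1
    exact h2.last.trans h3.1.symm
  have hzv : G.tgt z = v := h.verts_inter _ (tgt_mem_verts hzA) (hzx ▸ src_mem_verts hxB)
  have hd'v : G.src d' = v := hw.2.1.trans hv
  -- Within `A` the walk arrives at `v` by `d`, departs by `d'` and arrives again by `z`: three
  -- uses, one too many.
  rw [bd_indicator_cnt] at hA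
  have h1 : 1 ≤ (d :: d' :: l).countP (fun h => h.1 ∈ A ∧ G.src h = v) :=
    List.one_le_countP_iff.2 ⟨d', by simp, by simp [hd'A, hd'v]⟩
  have h2 : 1 ≤ (d' :: l).countP (fun h => h.1 ∈ A ∧ G.tgt h = v) :=
    List.one_le_countP_iff.2 ⟨z, by simp [hpq], by simp [hzA, hzv]⟩
  have h3 : (d :: d' :: l).countP (fun h => h.1 ∈ A ∧ G.tgt h = v) =
      (d' :: l).countP (fun h => h.1 ∈ A ∧ G.tgt h = v) + 1 :=
    List.countP_cons_of_pos (by simp [hdA, hv])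
  omega

end Usage

namespace CycleTree

variable (T : G.CycleTree)

theorem not_inter_of_interior {P : G.SimplePath} (hP : P ∈ T.paths) {v : V} (hv : v ∈ P.verts)
    (h1 : v ≠ P.init) (h2 : v ≠ P.term) : v ∉ T.interVerts := by
  intro hi
  obtain ⟨C, hC, hvC⟩ := T.exists_cycle_of_inter hi
  rcases eq_init_or_eq_term hP hC hv hvC with ⟨h, -⟩ | ⟨h, -⟩
  exacts [h1 h, h2 h]

/-- `W` is a closed walk that uses each edge as often as the indicator says. -/
def IsEulerTour (W : List (E × Bool)) : Prop :=
  (∃ u, Wk G.src G.tgt u W u) ∧ ∀ e, (cnt W e : ℤ) = T.indicator e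

variable {T} in
theorem IsEulerTour.of_isRotated {W W' : List (E × Bool)} (h : T.IsEulerTour W)
    (hr : W.IsRotated W') : T.IsEulerTour W' := by
  obtain ⟨⟨u, hu⟩, hc⟩ := h
  exact ⟨hu.of_isRotated hr, by rwa [← cnt_perm hr.perm]⟩

variable {T} in
theorem IsEulerTour.supp {W : List (E × Bool)} (h : T.IsEulerTour W) : supp W = T.edges := by
  ext e
  rw [← cnt_pos, ← T.indicator_pos, ← h.2]
  exact_mod_cast Iff.rfl

section

variable [Fintype E]

/-- A side consists of two half-edges of weight one or of a single one of weight two. -/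
theorem bd_sides {C A B : Set E} {v : V} (hC : C ∈ T.cycles) (hv : v ∈ G.verts C)
    (hA : G.star A v = G.star C v)
    (hB : (∃ C' ∈ T.cycles, C' ⊆ B ∧ v ∈ G.verts C' ∧ G.star B v = G.star C' v) ∨
        ∃ P ∈ T.paths, ∃ k, (v = P.init ∨ v = P.term) ∧ G.star P.edges v = {k} ∧
          G.star B v = {k}) :
    G.bd 1 (A.indicator T.indicator) v = 2 ∧ G.bd 1 (B.indicator T.indicator) v = 2 := by
  have key : ∀ D ∈ T.cycles, v ∈ G.verts D → ∀ X, G.star X v = G.star D v →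
      G.bd 1 (X.indicator T.indicator) v = 2 := by
    intro D hD hvD X hX
    obtain ⟨a, b, hab, hst⟩ := hD.1.star hvD
    have ha : a ∈ G.star D v := by simp [hst]
    have hb : b ∈ G.star D v := by simp [hst]
    rw [bd_indicator_pair (hX.trans hst) hab, T.indicator_cycle hD ha.1,
      T.indicator_cycle hD hb.1]
    norm_num
  refine ⟨key C hC hv A hA, ?_⟩
  rcases hB with ⟨C', hC', -, hv', hB⟩ | ⟨P, hP, k, -, hk, hB⟩
  · exact key C' hC' hv' B hB
  · have : k ∈ G.star P.edges v := by simp [hk]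
    rw [bd_indicator_single hB, T.indicator_path hP this.1]
    norm_num

theorem even_bd_indicator (v : V) : Even (G.bd 1 T.indicator v) := by
  have hIS : ∀ e, e ∉ T.edges → T.indicator e = 0 := fun e he => T.indicator_of_notMem he
  by_cases hi : v ∈ T.interVerts
  · obtain ⟨C, hC, hv⟩ := T.exists_cycle_of_inter hi
    obtain ⟨A, B, hsep, hCA, hA, hB⟩ := T.exists_sep hC hv hi
    obtain ⟨h1, h2⟩ := T.bd_sides hC hv hA hB
    rw [hsep.bd_eq _ hIS, h1, h2]
    decide
  · by_cases hv : v ∈ G.verts T.edges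
    · obtain ⟨h, k, hne, hst, hI⟩ := T.exists_star_of_not_inter hv hi
      rw [bd_pair hst hne _ hIS, hI]
      simp
    · rw [bd_eq_sum ∅ (by simp)]
      · simp
      · intro h hh _
        exact hIS _ fun hc => hv (mem_verts.2 ⟨h, hc, hh⟩)

theorem exists_eulerTour : ∃ W, T.IsEulerTour W := by
  obtain ⟨u, W, hW, hc⟩ := exists_euler_tour T.connected (m := T.indicator)
    (fun e => T.indicator_pos) T.indicator_nonneg T.even_bd_indicator
  exact ⟨W, ⟨u, hW⟩, hc⟩

variable [Finite V]

/-- A closed walk uses the edges of a block path an even number of times. -/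
theorem even_cnt_path {u : V} {W : List (E × Bool)} (hW : Wk G.src G.tgt u W u)
    (hS : supp W = T.edges) {P : G.SimplePath} (hP : P ∈ T.paths) {e : E} (he : e ∈ P.edges) :
    Even (cnt W e : ℤ) := by
  have hIS : ∀ e, e ∉ T.edges → (cnt W e : ℤ) = 0 := by
    intro e he
    rw [← hS, ← cnt_pos] at he
    omega
  have heven := hW.even_bd_of_closed
  -- Induction along the path. The first edge is alone on its side of the initial vertex, where the
  -- degree is even; at an interior vertex the counts of two consecutive edges have an even sum.
  have key : ∀ l1 d l2, P.steps = l1 ++ d :: l2 → Even (cnt W d.1 : ℤ) := by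
    intro l1
    induction l1 using List.reverseRecOn with
    | nil =>
      intro d l2 hl
      have hd : G.src d = P.init := by
        have := P.wk
        rw [hl] at this
        exact this.1
      have hst := P.star_init (d := d) (by simp [hl]) hd
      have hi : P.init ∈ T.interVerts := Or.inr ⟨P, hP, Or.inl rfl⟩
      obtain ⟨C, hC, hv⟩ := T.exists_cycle_of_inter hi
      obtain ⟨A, B, hsep, hCA, hA, hB⟩ := T.exists_sep hC hv hi
      have hdP : d ∈ G.star P.edges P.init := by simp [hst]
      have hdB : d ∈ G.star B P.init := by
        have h1 := path_subset hP hdP.1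
        rw [hsep.union] at h1
        refine ⟨h1.resolve_left fun h => ?_, hd⟩
        have h2 : d ∈ G.star A P.init := ⟨h, hd⟩
        rw [hA] at h2
        exact T.path_not_mem_cycle hP hC hdP.1 h2.1
      have hB' : G.star B P.init = {d} := by
        rcases hB with ⟨C', hC', -, hv', hB⟩ | ⟨Q, hQ, k, -, hk, hB⟩
        · rw [hB] at hdB
          exact absurd hdB.1 (T.path_not_mem_cycle hP hC' hdP.1)
        · rw [hB] at hdB ⊢
          rw [Set.mem_singleton_iff.1 hdB]
      have h3 := hsep.symm.even_bd hIS heven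
      rw [bd_indicator_single hB'] at h3
      simpa using h3
    | append_singleton m c ih =>
      intro d l2 hl
      have h1 := ih c (d :: l2) (by simp [hl])
      have hc : c ∈ P.steps := by simp [hl]
      have hd : d ∈ P.steps := by simp [hl]
      have hcd : G.tgt c = G.src d := by
        have := P.wk
        rw [hl] at this
        obtain ⟨w, h2, h3⟩ := wk_append.1 this
        exact h2.last.trans h3.1.symm
      have hi : G.tgt c ∉ T.interVerts := by
        refine T.not_inter_of_interior hP (tgt_mem_verts (fst_mem_supp hc)) (P.tgt_ne_init hc) ?_
        rw [hcd]
        exact P.src_ne_term hd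
      have hst : G.star T.edges (G.tgt c) = {flip c, d} := by
        rw [T.star_eq_of_interior hP (tgt_mem_verts (fst_mem_supp hc)) hi,
          P.star_interior hc hd hcd]
      have h4 := heven (G.tgt c)
      rw [bd_pair hst ?_ _ hIS] at h4
      · simp only [Pi.one_apply, one_mul, flip_fst] at h4
        exact (Int.even_add.1 h4).1 h1
      · rintro rfl
        exact P.flip_not_mem hc hd
  obtain ⟨b, hb⟩ := he
  obtain ⟨l1, l2, hl⟩ := List.append_of_mem hb
  exact key l1 _ l2 hl

/-- A covering closed walk of minimum length uses each edge as often as the indicator says. -/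
theorem isEulerTour_of_min {W : List (E × Bool)} (h : G.IsMinCoveringClosedWalk T.edges W) :
    T.IsEulerTour W := by
  obtain ⟨⟨⟨u, hu⟩, hS⟩, hmin⟩ := h
  rw [isWalk_iff] at hu
  -- A cycle edge is used at least once and a path edge a positive even number of times. Some tour
  -- attains all these bounds, so minimality turns them into equalities.
  have hle : ∀ e, T.indicator e ≤ cnt W e := by
    intro e
    by_cases he : e ∈ T.edges
    · have hpos : 0 < cnt W e := cnt_pos.2 (hS ▸ he)
      rcases T.mem_edges.1 he with ⟨C, hC, heC⟩ | ⟨P, hP, heP⟩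
      · rw [T.indicator_cycle hC heC]
        omega
      · rw [T.indicator_path hP heP]
        obtain ⟨r, hr⟩ := T.even_cnt_path hu hS hP heP
        omega
    · rw [T.indicator_of_notMem he]
      positivity
  obtain ⟨W₀, ⟨u₀, h₀⟩, hc₀⟩ := T.exists_eulerTour
  have hlen := hmin W₀ ⟨⟨u₀, isWalk_iff.2 h₀⟩, IsEulerTour.supp ⟨⟨u₀, h₀⟩, hc₀⟩⟩
  refine ⟨⟨u, hu⟩, ?_⟩
  have hsum : ∑ e, T.indicator e = ∑ e, (cnt W e : ℤ) := by
    refine le_antisymm (Finset.sum_le_sum fun e _ => hle e) ?_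
    rw [← Finset.sum_congr rfl (fun e _ => hc₀ e)]
    rw [← sum_cnt W, ← sum_cnt W₀] at hlen
    exact_mod_cast hlen
  have := (Finset.sum_eq_sum_iff_of_le fun e _ => hle e).1 hsum
  exact fun e => (this e (Finset.mem_univ e)).symm

variable {T}

omit [Finite V] in
/-- At an intersection vertex on a block cycle, a tour enters or leaves the cycle. -/
theorem IsEulerTour.crossing {d d' : E × Bool} {l : List (E × Bool)}
    (h : T.IsEulerTour (d :: d' :: l)) {C : Set E} (hC : C ∈ T.cycles) (hv : G.tgt d ∈ G.verts C)
    (hi : G.tgt d ∈ T.interVerts) : d.1 ∈ C ↔ d'.1 ∉ C := by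
  obtain ⟨A, B, hsep, hCA, hA, hB⟩ := T.exists_sep hC hv hi
  obtain ⟨h1, h2⟩ := T.bd_sides hC hv hA hB
  obtain ⟨⟨u, hu⟩, hc⟩ := id h
  have hc' : (fun e => (cnt (d :: d' :: l) e : ℤ)) = T.indicator := funext hc
  have hAn : A.Nonempty := hC.1.nonempty.mono hCA
  have hBn : B.Nonempty := by
    rcases hB with ⟨C', hC', hCB, -⟩ | ⟨P, hP, k, -, hk, hB⟩
    · exact hC'.1.nonempty.mono hCB
    · have : k ∈ G.star B (G.tgt d) := by simp [hB]
      exact ⟨_, this.1⟩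
  have hdS : d.1 ∈ A ∪ B := by
    rw [← hsep.union, ← h.supp]
    exact fst_mem_supp (by simp)
  have hd'S : d'.1 ∈ A ∪ B := by
    rw [← hsep.union, ← h.supp]
    exact fst_mem_supp (by simp)
  have c1 := hsep.crossing hu h.supp hBn (by rw [hc', h1]) rfl
  have c2 := hsep.symm.crossing hu h.supp hAn (by rw [hc', h2]) rfl
  have m1 : d.1 ∈ A ↔ d.1 ∈ C := by
    refine ⟨fun h => ?_, fun h => hCA h⟩
    have : flip d ∈ G.star A (G.tgt d) := ⟨h, rfl⟩
    rw [hA] at this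
    exact this.1
  have m2 : d'.1 ∈ A ↔ d'.1 ∈ C := by
    refine ⟨fun h => ?_, fun h => hCA h⟩
    have : d' ∈ G.star A (G.tgt d) := ⟨h, hu.2.1⟩
    rw [hA] at this
    exact this.1
  rw [← m1, ← m2]
  constructor
  · exact c1
  · intro hn
    by_contra hdA
    exact c2 (hdS.resolve_left hdA) (hd'S.resolve_left hn)

omit [Finite V] [Fintype E] in
/-- A tour does not turn back along an edge. -/
theorem IsEulerTour.ne_flip {d d' : E × Bool} {l : List (E × Bool)}
    (h : T.IsEulerTour (d :: d' :: l)) : d' ≠ flip d := by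
  classical
  rintro rfl
  obtain ⟨⟨u, hu⟩, hc⟩ := id h
  have hdT : d.1 ∈ T.edges := by
    rw [← h.supp]
    exact fst_mem_supp (by simp)
  -- The turn takes both possible uses of the edge, so it lies on a block path and does not recur in
  -- `l`. But `l` uses another edge at `G.tgt d`, so it leads from `G.src d` to `G.tgt d` without
  -- this edge and closes a cycle through it.
  have hcd := hc d.1
  rw [cnt_cons, cnt_cons, if_pos rfl, if_pos (flip_fst d)] at hcd
  obtain ⟨P, hP, hdP⟩ : ∃ P ∈ T.paths, d.1 ∈ P.edges := by
    rcases T.mem_edges.1 hdT with ⟨C, hC, heC⟩ | h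
    · rw [T.indicator_cycle hC heC] at hcd
      push_cast at hcd
      omega
    · exact h
  have hdl : d.1 ∉ SignedGraph.supp l := by
    rw [← cnt_pos]
    rw [T.indicator_path hP hdP] at hcd
    push_cast at hcd
    omega
  have hloop : G.src d ≠ G.tgt d := by
    rcases mem_supp'.1 hdP with hm | hm
    · exact P.src_ne_tgt hm
    · simpa using (P.src_ne_tgt hm).symm
  obtain ⟨k, hk, hkd⟩ : ∃ k ∈ G.star T.edges (G.tgt d), k.1 ≠ d.1 := by
    by_cases hi : G.tgt d ∈ T.interVerts
    · obtain ⟨C, hC, hv⟩ := T.exists_cycle_of_inter hi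
      obtain ⟨k, hk⟩ := mem_verts.1 hv
      refine ⟨k, star_mono hC.2 _ hk, fun heq => ?_⟩
      exact T.path_not_mem_cycle hP hC hdP (heq ▸ hk.1)
    · obtain ⟨a, b, hab, hst, -⟩ := T.exists_star_of_not_inter (tgt_mem_verts hdT) hi
      have key : ∀ x ∈ G.star T.edges (G.tgt d), x.1 = d.1 → x = flip d := by
        intro x hx hxd
        rcases eq_or_eq_flip hxd with rfl | rfl
        · exact absurd hx.2 hloop
        · rfl
      by_cases ha : a.1 = d.1
      · refine ⟨b, by simp [hst], fun hb => hab ?_⟩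
        rw [key a (by simp [hst]) ha, key b (by simp [hst]) hb]
      · exact ⟨a, by simp [hst], ha⟩
  have hkl : k.1 ∈ SignedGraph.supp l := by
    have := hk.1
    rw [← h.supp, supp_cons, supp_cons] at this
    simpa [hkd] using this
  obtain ⟨rfl, -, hl⟩ := hu
  rw [tgt_flip] at hl
  obtain ⟨l1, l2, rfl, w1, w2⟩ := hl.split_at (mem_verts.2 ⟨k, hkl, hk.2⟩)
  obtain ⟨C, hC, hdC, hCs⟩ := exists_cycle_through (d := flip d) (l := l1)
    (by rw [tgt_flip]; exact w1) (fun hm => hdl (supp_mono (by intro; simp; tauto) hm))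
  refine T.path_not_mem_cycle hP (C := C) ⟨hC, fun x hx => ?_⟩ hdP hdC
  rcases hCs hx with rfl | hx
  · exact hdT
  · rw [← h.supp]
    exact supp_mono (by intro; simp; tauto) hx

end

end CycleTree

end SignedGraph

/-! ### End-block cycles, circuits of Type III and directions -/

namespace SignedGraph

variable {V E : Type*} {G : SignedGraph V E}

theorem Wk.mem_of_mem_verts {u v w : V} {l : List (E × Bool)} (h : Wk G.src G.tgt u l v)
    (hw : w ∈ G.verts (supp l)) : w ∈ u :: l.map G.tgt := by
  obtain ⟨k, hk, rfl⟩ := mem_verts.1 hw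
  rcases mem_supp'.1 hk with hk | hk
  · rw [← h.map_append]
    exact List.mem_append_left _ (List.mem_map.2 ⟨k, hk, rfl⟩)
  · exact List.mem_cons_of_mem _ (List.mem_map.2 ⟨_, hk, by simp⟩)

theorem Wk.end_mem {u v : V} {l : List (E × Bool)} (h : Wk G.src G.tgt u l v) :
    v ∈ u :: l.map G.tgt := by
  rw [← h.map_append]
  simp

namespace CycleTree

variable {T : G.CycleTree}

theorem mem_cycles_of_subset {T' : G.CycleTree} (h : T'.edges ⊆ T.edges) {C : Set E}
    (hC : C ∈ T'.cycles) : C ∈ T.cycles := ⟨hC.1, fun _ he => h (hC.2 he)⟩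

theorem edges_eq_of_no_inter {C : Set E} (hC : C ∈ T.cycles)
    (h : ∀ v ∈ G.verts C, v ∉ T.interVerts) : T.edges = C := by
  refine Set.Subset.antisymm (fun e he => ?_) hC.2
  obtain ⟨e₀, he₀⟩ := hC.1.nonempty
  refine (T.connected.2 e₀ (hC.2 he₀) e he).mem_of_closed he₀ ?_
  intro v _ x hx y hy hxC
  have hv : v ∈ G.verts C := mem_verts.2 ⟨x, hxC, hx.2⟩
  rw [T.star_eq_of_not_inter hC hv (h v hv)] at hy
  exact hy.1

theorem isCircuit_of_cycle (hT : T.IsEulerian) {C : Set E} (hC : G.IsCycle C) (h : T.edges = C) :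
    T.IsCircuit := by
  refine ⟨hT, fun T' _ hss => ?_⟩
  obtain ⟨D, hD⟩ := T'.exists_cycle
  have hDC : D ⊆ C := fun e he => h ▸ hss.1 (hD.2 he)
  have := hD.1.eq_of_subset hC hDC
  subst this
  exact hss.2 (h ▸ hD.2)

/-- Intersection vertices and block paths require two different cycles, so there are no intersection
vertices, and zero is even. -/
theorem sign_of_single (hT : T.IsEulerian) {C : Set E} (hC : C ∈ T.cycles)
    (h : ∀ D ∈ T.cycles, D = C) : G.cycleSign C = 1 := by
  have hi : T.interVerts = ∅ := by
    refine Set.eq_empty_of_forall_notMem fun v hv => ?_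
    rcases hv with ⟨C₁, h1, C₂, h2, hne, -⟩ | ⟨P, hP, -⟩
    · exact hne ((h C₁ h1).trans (h C₂ h2).symm)
    · obtain ⟨C₁, h1, C₂, h2, hne, -⟩ := T.paths_inter P hP
      exact hne ((h C₁ h1).trans (h C₂ h2).symm)
  rcases Int.units_eq_one_or (G.cycleSign C) with h1 | h1
  · exact h1
  · have := (hT C hC).2 h1
    simp [hi] at this

theorem IsEndBlock.sign (hT : T.IsEulerian) {C : Set E} (hC : T.IsEndBlock C) :
    G.cycleSign C = -1 := by
  rcases Int.units_eq_one_or (G.cycleSign C) with h1 | h1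
  · have := (hT C hC.1).1 h1
    rw [hC.2] at this
    exact absurd this (by decide)
  · exact h1

theorem IsEndBlock.unique {C : Set E} (hC : T.IsEndBlock C) {v w : V} (hv : v ∈ G.verts C)
    (hvi : v ∈ T.interVerts) (hw : w ∈ G.verts C) (hwi : w ∈ T.interVerts) : v = w := by
  obtain ⟨x, hx⟩ := Set.ncard_eq_one.1 hC.2
  have h1 : v ∈ ({x} : Set V) := hx ▸ ⟨hv, hvi⟩
  have h2 : w ∈ ({x} : Set V) := hx ▸ ⟨hw, hwi⟩
  exact h1.trans h2.symm

/-- An Eulerian cycle-tree inside `T` has only unbalanced cycles, hence more than one by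
`sign_of_single`, hence both. The hypothesis `hS` then gives all of `T`. -/
theorem isCircuit_of_two (hT : T.IsEulerian) {C₁ C₂ : Set E}
    (hcyc : ∀ C ∈ T.cycles, C = C₁ ∨ C = C₂) (h1 : G.cycleSign C₁ = -1) (h2 : G.cycleSign C₂ = -1)
    (hS : ∀ S', G.IsConnected S' → S' ⊆ T.edges → C₁ ⊆ S' → C₂ ⊆ S' → T.edges ⊆ S') :
    T.IsCircuit := by
  refine ⟨hT, fun T' hT' hss => ?_⟩
  have hsign : ∀ C ∈ T'.cycles, G.cycleSign C = -1 := by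
    intro C hC
    rcases hcyc C (mem_cycles_of_subset hss.1 hC) with rfl | rfl <;> assumption
  obtain ⟨D, hD⟩ := T'.exists_cycle
  obtain ⟨D', hD', hne⟩ : ∃ D' ∈ T'.cycles, D' ≠ D := by
    by_contra! hcon
    have := sign_of_single hT' hD hcon
    rw [hsign D hD] at this
    exact absurd this (by decide)
  refine hss.2 (hS _ T'.connected hss.1 ?_ ?_)
  · rcases hcyc D (mem_cycles_of_subset hss.1 hD) with rfl | rfl
    · exact hD.2
    · rcases hcyc D' (mem_cycles_of_subset hss.1 hD') with rfl | rfl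
      exacts [hD'.2, absurd rfl hne]
  · rcases hcyc D (mem_cycles_of_subset hss.1 hD) with rfl | rfl
    · rcases hcyc D' (mem_cycles_of_subset hss.1 hD') with rfl | rfl
      exacts [absurd rfl hne, hD'.2]
    · exact hD.2

/-- Two end-block cycles with a common vertex form a circuit. -/
theorem isCircuit_of_endBlocks (hT : T.IsEulerian) {C C' : Set E} (hC : T.IsEndBlock C)
    (hC' : T.IsEndBlock C') (hne : C ≠ C') {v : V} (hv : v ∈ G.verts C) (hv' : v ∈ G.verts C') :
    T.IsCircuit := by
  have hi : v ∈ T.interVerts := Or.inl ⟨C, hC.1, C', hC'.1, hne, hv, hv'⟩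
  -- The two cycles exhaust the star of `v`, and `v` is the only intersection vertex on either, so
  -- nothing else can be attached to them.
  have hstar : G.star T.edges v ⊆ {h | h.1 ∈ C ∪ C'} := by
    obtain ⟨A, B, hsep, hCA, hA, hB⟩ := T.exists_sep hC.1 hv hi
    obtain ⟨x, hx⟩ := mem_verts.1 hv'
    have hxB : x ∈ G.star B v := by
      have h1 := hC'.1.2 hx.1
      rw [hsep.union] at h1
      refine ⟨h1.resolve_left fun h => hne ?_, hx.2⟩
      have h2 : x ∈ G.star A v := ⟨h, hx.2⟩
      rw [hA] at h2
      exact T.cycle_eq hC.1 hC'.1 h2.1 hx.1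
    rintro y ⟨hy, hyv⟩
    rw [hsep.union] at hy
    rcases hy with hy | hy
    · have h2 : y ∈ G.star A v := ⟨hy, hyv⟩
      rw [hA] at h2
      exact Or.inl h2.1
    · have hyB : y ∈ G.star B v := ⟨hy, hyv⟩
      right
      rcases hB with ⟨C'', hC'', -, hv'', hB⟩ | ⟨P, hP, k, -, hk, hB⟩
      · rw [hB] at hyB hxB
        rw [T.cycle_eq hC'.1 hC'' hx.1 hxB.1]
        exact hyB.1
      · rw [hB, ← hk] at hxB
        exact absurd hx.1 (T.path_not_mem_cycle hP hC'.1 hxB.1)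
  have hedges : T.edges ⊆ C ∪ C' := by
    obtain ⟨e₀, he₀⟩ := hC.1.1.nonempty
    intro e he
    refine (T.connected.2 e₀ (hC.1.2 he₀) e he).mem_of_closed (Or.inl he₀) ?_
    intro w _ x hx y hy hxC
    by_cases hwv : w = v
    · subst hwv
      exact hstar hy
    · rcases hxC with hxC | hxC
      · have hw : w ∈ G.verts C := mem_verts.2 ⟨x, hxC, hx.2⟩
        rw [T.star_eq_of_not_inter hC.1 hw fun h => hwv (hC.unique hw h hv hi)] at hy
        exact Or.inl hy.1
      · have hw : w ∈ G.verts C' := mem_verts.2 ⟨x, hxC, hx.2⟩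
        rw [T.star_eq_of_not_inter hC'.1 hw fun h => hwv (hC'.unique hw h hv' hi)] at hy
        exact Or.inr hy.1
  refine isCircuit_of_two hT (C₁ := C) (C₂ := C') ?_ (hC.sign hT) (hC'.sign hT)
    fun S' _ _ h1 h2 e he => (hedges he).elim (fun h => h1 h) (fun h => h2 h)
  intro D hD
  obtain ⟨e, he⟩ := hD.1.nonempty
  rcases hedges (hD.2 he) with h | h
  · exact Or.inl (T.cycle_eq hD hC.1 he h)
  · exact Or.inr (T.cycle_eq hD hC'.1 he h)

/-- Each closed part of a tour contains edges of an end-block cycle. -/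
theorem IsEulerTour.exists_endBlock [Fintype E] (hT : T.IsEulerian) (hnc : ¬ T.IsCircuit)
    {l1 A l3 : List (E × Bool)} (hW : T.IsEulerTour (l1 ++ A ++ l3)) (hA : A ≠ []) {w : V}
    (hw : Wk G.src G.tgt w A w) : ∃ C, T.IsEndBlock C ∧ ∃ e ∈ SignedGraph.supp A, e ∈ C := by
  -- A minimal closed piece `m` repeats no vertex, and no edge either since a tour does not turn
  -- back; so it goes round a block cycle. The tour leaves a cycle at each intersection vertex it
  -- passes, so only the base `x` can be one.
  obtain ⟨m1, m, m3, x, rfl, hm, hmw, hn⟩ := hw.exists_min_closed hA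
  have hrot : T.IsEulerTour (m ++ (m3 ++ l3 ++ (l1 ++ m1))) := by
    refine hW.of_isRotated ?_
    have := List.isRotated_append (l := l1 ++ m1) (l' := m ++ (m3 ++ l3))
    simpa using this
  set r := m3 ++ l3 ++ (l1 ++ m1) with hr
  have hfst : (m.map Prod.fst).Nodup := by
    refine hmw.nodup_fst_of_closed hn ?_
    rintro d rfl
    exact hrot.ne_flip rfl
  have hCyc : G.IsCycle (SignedGraph.supp m) :=
    ⟨x, m, isCycleWalk_iff.2 ⟨hm, hmw, hn, hfst⟩, rfl⟩
  have hC : SignedGraph.supp m ∈ T.cycles := by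
    refine ⟨hCyc, ?_⟩
    rw [← hrot.supp]
    exact supp_mono (by intro; simp; tauto)
  have hx : ∀ v ∈ G.verts (SignedGraph.supp m), v ∈ T.interVerts → v = x := by
    intro v hv hi
    by_contra hvx
    obtain ⟨d, hd, rfl⟩ := List.mem_map.1 (hmw.map_perm.mem_iff.1 (exists_mem_map_src hmw hv))
    obtain ⟨a, b, hab⟩ := List.append_of_mem hd
    cases b with
    | nil =>
      rw [hab] at hmw
      exact hvx hmw.last
    | cons d' b =>
      have h2 : T.IsEulerTour (d :: d' :: (b ++ r ++ a)) := by
        refine hrot.of_isRotated ?_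
        rw [hab]
        have := List.isRotated_append (l := a) (l' := d :: d' :: (b ++ r))
        simpa using this
      exact (h2.crossing hC hv hi).1 (fst_mem_supp hd) (fst_mem_supp (by simp [hab]))
  obtain ⟨e, he⟩ := supp_nonempty hm
  refine ⟨SignedGraph.supp m, ⟨hC, ?_⟩, e, supp_mono (by intro; simp; tauto) he, he⟩
  by_cases hxi : x ∈ G.verts (SignedGraph.supp m) ∩ T.interVerts
  · refine Set.ncard_eq_one.2 ⟨x, ?_⟩
    ext v
    constructor
    · rintro ⟨hv, hi⟩
      exact hx v hv hi
    · rintro rfl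
      exact hxi
  · refine absurd (isCircuit_of_cycle hT hCyc (edges_eq_of_no_inter hC fun v hv hi => ?_)) hnc
    obtain rfl := hx v hv hi
    exact hxi ⟨hv, hi⟩

/-! ### Circuits of Type III -/

section Dumbbell

variable {C₁ C₂ : Set E} {P : G.SimplePath}

theorem _root_.SignedGraph.sep_dumbbell (hd : Disjoint (G.verts C₁) (G.verts C₂))
    (h1 : P.verts ∩ G.verts C₁ = {P.init}) :
    Sep G (C₁ ∪ P.edges ∪ C₂) C₁ (P.edges ∪ C₂) P.init := by
  refine ⟨Set.union_assoc _ _ _, Set.disjoint_left.2 ?_, ?_⟩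
  · rintro e he (⟨b, hb⟩ | heC)
    · have := h1.subset ⟨tgt_mem_verts (h := (e, b)) (fst_mem_supp hb), tgt_mem_verts he⟩
      exact P.tgt_ne_init hb this
    · exact Set.disjoint_left.1 hd (src_mem_verts (h := (e, false)) he)
        (src_mem_verts (h := (e, false)) heC)
  · intro w hw hw'
    rw [verts_union] at hw'
    rcases hw' with hw' | hw'
    · exact h1.subset ⟨hw', hw⟩
    · exact absurd hw' (Set.disjoint_left.1 hd hw)

theorem _root_.SignedGraph.sep_path_cycle (h2 : P.verts ∩ G.verts C₂ = {P.term}) :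
    Sep G (P.edges ∪ C₂) P.edges C₂ P.term := by
  refine ⟨rfl, Set.disjoint_left.2 ?_, fun w hw hw' => h2.subset ⟨hw, hw'⟩⟩
  rintro e ⟨b, hb⟩ heC
  have := h2.subset ⟨src_mem_verts (h := (e, b)) (fst_mem_supp hb), src_mem_verts heC⟩
  exact P.src_ne_term hb this

/-- The ends of the path separate the three pieces, and a simple path contains no cycle. -/
theorem _root_.SignedGraph.cycles_dumbbell (hC₁ : G.IsCycle C₁) (hC₂ : G.IsCycle C₂)
    (hd : Disjoint (G.verts C₁) (G.verts C₂))
    (h1 : P.verts ∩ G.verts C₁ = {P.init}) (h2 : P.verts ∩ G.verts C₂ = {P.term}) :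
    G.cyclesIn (C₁ ∪ P.edges ∪ C₂) = {C₁, C₂} := by
  ext C
  constructor
  · rintro ⟨hC, hCS⟩
    rcases (sep_dumbbell hd h1).cycle hC hCS with h | h
    · exact Or.inl (hC.eq_of_subset hC₁ h)
    · rcases (sep_path_cycle h2).cycle hC h with h | h
      · exact absurd h (P.not_cycle hC)
      · exact Or.inr (hC.eq_of_subset hC₂ h)
  · rintro (rfl | rfl)
    · exact ⟨hC₁, fun _ h => Or.inl (Or.inl h)⟩
    · exact ⟨hC₂, fun _ h => Or.inr h⟩

theorem _root_.SignedGraph.connected_dumbbell (hC₁ : G.IsCycle C₁) (hC₂ : G.IsCycle C₂)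
    (h1 : P.verts ∩ G.verts C₁ = {P.init}) (h2 : P.verts ∩ G.verts C₂ = {P.term}) :
    G.IsConnected (C₁ ∪ P.edges ∪ C₂) := by
  obtain ⟨d, hd⟩ := P.edges_nonempty
  have hP : ∀ e ∈ P.edges, G.SameComponent (C₁ ∪ P.edges ∪ C₂) ∅ e d := fun e he =>
    P.wk.sameComponent_of_mem (fun _ h => Or.inl (Or.inr h)) he hd
  have hlink : ∀ C v, G.IsCycle C → C ⊆ C₁ ∪ P.edges ∪ C₂ → v ∈ P.verts → v ∈ G.verts C →
      ∀ e ∈ C, G.SameComponent (C₁ ∪ P.edges ∪ C₂) ∅ e d := by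
    intro C v hC hCS hvP hvC e he
    obtain ⟨x, hx⟩ := mem_verts.1 hvP
    obtain ⟨y, hy⟩ := mem_verts.1 hvC
    have s1 := (hC.sameComponent hCS v he hy.1).mono subset_rfl (Set.empty_subset _)
    have s2 : G.SameComponent (C₁ ∪ P.edges ∪ C₂) ∅ y.1 x.1 :=
      .of_star (star_mono hCS v hy) (star_mono (fun _ h => Or.inl (Or.inr h)) v hx) (by simp)
    exact (s1.trans s2).trans (hP _ hx.1)
  have key : ∀ e ∈ C₁ ∪ P.edges ∪ C₂, G.SameComponent (C₁ ∪ P.edges ∪ C₂) ∅ e d := by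
    rintro e ((he | he) | he)
    · exact hlink C₁ P.init hC₁ (fun _ h => Or.inl (Or.inl h)) P.init_mem (h1.symm.subset rfl).2 e he
    · exact hP e he
    · exact hlink C₂ P.term hC₂ (fun _ h => Or.inr h) P.term_mem (h2.symm.subset rfl).2 e he
  exact ⟨⟨d, Or.inl (Or.inr hd)⟩, fun e he e' he' => (key e he).trans (key e' he').symm⟩

/-- If a path edge is missing, `C₁` with the part of the path before it has no vertex in common with
`C₂` and the part after it, so `S'` would be disconnected. -/
theorem _root_.SignedGraph.subset_of_connected_dumbbell (hC₁ : G.IsCycle C₁) (hC₂ : G.IsCycle C₂)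
    (hd : Disjoint (G.verts C₁) (G.verts C₂))
    (h1 : P.verts ∩ G.verts C₁ = {P.init}) (h2 : P.verts ∩ G.verts C₂ = {P.term}) {S' : Set E}
    (hS' : G.IsConnected S') (hsub : S' ⊆ C₁ ∪ P.edges ∪ C₂) (hS1 : C₁ ⊆ S') (hS2 : C₂ ⊆ S') :
    P.edges ⊆ S' := by
  rintro e ⟨b, hb⟩
  by_contra heS
  obtain ⟨l1, l2, hl⟩ := List.append_of_mem hb
  have hw := P.wk
  rw [hl] at hw
  obtain ⟨w, w1, -, w2⟩ := wk_append.1 hw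
  have hdisj : ∀ v ∈ P.init :: l1.map G.tgt, v ∉ G.tgt (e, b) :: l2.map G.tgt := by
    have := P.nodup
    rw [hl, List.map_append, List.map_cons, ← List.cons_append, List.nodup_append] at this
    exact fun v hv hv' => this.2.2 v hv v hv' rfl
  have hL1 : ∀ v ∈ P.init :: l1.map G.tgt, v ∈ P.verts := fun v hv => by
    rw [P.mem_verts_iff, hl]
    simp only [List.map_append, List.mem_cons, List.mem_append] at hv ⊢
    tauto
  have hL2 : ∀ v ∈ G.tgt (e, b) :: l2.map G.tgt, v ∈ P.verts := fun v hv => by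
    rw [P.mem_verts_iff, hl]
    simp only [List.map_append, List.map_cons, List.mem_cons, List.mem_append] at hv ⊢
    tauto
  obtain ⟨c₁, hc₁⟩ := hC₁.nonempty
  obtain ⟨c₂, hc₂⟩ := hC₂.nonempty
  have hmem := (hS'.2 c₁ (hS1 hc₁) c₂ (hS2 hc₂)).mem_of_closed (A := C₁ ∪ supp l1) (Or.inl hc₁) ?_
  · rcases hmem with h | h
    · exact Set.disjoint_left.1 hd (src_mem_verts (h := (c₂, false)) h)
        (src_mem_verts (h := (c₂, false)) hc₂)
    · refine Set.disjoint_left.1 (sep_path_cycle h2).disjoint ?_ hc₂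
      rw [SimplePath.edges, hl, supp_append]
      exact Or.inl h
  · intro v _ x hx y hy hxX
    by_contra hyX
    have hv1 : v ∈ G.verts C₁ ∨ v ∈ P.init :: l1.map G.tgt := by
      rcases hxX with h | h
      · exact Or.inl (mem_verts.2 ⟨x, h, hx.2⟩)
      · exact Or.inr (w1.mem_of_mem_verts (mem_verts.2 ⟨x, h, hx.2⟩))
    have hv2 : v ∈ G.verts C₂ ∨ v ∈ G.tgt (e, b) :: l2.map G.tgt := by
      rcases hsub hy.1 with (h | h) | h
      · exact absurd (Or.inl h) hyX
      · rw [SimplePath.edges, hl, supp_append, supp_cons] at h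
        rcases h with h | h | h
        · exact absurd (Or.inr h) hyX
        · exact absurd (show y.1 = e from h) fun h => heS (h ▸ hy.1)
        · exact Or.inr (w2.mem_of_mem_verts (mem_verts.2 ⟨y, h, hy.2⟩))
      · exact Or.inl (mem_verts.2 ⟨y, h, hy.2⟩)
    rcases hv1 with h | h <;> rcases hv2 with h' | h'
    · exact Set.disjoint_left.1 hd h h'
    · have : v = P.init := h1.subset ⟨hL2 v h', h⟩
      exact hdisj v (by simp [this]) h'
    · have : v = P.term := h2.subset ⟨hL1 v h, h'⟩
      exact hdisj v h (this ▸ w2.end_mem)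
    · exact hdisj v h h'

/-- Two disjoint unbalanced cycles that are joined by a simple path form a circuit of Type III. -/
theorem exists_typeIII (hC₁ : G.IsCycle C₁) (hC₂ : G.IsCycle C₂)
    (hs1 : G.cycleSign C₁ = -1) (hs2 : G.cycleSign C₂ = -1)
    (hd : Disjoint (G.verts C₁) (G.verts C₂))
    (h1 : P.verts ∩ G.verts C₁ = {P.init}) (h2 : P.verts ∩ G.verts C₂ = {P.term}) :
    ∃ D : G.CycleTree, D.paths = {P} ∧ D.cycles = {C₁, C₂} ∧ D.IsTypeIII C₁ P C₂ := by
  have hne : C₁ ≠ C₂ := by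
    rintro rfl
    exact Set.disjoint_left.1 hd (h1.symm.subset rfl).2 (h1.symm.subset rfl).2
  have hcyc := cycles_dumbbell hC₁ hC₂ hd h1 h2
  have hconn := connected_dumbbell hC₁ hC₂ h1 h2
  have hsep := sep_dumbbell hd h1
  have hsep2 : Sep G (C₁ ∪ P.edges ∪ C₂) (C₁ ∪ P.edges) C₂ P.term := by
    refine ⟨rfl, ?_, ?_⟩
    · rw [Set.disjoint_union_left]
      exact ⟨Set.disjoint_of_subset_right Set.subset_union_right hsep.disjoint,
        (sep_path_cycle h2).disjoint⟩
    · intro w hw hw'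
      rw [verts_union] at hw
      rcases hw with hw | hw
      · exact absurd hw' (Set.disjoint_left.1 hd hw)
      · exact h2.subset ⟨hw, hw'⟩
  have hdis : ∀ C ∈ G.cyclesIn (C₁ ∪ P.edges ∪ C₂), ∀ C' ∈ G.cyclesIn (C₁ ∪ P.edges ∪ C₂),
      C ≠ C' → Disjoint (G.verts C) (G.verts C') := by
    rw [hcyc]
    rintro C (rfl | rfl) C' (rfl | rfl) hne'
    exacts [absurd rfl hne', hd, hd.symm, absurd rfl hne']
  let D : G.CycleTree :=
    { edges := C₁ ∪ P.edges ∪ C₂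
      paths := {P}
      connected := hconn
      cover := by
        rw [hcyc]
        ext e
        simp only [Set.mem_union, Set.mem_iUnion, Set.mem_insert_iff, Set.mem_singleton_iff,
          exists_prop, exists_eq_or_imp, exists_eq_left]
        tauto
      cycles_inter := by
        intro C hC C' hC' hne'
        have h := hdis C hC C' hC' hne'
        refine ⟨Set.disjoint_left.2 fun e he he' => Set.disjoint_left.1 h
          (src_mem_verts (h := (e, false)) he) (src_mem_verts (h := (e, false)) he'), ?_⟩
        rw [h.inter_eq]
        exact Set.subsingleton_empty
      cycles_le_two := by
        intro v
        refine (Set.encard_le_encard (t := {C₁, C₂}) ?_).trans (Set.encard_pair hne).le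
        intro C hC
        rw [← hcyc]
        exact hC.1
      paths_disjoint := by
        rintro Q rfl Q' rfl h
        exact absurd rfl h
      paths_inter := by
        rintro Q rfl
        rw [hcyc]
        refine ⟨C₁, by simp, C₂, by simp, hne, h1, h2, ?_⟩
        rintro X (rfl | rfl) hX hX'
        exacts [absurd rfl hX, absurd rfl hX']
      cut_cycles := by
        rintro C hC C' hC' hne' v ⟨hv, hv'⟩
        exact absurd hv' (Set.disjoint_left.1 (hdis C hC C' hC' hne') hv)
      cut_paths := by
        rintro Q rfl
        exact ⟨hsep.isCutPoint hconn hC₁.nonempty (Q.edges_nonempty.mono Set.subset_union_left),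
          hsep2.isCutPoint hconn (hC₁.nonempty.mono Set.subset_union_left) hC₂.nonempty⟩ }
  have hcyc' : D.cycles = {C₁, C₂} := hcyc
  have hinter : D.interVerts = {P.init, P.term} := by
    ext v
    constructor
    · rintro (⟨C, hC, C', hC', hne', hv, hv'⟩ | ⟨Q, hQ, h⟩)
      · exact absurd hv' (Set.disjoint_left.1 (hdis C hC C' hC' hne') hv)
      · obtain rfl : Q = P := hQ
        exact h
    · exact fun h => Or.inr ⟨P, rfl, h⟩
  have hi1 : G.verts C₁ ∩ D.interVerts = {P.init} := by
    rw [hinter]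
    ext v
    constructor
    · rintro ⟨hv, rfl | rfl⟩
      exacts [rfl, h1.subset ⟨P.term_mem, hv⟩]
    · rintro rfl
      exact ⟨(h1.symm.subset rfl).2, Or.inl rfl⟩
  have hi2 : G.verts C₂ ∩ D.interVerts = {P.term} := by
    rw [hinter]
    ext v
    constructor
    · rintro ⟨hv, rfl | rfl⟩
      exacts [h2.subset ⟨P.init_mem, hv⟩, rfl]
    · rintro rfl
      exact ⟨(h2.symm.subset rfl).2, Or.inr rfl⟩
  have hE : D.IsEulerian := by
    intro C hC
    have h3 : G.cycleSign C = -1 ∧ (G.verts C ∩ D.interVerts).ncard = 1 := by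
      rw [hcyc'] at hC
      rcases hC with rfl | rfl
      · exact ⟨hs1, by rw [hi1, Set.ncard_singleton]⟩
      · exact ⟨hs2, by rw [hi2, Set.ncard_singleton]⟩
    rw [h3.1, h3.2]
    decide
  refine ⟨D, rfl, hcyc', isCircuit_of_two hE (C₁ := C₁) (C₂ := C₂) ?_ hs1 hs2 ?_, rfl, hC₁, hC₂,
    hs1, hs2, hd, h1, h2⟩
  · intro C hC
    rw [hcyc'] at hC
    exact hC
  · rintro S' hS' hsub k1 k2 e ((he | he) | he)
    exacts [k1 he, subset_of_connected_dumbbell hC₁ hC₂ hd h1 h2 hS' hsub k1 k2 he, k2 he]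

end Dumbbell

/-! ### Directions -/

section Direction

variable {δ : G.Orientation}

/-- All arrows on one side of `v` agree: on a cycle by the property of a direction at cut-points, on
a path because there is only one. If the two sides agreed as well, `v` would be a sink or a source
of `T`. -/
theorem arrow_ne_of_mem_cycle (hδ : δ.IsDirection T) {C : Set E} (hC : C ∈ T.cycles) {v : V}
    (hv : v ∈ G.verts C) (hi : v ∈ T.interVerts) {x y : E × Bool} (hx : x ∈ G.star T.edges v)
    (hy : y ∈ G.star T.edges v) (hxC : x.1 ∈ C) (hyC : y.1 ∉ C) :
    δ.arrow x.1 x.2 ≠ δ.arrow y.1 y.2 := by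
  intro heq
  have hcut := T.isCutPoint_of_inter hi
  obtain ⟨A, B, hsep, hCA, hA, hB⟩ := T.exists_sep hC hv hi
  obtain ⟨s, hs⟩ := hδ.2 C hC v hv hcut
  have hyB : y ∈ G.star B v := by
    have := hy.1
    rw [hsep.union] at this
    refine ⟨this.resolve_left fun h => hyC ?_, hy.2⟩
    have h1 : y ∈ G.star A v := ⟨h, hy.2⟩
    rw [hA] at h1
    exact h1.1
  have hBs : ∀ z ∈ G.star B v, δ.arrow z.1 z.2 = δ.arrow y.1 y.2 := by
    rcases hB with ⟨C', hC', -, hv', hB⟩ | ⟨P, hP, k, -, -, hB⟩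
    · obtain ⟨s', hs'⟩ := hδ.2 C' hC' v hv' hcut
      rw [hB] at hyB ⊢
      intro z hz
      rw [hs' _ hz.1 _ hz.2, hs' _ hyB.1 _ hyB.2]
    · rw [hB] at hyB ⊢
      intro z hz
      rw [Set.mem_singleton_iff.1 hz, Set.mem_singleton_iff.1 hyB]
  refine hδ.1 v (mem_verts.2 ⟨x, hx⟩) s fun e he b hb => ?_
  rw [hsep.union] at he
  rcases he with he | he
  · have h1 : (e, b) ∈ G.star A v := ⟨he, hb⟩
    rw [hA] at h1
    exact hs e h1.1 b hb
  · rw [hBs (e, b) ⟨he, hb⟩, ← heq]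
    exact hs _ hxC _ hx.2

/-- Every direction is coherent along a tour. At an intersection vertex the tour changes sides;
elsewhere it passes through the only two half-edges, which have different arrows as there is no sink
or source. -/
theorem IsEulerTour.arrow_ne [Fintype E] (hδ : δ.IsDirection T) {d d' : E × Bool}
    {l : List (E × Bool)} (h : T.IsEulerTour (d :: d' :: l)) :
    δ.arrow (flip d).1 (flip d).2 ≠ δ.arrow d'.1 d'.2 := by
  obtain ⟨u, hu⟩ := h.1
  have hd : flip d ∈ G.star T.edges (G.tgt d) :=
    ⟨by rw [← h.supp]; exact fst_mem_supp (d := d) (by simp), rfl⟩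
  have hd' : d' ∈ G.star T.edges (G.tgt d) :=
    ⟨by rw [← h.supp]; exact fst_mem_supp (by simp), hu.2.1⟩
  by_cases hi : G.tgt d ∈ T.interVerts
  · obtain ⟨C, hC, hv⟩ := T.exists_cycle_of_inter hi
    have hcr := h.crossing hC hv hi
    by_cases hdC : d.1 ∈ C
    · exact arrow_ne_of_mem_cycle hδ hC hv hi hd hd' hdC (hcr.1 hdC)
    · exact (arrow_ne_of_mem_cycle hδ hC hv hi hd' hd (not_not.1 fun hn => hdC (hcr.2 hn)) hdC).symm
  · have hv := mem_verts.2 ⟨_, hd⟩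
    obtain ⟨a, b, hab, hst, -⟩ := T.exists_star_of_not_inter hv hi
    intro heq
    have hsub : ({d', flip d} : Set _) ⊆ {a, b} := by
      rw [← hst]
      rintro x (rfl | rfl)
      exacts [hd', hd]
    have hpair := pair_eq_of_subset h.ne_flip hsub
    refine hδ.1 _ hv (δ.arrow d'.1 d'.2) fun e he b hb => ?_
    have : (e, b) ∈ G.star T.edges (G.tgt d) := ⟨he, hb⟩
    rw [hst, ← hpair] at this
    rcases this with h1 | h1
    · rw [← h1]
    · rw [← heq, ← h1]

/-- A direction of a cycle-tree restricts to a direction of each circuit of Type III that consists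
of two end-block cycles and of a path along which the direction is coherent. -/
theorem isDirection_restrict (hδ : δ.IsDirection T) {C₁ C₂ : Set E} {P : G.SimplePath}
    {D : G.CycleTree} (hD : D.cycles = {C₁, C₂}) (hIII : D.IsTypeIII C₁ P C₂)
    (hC₁ : T.IsEndBlock C₁) (hC₂ : T.IsEndBlock C₂) (hi1 : P.init ∈ T.interVerts)
    (hi2 : P.term ∈ T.interVerts) (hPT : P.edges ⊆ T.edges)
    (hP : ∀ d ∈ P.steps, ∀ d' ∈ P.steps, G.tgt d = G.src d' →
      δ.arrow (flip d).1 (flip d).2 ≠ δ.arrow d'.1 d'.2) : δ.IsDirection D := by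
  obtain ⟨-, hDe, -, -, -, -, hdis, h1, h2⟩ := hIII
  have hsub : D.edges ⊆ T.edges := by
    rw [hDe]
    exact Set.union_subset (Set.union_subset hC₁.1.2 hPT) hC₂.1.2
  have m1 : P.init ∈ G.verts C₁ := (h1.symm.subset rfl).2
  have m2 : P.term ∈ G.verts C₂ := (h2.symm.subset rfl).2
  have sub1 : C₁ ⊆ D.edges := by rw [hDe]; exact fun _ h => Or.inl (Or.inl h)
  have sub2 : C₂ ⊆ D.edges := by rw [hDe]; exact fun _ h => Or.inr h
  have subP : P.edges ⊆ D.edges := by rw [hDe]; exact fun _ h => Or.inl (Or.inr h)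
  have hcyc : ∀ C ∈ D.cycles, T.IsEndBlock C := by
    rw [hD]
    rintro C (rfl | rfl) <;> assumption
  -- there is no sink or source at the ends of the path
  have hends : ∀ C v, T.IsEndBlock C → v ∈ G.verts C → v ∈ T.interVerts → C ⊆ D.edges →
      Disjoint P.edges C → v ∈ P.verts → ∀ s : ℤˣ,
      ¬ ∀ e ∈ D.edges, ∀ b, G.inc e b = v → δ.arrow e b = s := by
    intro C v hC hv hi hCD hPC hvP s hs
    obtain ⟨x, hx⟩ := mem_verts.1 hv
    obtain ⟨y, hy⟩ := mem_verts.1 hvP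
    refine arrow_ne_of_mem_cycle hδ hC.1 hv hi (star_mono hC.1.2 v hx) (star_mono hPT v hy) hx.1
      (Set.disjoint_left.1 hPC hy.1) ?_
    rw [hs _ (hCD hx.1) _ hx.2, hs _ (subP hy.1) _ hy.2]
  have dis1 : Disjoint P.edges C₁ := by
    refine ((sep_dumbbell hdis h1).disjoint.mono_right Set.subset_union_left).symm
  have dis2 : Disjoint P.edges C₂ := (sep_path_cycle h2).disjoint
  have hcy : ∀ C ∈ D.cycles, ∀ v ∈ G.verts C, v ∉ T.interVerts →
      G.star D.edges v = G.star C v ∧ G.star T.edges v = G.star C v := by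
    intro C hC v hv hi
    have h := T.star_eq_of_not_inter (hcyc C hC).1 hv hi
    refine ⟨Set.Subset.antisymm ?_ (star_mono hC.2 v), h⟩
    rw [← h]
    exact star_mono hsub v
  constructor
  · intro v hv s hs
    have hcase : (∃ C ∈ D.cycles, v ∈ G.verts C) ∨ v ∈ P.verts := by
      rw [hDe, verts_union, verts_union] at hv
      rw [hD]
      rcases hv with (hv | hv) | hv
      exacts [Or.inl ⟨C₁, by simp, hv⟩, Or.inr hv, Or.inl ⟨C₂, by simp, hv⟩]
    have hinit : v ≠ P.init := by
      rintro rfl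
      exact hends C₁ _ hC₁ m1 hi1 sub1 dis1 P.init_mem s hs
    have hterm : v ≠ P.term := by
      rintro rfl
      exact hends C₂ _ hC₂ m2 hi2 sub2 dis2 P.term_mem s hs
    rcases hcase with ⟨C, hC, hvC⟩ | hvP
    · have hi : v ∉ T.interVerts := by
        intro hi
        have hC' := hC
        rw [hD] at hC'
        rcases hC' with rfl | rfl
        · exact hinit (hC₁.unique hvC hi m1 hi1)
        · exact hterm (hC₂.unique hvC hi m2 hi2)
      refine hδ.1 v (verts_mono (hcyc C hC).1.2 hvC) s fun e he b hb => ?_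
      have : (e, b) ∈ G.star T.edges v := ⟨he, hb⟩
      rw [(hcy C hC v hvC hi).2] at this
      exact hs e (hC.2 this.1) b hb
    · obtain ⟨d, hd, d', hd', rfl, h3, -⟩ := P.exists_interior hvP hinit hterm
      refine hP d hd d' hd' h3.symm ?_
      exact (hs (flip d).1 (subP (fst_mem_supp (d := d) hd)) (flip d).2 rfl).trans
        (hs d'.1 (subP (fst_mem_supp hd')) d'.2 h3).symm
  -- A cut-point of `D` on its cycle is an intersection vertex of `T`: at any other vertex only the
  -- cycle itself is attached, and it stays connected without the point.
  · intro C hC v hv hcut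
    by_cases hi : v ∈ T.interVerts
    · exact hδ.2 C (hcyc C hC).1 v hv (T.isCutPoint_of_inter hi)
    · refine absurd hcut (not_isCutPoint ?_)
      rw [(hcy C hC v hv hi).1]
      exact fun a ha b hb => hC.1.sameComponent hC.2 v ha.1 hb.1

end Direction

end CycleTree

end SignedGraph

/-! ### Cutting a tour into segments on and off the end-block cycles -/

namespace SignedGraph

section Lists

variable {α : Type*}

theorem _root_.List.IsRotated.flatten {L L' : List (List α)} (h : L.IsRotated L') :
    L.flatten.IsRotated L'.flatten := by
  obtain ⟨n, rfl⟩ := h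
  rw [List.rotate_eq_drop_append_take_mod, List.flatten_append]
  conv_lhs => rw [← List.take_append_drop (n % L.length) L, List.flatten_append]
  exact List.isRotated_append

theorem _root_.List.ofFn_isRotated {n : ℕ} (f : Fin (n + 1) → α) (i : Fin (n + 1)) :
    (List.ofFn f).IsRotated (List.ofFn fun j => f (i + j)) := by
  refine ⟨i, List.ext_getElem (by simp) fun j h1 h2 => ?_⟩
  rw [List.getElem_rotate]
  simp only [List.getElem_ofFn, List.length_ofFn]
  congr 1
  ext
  simp [Fin.val_add, add_comm]

/-- A list that ends outside of `p` is an alternating sequence of nonempty blocks in `p` and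
nonempty blocks outside of `p`, preceded by a block outside of `p`. -/
theorem _root_.List.exists_blocks_of_last (p : α → Prop) (l : List α) {z : α} (hz : ¬ p z) :
    ∃ (q : List α) (L : List (List α × List α)),
      l ++ [z] = q ++ (L.map fun x => x.1 ++ x.2).flatten ∧ (∀ a ∈ q, ¬ p a) ∧
      ∀ x ∈ L, x.1 ≠ [] ∧ x.2 ≠ [] ∧ (∀ a ∈ x.1, p a) ∧ ∀ a ∈ x.2, ¬ p a := by
  induction l with
  | nil => exact ⟨[z], [], by simp, by simpa using hz, by simp⟩
  | cons a l ih =>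
    obtain ⟨q, L, h1, h2, h3⟩ := ih
    by_cases ha : p a
    · cases q with
      | nil =>
        cases L with
        | nil => simp at h1
        | cons x L =>
          refine ⟨[], (a :: x.1, x.2) :: L, by simpa using h1, by simp, ?_⟩
          rw [List.forall_mem_cons] at h3 ⊢
          refine ⟨⟨by simp, h3.1.2.1, ?_, h3.1.2.2.2⟩, h3.2⟩
          exact List.forall_mem_cons.2 ⟨ha, h3.1.2.2.1⟩
      | cons b q =>
        refine ⟨[], ([a], b :: q) :: L, by simpa using h1, by simp, ?_⟩
        exact List.forall_mem_cons.2 ⟨⟨by simp, by simp, by simpa using ha, h2⟩, h3⟩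
    · exact ⟨a :: q, L, by simpa using h1, List.forall_mem_cons.2 ⟨ha, h2⟩, h3⟩

/-- Rotate `l` to end outside `p` and append the leading block outside `p` to the last block, where
it belongs cyclically. The element `d` ensures that there is at least one pair of blocks. -/
theorem _root_.List.exists_blocks (p : α → Prop) {l : List α} {d z : α} (hd : d ∈ l) (hpd : p d)
    (hz : z ∈ l) (hpz : ¬ p z) : ∃ (n : ℕ) (c q : Fin (n + 1) → List α),
      l.IsRotated (List.ofFn fun i => c i ++ q i).flatten ∧ (∀ i, c i ≠ []) ∧ (∀ i, q i ≠ []) ∧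
      (∀ i, ∀ a ∈ c i, p a) ∧ ∀ i, ∀ a ∈ q i, ¬ p a := by
  obtain ⟨l1, l2, rfl⟩ := List.append_of_mem hz
  have hrot : (l1 ++ z :: l2).IsRotated (l2 ++ l1 ++ [z]) := by
    have := List.isRotated_append (l := l1 ++ [z]) (l' := l2)
    simpa using this
  obtain ⟨q, L, h1, h2, h3⟩ := List.exists_blocks_of_last p (l2 ++ l1) hpz
  rcases List.eq_nil_or_concat' L with rfl | ⟨L', x, rfl⟩
  · refine absurd hpd (h2 d ?_)
    have := hrot.mem_iff.1 hd
    rw [h1] at this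
    simpa using this
  · have h4 : ∀ y ∈ L' ++ [(x.1, x.2 ++ q)], y.1 ≠ [] ∧ y.2 ≠ [] ∧ (∀ a ∈ y.1, p a) ∧
        ∀ a ∈ y.2, ¬ p a := by
      intro y hy
      rcases List.mem_append.1 hy with hy | hy
      · exact h3 y (List.mem_append_left _ hy)
      · obtain rfl := List.mem_singleton.1 hy
        obtain ⟨e1, e2, e3, e4⟩ := h3 x (by simp)
        refine ⟨e1, by simp [e2], e3, fun a ha => ?_⟩
        rcases List.mem_append.1 ha with ha | ha
        exacts [e4 a ha, h2 a ha]
    have hrot' : (l1 ++ z :: l2).IsRotated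
        ((L' ++ [(x.1, x.2 ++ q)]).map fun y => y.1 ++ y.2).flatten := by
      refine hrot.trans ?_
      rw [h1]
      have := List.isRotated_append (l := q)
        (l' := ((L' ++ [x]).map fun y => y.1 ++ y.2).flatten)
      simpa using this
    generalize hM : L' ++ [(x.1, x.2 ++ q)] = M at h4 hrot'
    obtain ⟨y, M', rfl⟩ := List.exists_cons_of_ne_nil (l := M) (by rintro rfl; simp at hM)
    have hof : (List.ofFn fun i : Fin (M'.length + 1) =>
        ((y :: M').get i).1 ++ ((y :: M').get i).2) = (y :: M').map fun y => y.1 ++ y.2 := by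
      conv_rhs => rw [← List.ofFn_get (y :: M'), List.map_ofFn]
      rfl
    have h5 := fun i : Fin (M'.length + 1) => h4 _ (List.get_mem (y :: M') i)
    refine ⟨M'.length, fun i => ((y :: M').get i).1, fun i => ((y :: M').get i).2, ?_,
      fun i => (h5 i).1, fun i => (h5 i).2.1, fun i => (h5 i).2.2.1, fun i => (h5 i).2.2.2⟩
    rw [hof]
    exact hrot'

/-- Brings two cyclically consecutive blocks to the front; `n + 2` makes them different blocks. -/
theorem _root_.List.flatten_ofFn_isRotated {n : ℕ} (f : Fin (n + 2) → List α) (i : Fin (n + 2)) :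
    ∃ r, (List.ofFn f).flatten.IsRotated (f i ++ f (i + 1) ++ r) := by
  have h : (List.ofFn fun j => f (i + j)) =
      f i :: f (i + 1) :: List.ofFn fun j : Fin n => f (i + j.succ.succ) := by
    rw [List.ofFn_succ, List.ofFn_succ, add_zero, Fin.succ_zero_eq_one]
  refine ⟨(List.ofFn fun j : Fin n => f (i + j.succ.succ)).flatten, ?_⟩
  have := (List.ofFn_isRotated f i).flatten
  rw [h] at this
  simpa using this

end Lists

theorem cnt_flatten {E : Type*} (L : List (List (E × Bool))) (e : E) :
    cnt L.flatten e = (L.map fun l => cnt l e).sum := by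
  induction L with
  | nil => simp
  | cons l L ih => simp [cnt_append, ih]

open Classical in
theorem cnt_of_nodup {E : Type*} {l : List (E × Bool)} (h : (l.map Prod.fst).Nodup) (e : E) :
    cnt l e = if e ∈ supp l then 1 else 0 := by
  have h1 := cnt_le_one h e
  have h2 := cnt_pos (l := l) (e := e)
  split_ifs with he
  · have := h2.2 he
    omega
  · have := mt h2.1 he
    omega

theorem Wk.start_eq {D X : Type*} {s t : D → X} {u u' v v' : X} {l : List D} (h : Wk s t u l v)
    (h' : Wk s t u' l v') (hl : l ≠ []) : u = u' := by
  cases l with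
  | nil => exact absurd rfl hl
  | cons d l => exact h.1.symm.trans h'.1

variable {V E : Type*} {G : SignedGraph V E}

namespace CycleTree

variable {T : G.CycleTree}

variable (T) in
/-- The edges of the end-block cycles. -/
def endEdges : Set E := {e | ∃ C, T.IsEndBlock C ∧ e ∈ C}

theorem mem_interVerts_of_ne {C : Set E} (hC : C ∈ T.cycles) {v : V} (hv : v ∈ G.verts C)
    {y : E × Bool} (hy : y ∈ G.star T.edges v) (hyC : y.1 ∉ C) : v ∈ T.interVerts := by
  by_contra hi
  rw [T.star_eq_of_not_inter hC hv hi] at hy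
  exact hyC hy.1

/-- Different end-block cycles have no common vertex unless `T` is a circuit, so a walk on their
edges cannot pass from one to another. -/
theorem mem_endBlock_of_wk (hT : T.IsEulerian) (hnc : ¬ T.IsCircuit) {C : Set E}
    (hC : T.IsEndBlock C) {u v : V} {l : List (E × Bool)} (h : Wk G.src G.tgt u l v)
    (hl : ∀ d ∈ l, d.1 ∈ T.endEdges) (hu : u ∈ G.verts C) : ∀ d ∈ l, d.1 ∈ C := by
  induction l generalizing u with
  | nil => simp
  | cons d l ih =>
    obtain ⟨rfl, h⟩ := h
    obtain ⟨C', hC', hd⟩ := hl d (by simp)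
    obtain rfl : C = C' := by
      by_contra hne
      exact hnc (isCircuit_of_endBlocks hT hC hC' hne hu (src_mem_verts hd))
    exact List.forall_mem_cons.2
      ⟨hd, ih h (fun x hx => hl x (List.mem_cons_of_mem _ hx)) (tgt_mem_verts hd)⟩

/-- Otherwise the tour would stay on one cycle, so `T` would be this cycle and thus a circuit. -/
theorem IsEulerTour.exists_not_mem_endEdges (hT : T.IsEulerian) (hnc : ¬ T.IsCircuit)
    {W : List (E × Bool)} (hW : T.IsEulerTour W) : ∃ d ∈ W, d.1 ∉ T.endEdges := by
  by_contra! hcon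
  obtain ⟨u, hu⟩ := hW.1
  obtain ⟨e, b, hb⟩ : (SignedGraph.supp W).Nonempty := hW.supp ▸ T.connected.1
  obtain ⟨d, W, rfl⟩ := List.exists_cons_of_ne_nil (List.ne_nil_of_mem hb)
  obtain ⟨C, hC, hd⟩ := hcon d (by simp)
  have hv : u ∈ G.verts C := hu.1 ▸ src_mem_verts hd
  refine hnc (isCircuit_of_cycle hT hC.1.1 (Set.Subset.antisymm ?_ hC.1.2))
  rw [← hW.supp]
  rintro e' ⟨b', hb'⟩
  exact mem_endBlock_of_wk hT hnc hC hu hcon hv _ hb'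

theorem IsEulerTour.exists_mem_endEdges [Fintype E] (hT : T.IsEulerian) (hnc : ¬ T.IsCircuit)
    {W : List (E × Bool)} (hW : T.IsEulerTour W) : ∃ d ∈ W, d.1 ∈ T.endEdges := by
  obtain ⟨u, hu⟩ := hW.1
  have hne : W ≠ [] := by
    rintro rfl
    have := T.connected.1
    rw [← hW.supp] at this
    simp at this
  obtain ⟨C, hC, e, ⟨b, hb⟩, he⟩ := IsEulerTour.exists_endBlock hT hnc (l1 := []) (l3 := [])
    (by simpa using hW) hne hu
  exact ⟨_, hb, C, hC, he⟩

/-- A maximal segment of a tour on the end-block cycles goes once around one of them. -/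
theorem IsEulerTour.isCycleWalk (hT : T.IsEulerian) (hnc : ¬ T.IsCircuit)
    {c q q' : List (E × Bool)} {y z : E × Bool} (hW : T.IsEulerTour (c ++ (y :: q)))
    (hq : y :: q = q' ++ [z]) (hc : c ≠ []) (hcE : ∀ d ∈ c, d.1 ∈ T.endEdges)
    (hy : y.1 ∉ T.endEdges) (hz : z.1 ∉ T.endEdges) :
    ∃ u, G.IsCycleWalk u c ∧ u ∈ T.interVerts ∧ T.IsEndBlock (SignedGraph.supp c) := by
  obtain ⟨u, hu⟩ := hW.1
  obtain ⟨a, h1, h2⟩ := wk_append.1 hu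
  obtain ⟨d, c', hdc⟩ := List.exists_cons_of_ne_nil hc
  obtain ⟨C, hC, hdC⟩ := hcE d (by simp [hdc])
  have huC : u ∈ G.verts C := by
    rw [hdc] at h1
    exact h1.1 ▸ src_mem_verts hdC
  have hcC := mem_endBlock_of_wk hT hnc hC h1 hcE huC
  have haC : a ∈ G.verts C := by
    obtain ⟨c'', d', hd'⟩ := (List.eq_nil_or_concat' c).resolve_left hc
    rw [hd'] at h1
    exact h1.last ▸ tgt_mem_verts (hcC d' (by simp [hd']))
  have hne : ∀ x : E × Bool, x.1 ∉ T.endEdges → x.1 ∉ C := fun x hx hxC => hx ⟨C, hC, hxC⟩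
  have hai : a ∈ T.interVerts := by
    refine mem_interVerts_of_ne hC.1 haC ⟨?_, h2.1⟩ (hne y hy)
    rw [← hW.supp]
    exact fst_mem_supp (by simp)
  have hui : u ∈ T.interVerts := by
    rw [hq] at h2
    refine mem_interVerts_of_ne hC.1 huC (y := flip z) ⟨?_, h2.last⟩ (hne z hz)
    rw [← hW.supp, hq]
    exact fst_mem_supp (d := z) (by simp)
  -- At both ends of the segment an edge outside `C` is attached, so both are the only intersection
  -- vertex of `C` and the segment is closed.
  obtain rfl := hC.unique huC hui haC hai
  have hsub : SignedGraph.supp c ⊆ C := by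
    rintro e ⟨b, hb⟩
    exact hcC _ hb
  have hn : (c.map Prod.fst).Nodup := by
    classical
    refine List.nodup_iff_count_le_one.2 fun e => ?_
    by_cases he : e ∈ C
    · have h3 := hW.2 e
      rw [T.indicator_cycle hC.1 he, cnt_append] at h3
      have : cnt c e ≤ 1 := by omega
      rw [cnt] at this
      convert this
    · have : e ∉ c.map Prod.fst := fun h => he (hsub (mem_supp.2 h))
      rw [List.count_eq_zero_of_not_mem this]
      exact Nat.zero_le _
  -- A closed walk on `C` without repeated edges contains a cycle, which must be all of `C`.
  have key : ∀ (l : List (E × Bool)) (w : V), l ≠ [] → (l.map Prod.fst).Nodup →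
      Wk G.src G.tgt w l w → SignedGraph.supp l ⊆ C → SignedGraph.supp l = C := by
    intro l w h0 h1 h2 h3
    obtain ⟨C', hC', hs⟩ := exists_cycle_of_closed h2 h0 h1
    exact h3.antisymm (hC'.eq_of_subset hC.1.1 (hs.trans h3) ▸ hs)
  have hs := key c u hc hn h1 hsub
  refine ⟨u, isCycleWalk_iff.2 ⟨hc, h1, ?_, hn⟩, hui, hs ▸ hC⟩
  -- A closed piece after the first step would use all edges of `C`, among them that of the first
  -- step.
  by_contra hdup
  rw [hdc] at hdup h1 hn
  obtain ⟨l1, l2, l3, w, rfl, h0, -, h4, -⟩ := h1.2.exists_closed_infix hdup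
  simp only [List.map_cons, List.map_append, List.nodup_cons, List.nodup_append] at hn
  have h5 := key l2 w h0 hn.2.1.2.1 h4 fun e he => hsub (hdc ▸ supp_mono (by intro; simp; tauto) he)
  rw [← h5, mem_supp] at hdC
  exact hn.1 (by simp only [List.mem_append]; tauto)

end CycleTree

end SignedGraph

/-! ### Decomposition of a minimum walk into circuits of Type III -/

namespace SignedGraph

variable {V E : Type*} {G : SignedGraph V E}

namespace CycleTree

variable {T : G.CycleTree}

theorem verts_inter_endBlock {C : Set E} (hC : T.IsEndBlock C) {w : V} (hw : w ∈ G.verts C)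
    (hwi : w ∈ T.interVerts) {P : G.SimplePath} (hPT : P.edges ⊆ T.edges)
    (hPE : ∀ e ∈ P.edges, e ∉ T.endEdges) (hwP : w ∈ P.verts) : P.verts ∩ G.verts C = {w} := by
  ext v
  constructor
  · rintro ⟨hvP, hv⟩
    obtain ⟨x, hx⟩ := mem_verts.1 hvP
    exact hC.unique hv (mem_interVerts_of_ne hC.1 hv (star_mono hPT v hx)
      fun h => hPE _ hx.1 ⟨C, hC, h⟩) hw hwi
  · rintro rfl
    exact ⟨hwP, hw⟩

open Classical in
theorem cnt_decomposition {n : ℕ} {c : Fin n → List (E × Bool)} {P : Fin n → G.SimplePath}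
    {W : List (E × Bool)} (hrot : W.IsRotated (List.ofFn fun i => c i ++ (P i).steps).flatten)
    (hc : ∀ i, G.IsCycleWalk (P i).init (c i)) (e : E) :
    cnt W e = (Finset.univ.filter fun i => e ∈ supp (c i)).card +
      (Finset.univ.filter fun i => e ∈ (P i).edges).card := by
  rw [cnt_perm hrot.perm, cnt_flatten, List.map_ofFn, List.sum_ofFn, Finset.card_filter,
    Finset.card_filter, ← Finset.sum_add_distrib]
  refine Finset.sum_congr rfl fun i _ => ?_
  rw [Function.comp_apply, cnt_append, cnt_of_nodup (isCycleWalk_iff.1 (hc i)).2.2.2,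
    cnt_of_nodup (P i).nodup_edges]
  rfl

theorem indicator_typeIII {D : G.CycleTree} {C₁ C₂ : Set E} {P : G.SimplePath}
    (hp : D.paths = {P}) (hc : D.cycles = {C₁, C₂}) (hne : C₁ ≠ C₂) (e : E)
    [Decidable (e ∈ C₁)] [Decidable (e ∈ C₂)] [Decidable (e ∈ P.edges)] :
    D.indicator e = (if e ∈ C₁ then 1 else 0) + (if e ∈ C₂ then 1 else 0) +
      2 * if e ∈ P.edges then 1 else 0 := by
  have h1 : C₁ ∈ D.cycles := by simp [hc]
  have h2 : C₂ ∈ D.cycles := by simp [hc]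
  have h3 : P ∈ D.paths := by simp [hp]
  have h12 : e ∈ C₁ → e ∉ C₂ := fun h h' => hne (D.cycle_eq h1 h2 h h')
  have hP1 : e ∈ P.edges → e ∉ C₁ := D.path_not_mem_cycle h3 h1
  have hP2 : e ∈ P.edges → e ∉ C₂ := D.path_not_mem_cycle h3 h2
  rw [indicator, hc, hp]
  by_cases e1 : e ∈ C₁
  · simp [e1, h12 e1, mt hP1 (not_not.2 e1)]
  · by_cases e2 : e ∈ C₂
    · simp [e1, e2, mt hP2 (not_not.2 e2)]
    · simp [e1, e2]

variable [Fintype E]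

/-- A repeated vertex would close a piece of the segment, and by `exists_endBlock` this piece would
contain an edge of an end-block cycle. -/
theorem IsEulerTour.nodup_of_not_mem_endEdges (hT : T.IsEulerian) (hnc : ¬ T.IsCircuit)
    {l1 p l3 : List (E × Bool)} (hW : T.IsEulerTour (l1 ++ p ++ l3))
    (hp : ∀ d ∈ p, d.1 ∉ T.endEdges) {u v : V} (h : Wk G.src G.tgt u p v) :
    (u :: p.map G.tgt).Nodup := by
  by_contra hn
  obtain ⟨a, m, b, w, rfl, hm, -, hw, -⟩ := h.exists_closed_infix hn
  obtain ⟨C, hC, e, ⟨i, hi⟩, he⟩ := IsEulerTour.exists_endBlock hT hnc (l1 := l1 ++ a)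
    (l3 := b ++ l3) (by simpa using hW) hm hw
  exact hp (e, i) (by simp [hi]) ⟨C, hC, he⟩

theorem IsEulerTour.arrow_ne_of_path {δ : G.Orientation} (hδ : δ.IsDirection T)
    {P : G.SimplePath} {l1 l3 : List (E × Bool)} (hW : T.IsEulerTour (l1 ++ P.steps ++ l3))
    {d d' : E × Bool} (hd : d ∈ P.steps) (hd' : d' ∈ P.steps) (h : G.tgt d = G.src d') :
    δ.arrow (flip d).1 (flip d).2 ≠ δ.arrow d'.1 d'.2 := by
  obtain ⟨a, b, hab⟩ := List.append_of_mem hd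
  have hwk := P.wk
  rw [hab] at hwk
  obtain ⟨w, -, hw⟩ := wk_append.1 hwk
  cases b with
  | nil => exact absurd (h.symm.trans hw.2) (P.src_ne_term hd')
  | cons x b =>
    obtain rfl : x = d' := P.eq_of_src (by simp [hab]) hd' (hw.2.1.trans h)
    refine IsEulerTour.arrow_ne hδ (l := b ++ l3 ++ (l1 ++ a)) (hW.of_isRotated ?_)
    rw [hab]
    have := List.isRotated_append (l := l1 ++ a) (l' := d :: x :: (b ++ l3))
    simpa using this

/-- The decomposition of a tour of an Eulerian cycle-tree into end-block cycles and paths. -/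
theorem IsEulerTour.exists_decomposition (hT : T.IsEulerian) (hnc : ¬ T.IsCircuit)
    {W : List (E × Bool)} (hW : T.IsEulerTour W) :
    ∃ (n : ℕ) (c : Fin (n + 2) → List (E × Bool)) (P : Fin (n + 2) → G.SimplePath),
      W.IsRotated (List.ofFn fun i => c i ++ (P i).steps).flatten ∧
      (∀ i, G.IsCycleWalk (P i).init (c i)) ∧
      (∀ i, (P i).term = (P (i + 1)).init) ∧
      (∀ i, (P i).init ∈ T.interVerts) ∧
      (∀ i, T.IsEndBlock (SignedGraph.supp (c i))) ∧
      (∀ i, ∀ e ∈ (P i).edges, e ∉ T.endEdges) := by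
  obtain ⟨d, hd, hdE⟩ := hW.exists_mem_endEdges hT hnc
  obtain ⟨z, hz, hzE⟩ := hW.exists_not_mem_endEdges hT hnc
  obtain ⟨n, c, q, hrot, hc, hq, hcE, hqE⟩ :=
    List.exists_blocks (fun d : E × Bool => d.1 ∈ T.endEdges) hd hdE hz hzE
  -- Here `p₀` precedes the segment `c₀` and `r` is the rest of the tour. The step after `c₀` is the
  -- head of `r`, or that of `p₀` if `r` is empty.
  have hcyc : ∀ {c₀ p₀ r : List (E × Bool)}, T.IsEulerTour (p₀ ++ c₀ ++ r) → p₀ ≠ [] →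
      c₀ ≠ [] → (∀ d ∈ c₀, d.1 ∈ T.endEdges) → (∀ d ∈ p₀, d.1 ∉ T.endEdges) →
      (∀ d ∈ r.head?, d.1 ∉ T.endEdges) →
      ∃ u, G.IsCycleWalk u c₀ ∧ u ∈ T.interVerts ∧ T.IsEndBlock (SignedGraph.supp c₀) := by
    intro c₀ p₀ r h h0 h1 h2 h3 h4
    obtain ⟨p₁, z, hz⟩ := (List.eq_nil_or_concat' p₀).resolve_left h0
    obtain ⟨y, r', hy⟩ := List.exists_cons_of_ne_nil (l := r ++ p₀) (by simp [h0])
    refine IsEulerTour.isCycleWalk hT hnc (c := c₀) (y := y) (q := r') (q' := r ++ p₁) (z := z)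
      ?_ ?_ h1 h2 ?_ (h3 z (by simp [hz]))
    · rw [← hy]
      refine h.of_isRotated ?_
      have := List.isRotated_append (l := p₀) (l' := c₀ ++ r)
      simpa using this
    · rw [← hy, hz]
      simp
    · cases r with
      | nil =>
        refine h3 y ?_
        have : p₀ = y :: r' := hy
        simp [this]
      | cons x r =>
        obtain ⟨rfl, -⟩ := List.cons.inj hy
        exact h4 x (by simp)
  cases n with
  | zero =>
    -- With a single pair of segments the path would return to the base of its cycle, but it repeats
    -- no vertex. This is what gives `k ≥ 1`.
    have h1 : T.IsEulerTour (c 0 ++ q 0) := hW.of_isRotated (by simpa using hrot)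
    have h2 : T.IsEulerTour (q 0 ++ c 0 ++ []) := by
      refine h1.of_isRotated ?_
      simpa using List.isRotated_append
    obtain ⟨u, h3, -, -⟩ := hcyc h2 (hq 0) (hc 0) (hcE 0) (hqE 0) (by simp)
    obtain ⟨w, hw⟩ := h1.1
    obtain ⟨a, ha, hb⟩ := wk_append.1 hw
    have h4 := (isCycleWalk_iff.1 h3).2.1
    obtain rfl := ha.start_eq h4 (hc 0)
    obtain rfl := ha.eq_end h4
    have := IsEulerTour.nodup_of_not_mem_endEdges hT hnc (l3 := [])
      (by simpa using h1) (hqE 0) hb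
    obtain ⟨l, x, hl⟩ := (List.eq_nil_or_concat' (q 0)).resolve_left (hq 0)
    rw [hl] at hb this
    rw [← hb.last] at this
    simp at this
  | succ n =>
    have htour : ∀ i, ∃ r, T.IsEulerTour (c i ++ q i ++ (c (i + 1) ++ q (i + 1)) ++ r) := by
      intro i
      obtain ⟨r, hr⟩ := List.flatten_ofFn_isRotated (fun i => c i ++ q i) i
      exact ⟨r, hW.of_isRotated (hrot.trans hr)⟩
    have hcyc' : ∀ i, ∃ u, G.IsCycleWalk u (c i) ∧ u ∈ T.interVerts ∧
        T.IsEndBlock (SignedGraph.supp (c i)) := by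
      intro i
      obtain ⟨r, hr⟩ := htour (i - 1)
      rw [sub_add_cancel] at hr
      have h2 : T.IsEulerTour (q (i - 1) ++ c i ++ (q i ++ (r ++ c (i - 1)))) := by
        refine hr.of_isRotated ?_
        have := List.isRotated_append (l := c (i - 1)) (l' := q (i - 1) ++ (c i ++ (q i ++ r)))
        simpa using this
      refine hcyc h2 (hq _) (hc i) (hcE i) (hqE _) ?_
      obtain ⟨x, l, hx⟩ := List.exists_cons_of_ne_nil (hq i)
      have h3 := hqE i x (by simp [hx])
      simpa [hx] using h3
    choose u hu hui hub using hcyc'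
    have hwk : ∀ i, Wk G.src G.tgt (u i) (q i) (u (i + 1)) := by
      intro i
      obtain ⟨r, ⟨w, hr⟩, -⟩ := htour i
      obtain ⟨b, h1, -⟩ := wk_append.1 hr
      obtain ⟨a, h2, h3⟩ := wk_append.1 h1
      obtain ⟨a', h4, -⟩ := wk_append.1 h3
      obtain ⟨w', h5, h6⟩ := wk_append.1 h2
      have h7 := (isCycleWalk_iff.1 (hu i)).2.1
      obtain rfl := h5.start_eq h7 (hc i)
      obtain rfl := h5.eq_end h7
      obtain rfl := h4.start_eq (isCycleWalk_iff.1 (hu (i + 1))).2.1 (hc _)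
      exact h6
    let P : Fin (n + 2) → G.SimplePath := fun i =>
      { init := u i
        term := u (i + 1)
        steps := q i
        isWalk := isWalk_iff.2 (hwk i)
        nodup := by
          obtain ⟨r, hr⟩ := htour i
          exact IsEulerTour.nodup_of_not_mem_endEdges hT hnc (l1 := c i)
            (l3 := c (i + 1) ++ q (i + 1) ++ r) (by simpa using hr) (hqE i) (hwk i)
        pos := hq i }
    refine ⟨n, c, P, hrot, hu, fun i => rfl, hui, hub, ?_⟩
    rintro i e ⟨b, hb⟩
    exact hqE i _ hb

/-- A closed walk of minimum length that covers an Eulerian cycle-tree consists of the end-block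
cycles and of simple paths between them, which form circuits of Type III. -/
theorem exists_typeIII_decomposition [Finite V] (hT : T.IsEulerian) (hnc : ¬ T.IsCircuit)
    {W : List (E × Bool)} (hmin : G.IsMinCoveringClosedWalk T.edges W) :
    ∃ k : ℕ, 1 ≤ k ∧
      ∃ (c : Fin (k + 1) → List (E × Bool)) (P : Fin (k + 1) → G.SimplePath)
        (D : Fin (k + 1) → G.CycleTree),
        W.IsRotated (List.ofFn fun i => c i ++ (P i).steps).flatten ∧
        (∀ i, G.IsCycleWalk (P i).init (c i)) ∧
        (∀ i, (P i).term = (P (i + 1)).init) ∧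
        (Function.Injective fun i => supp (c i)) ∧
        (∀ C : Set E, T.IsEndBlock C ↔ ∃ i, supp (c i) = C) ∧
        (∀ C ∈ T.cycles, ¬ T.IsEndBlock C → ∀ e ∈ C, ∃! i, e ∈ (P i).edges) ∧
        (∀ Q ∈ T.paths, ∀ e ∈ Q.edges, {i | e ∈ (P i).edges}.ncard = 2) ∧
        (∀ i, (D i).IsTypeIII (supp (c i)) (P i) (supp (c (i + 1)))) ∧
        (∀ δ : G.Orientation, δ.IsDirection T → ∀ i, δ.IsDirection (D i)) ∧
        ∀ e, (T.indicator e : ℚ) = 1 / 2 * ∑ i, ((D i).indicator e : ℚ) := by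
  classical
  have hW := T.isEulerTour_of_min hmin
  obtain ⟨n, c, P, hrot, hcyc, hterm, hinit, hend, hPE⟩ := hW.exists_decomposition hT hnc
  -- The uses of an edge, as many as the indicator says, are distributed over cycles and paths. An
  -- end-block edge is on no path and any other edge on no `c i`, so all counting claims follow from
  -- this identity.
  have hcnt : ∀ e, T.indicator e = ((Finset.univ.filter fun i => e ∈ supp (c i)).card : ℤ) +
      (Finset.univ.filter fun i => e ∈ (P i).edges).card := by
    intro e
    rw [← hW.2 e, cnt_decomposition hrot hcyc]
    push_cast
    rfl
  have hcW : ∀ {e}, e ∈ T.endEdges → (Finset.univ.filter fun i => e ∈ (P i).edges).card = 0 := by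
    intro e he
    rw [Finset.card_eq_zero, Finset.filter_eq_empty_iff]
    exact fun i _ h => hPE i e h he
  have hpW : ∀ {e}, e ∉ T.endEdges → (Finset.univ.filter fun i => e ∈ supp (c i)).card = 0 := by
    intro e he
    rw [Finset.card_eq_zero, Finset.filter_eq_empty_iff]
    exact fun i _ h => he ⟨_, hend i, h⟩
  have hone : ∀ {C e}, T.IsEndBlock C → e ∈ C →
      (Finset.univ.filter fun i => e ∈ supp (c i)).card = 1 := by
    intro C e hC he
    have h := hcnt e
    rw [hcW ⟨C, hC, he⟩, T.indicator_cycle hC.1 he] at h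
    omega
  have hinj : Function.Injective fun i => supp (c i) := by
    intro i j hij
    obtain ⟨e, he⟩ := (hend i).1.1.nonempty
    refine Finset.card_le_one.1 (hone (hend i) he).le i ?_ j ?_
    · simpa using he
    · have h : supp (c i) = supp (c j) := hij
      simpa [← h] using he
  have hPT : ∀ i, (P i).edges ⊆ T.edges := by
    intro i
    rw [← hW.supp, supp_perm hrot.perm]
    refine supp_mono fun d hd => ?_
    simp only [List.mem_flatten, List.mem_ofFn]
    exact ⟨_, ⟨i, rfl⟩, List.mem_append_right _ hd⟩
  have hnext : ∀ i : Fin (n + 2), i ≠ i + 1 := by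
    intro i h
    exact one_ne_zero (left_eq_add.1 h)
  have hne : ∀ i, supp (c i) ≠ supp (c (i + 1)) := fun i h => hnext i (hinj h)
  have hv : ∀ i, (P i).init ∈ G.verts (supp (c i)) := by
    intro i
    obtain ⟨h1, h2, -⟩ := isCycleWalk_iff.1 (hcyc i)
    obtain ⟨d, l, hl⟩ := List.exists_cons_of_ne_nil h1
    rw [hl] at h2 ⊢
    exact h2.1 ▸ src_mem_verts (fst_mem_supp (by simp))
  -- Consecutive cycles are unbalanced, because they have one intersection vertex, and disjoint,
  -- because `T` is not a circuit.
  have hD : ∀ i, ∃ D : G.CycleTree, D.paths = {P i} ∧ D.cycles = {supp (c i), supp (c (i + 1))} ∧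
      D.IsTypeIII (supp (c i)) (P i) (supp (c (i + 1))) := by
    intro i
    refine exists_typeIII (hend i).1.1 (hend (i + 1)).1.1 ((hend i).sign hT)
      ((hend (i + 1)).sign hT) (Set.disjoint_left.2 fun v h1 h2 =>
        hnc (isCircuit_of_endBlocks hT (hend i) (hend (i + 1)) (hne i) h1 h2)) ?_ ?_
    · exact verts_inter_endBlock (hend i) (hv i) (hinit i) (hPT i) (hPE i) (P i).init_mem
    · exact verts_inter_endBlock (hend (i + 1)) (hterm i ▸ hv (i + 1)) (hterm i ▸ hinit (i + 1))
        (hPT i) (hPE i) (P i).term_mem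
  choose D hDp hDc hDIII using hD
  refine ⟨n + 1, by omega, c, P, D, hrot, hcyc, hterm, hinj, ?_, ?_, ?_, hDIII, ?_, ?_⟩
  · refine fun C => ⟨fun hC => ?_, fun ⟨i, hi⟩ => hi ▸ hend i⟩
    obtain ⟨e, he⟩ := hC.1.1.nonempty
    obtain ⟨i, hi⟩ := Finset.card_pos.1 ((hone hC he).symm ▸ Nat.one_pos)
    exact ⟨i, T.cycle_eq (hend i).1 hC.1 (by simpa using hi) he⟩
  · intro C hC hCe e he
    have h := hcnt e
    rw [hpW, T.indicator_cycle hC he] at h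
    · obtain ⟨i, hi⟩ := Finset.card_eq_one.1
        (show (Finset.univ.filter fun i => e ∈ (P i).edges).card = 1 by omega)
      have key : ∀ j, e ∈ (P j).edges ↔ j = i := fun j => by
        simpa using congrArg (j ∈ ·) hi
      exact ⟨i, (key i).2 rfl, fun j hj => (key j).1 hj⟩
    · rintro ⟨C', hC', he'⟩
      exact hCe (T.cycle_eq hC hC'.1 he he' ▸ hC')
  · intro Q hQ e he
    have h := hcnt e
    rw [hpW, T.indicator_path hQ he] at h
    · rw [Set.ncard_eq_toFinset_card', Set.toFinset_ofPred]
      have h2 : (Finset.univ.filter fun i => e ∈ (P i).edges).card = 2 := by omega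
      convert h2
    · rintro ⟨C, hC, he'⟩
      exact T.path_not_mem_cycle hQ hC.1 he he'
  · intro δ hδ i
    refine isDirection_restrict hδ (hDc i) (hDIII i) (hend i) (hend (i + 1)) (hinit i)
      (hterm i ▸ hinit (i + 1)) (hPT i) fun d hd d' hd' h => ?_
    obtain ⟨r, hr⟩ := List.flatten_ofFn_isRotated (fun i => c i ++ (P i).steps) i
    refine IsEulerTour.arrow_ne_of_path hδ (P := P i) (l1 := c i)
      (l3 := c (i + 1) ++ (P (i + 1)).steps ++ r) ?_ hd hd' h
    simpa using hW.of_isRotated (hrot.trans hr)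
  · intro e
    -- Each end-block cycle lies in two cyclically consecutive circuits, and each path has weight
    -- two in its circuit, so the indicators of the circuits add up to twice that of `T`.
    have hshift : ∑ i, (if e ∈ supp (c (i + 1)) then (1 : ℤ) else 0) =
        ∑ i, if e ∈ supp (c i) then 1 else 0 :=
      Equiv.sum_comp (Equiv.addRight (1 : Fin (n + 2))) fun i => if e ∈ supp (c i) then (1 : ℤ) else 0
    have h1 : ∑ i, (D i).indicator e = 2 * T.indicator e := by
      rw [Finset.sum_congr rfl fun i _ => indicator_typeIII (hDp i) (hDc i) (hne i) e,
        Finset.sum_add_distrib, Finset.sum_add_distrib, ← Finset.mul_sum, hcnt, hshift]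
      simp only [Finset.sum_boole]
      ring
    rw [← Int.cast_sum, h1]
    push_cast
    ring

end CycleTree

end SignedGraph

/-- Classification of indecomposable integral flows on signed graphs. In part (b), the walk `c i`
goes once around the end-block cycle `C_i`, the path `P i` is `P_{i+1}`, the indices are cyclic
(`i : Fin (k + 1)`), and `D i` is the circuit `C_i P_{i+1} C_{i+1}`. -/
theorem mainTheorem1 {V E : Type*} [Finite V] [Fintype E] (G : SignedGraph V E)
    (ε : G.Orientation) :
    (∀ f : E → ℤ, ε.IsFlow f →
      (ε.IsIndecomposable f ↔
        ∃ T : G.CycleTree, T.IsEulerian ∧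
          ∀ e, f e = ε.coupling (ε.ofFun f) e * T.indicator e)) ∧
    (∀ T : G.CycleTree, T.IsEulerian → ¬ T.IsCircuit →
      ∀ W : List (E × Bool), G.IsMinCoveringClosedWalk T.edges W →
      ∃ k : ℕ, 1 ≤ k ∧
      ∃ (c : Fin (k + 1) → List (E × Bool)) (P : Fin (k + 1) → G.SimplePath)
        (D : Fin (k + 1) → G.CycleTree),
        W.IsRotated (List.ofFn fun i => c i ++ (P i).steps).flatten ∧
        (∀ i, G.IsCycleWalk (P i).init (c i)) ∧
        (∀ i, (P i).term = (P (i + 1)).init) ∧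
        (Function.Injective fun i => SignedGraph.supp (c i)) ∧
        (∀ C : Set E, T.IsEndBlock C ↔ ∃ i, SignedGraph.supp (c i) = C) ∧
        (∀ C ∈ T.cycles, ¬ T.IsEndBlock C → ∀ e ∈ C, ∃! i, e ∈ (P i).edges) ∧
        (∀ Q ∈ T.paths, ∀ e ∈ Q.edges, {i | e ∈ (P i).edges}.ncard = 2) ∧
        (∀ i, (D i).IsTypeIII (SignedGraph.supp (c i)) (P i) (SignedGraph.supp (c (i + 1)))) ∧
        (∀ δ : G.Orientation, δ.IsDirection T → ∀ i, δ.IsDirection (D i)) ∧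
        ∀ e, (T.indicator e : ℚ) = 1 / 2 * ∑ i, ((D i).indicator e : ℚ)) := by
  exact ⟨fun f hf => SignedGraph.Orientation.isIndecomposable_iff hf,
    fun T hT hnc W hW => SignedGraph.CycleTree.exists_typeIII_decomposition hT hnc hW⟩
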